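/- Let $G$ be a compact connected Lie group with normalized Haar measure, fix a bi-invariant Riemannian metric on $G$, and let $X_1,\dots,X_n$ be a basis of left-invariant vector fields which is orthonormal for it, so that $\mathcal L_G=-(X_1^2+\dots+X_n^2)$ is the positive Laplace–Beltrami operator; put $\nabla_G f=(X_1f,\dots,X_nf)$. For a continuous irreducible unitary matrix representation $\xi$ of $G$, of dimension $d_\xi$, let $\nu_\xi\ge 0$ be the eigenvalue of $\mathcal L_G$ on the matrix coefficients of $\xi$ and $\langle\xi\rangle=\sqrt{1+\nu_\xi}$. For a distribution $u$ on $G$ let $\widehat u(\xi)=\langle u,\xi^*\rangle\in\mathbb C^{d_\xi\times d_\xi}$, and let $H^s(G)$, $s\in\mathbb R$, be the space of distributions with $\|u\|_{H^s}^2=\sum_{[\xi]\in\widehat G}d_\xi\langle\xi\rangle^{2s}\|\widehat u(\xi)\|_{\mathrm{HS}}^2<\infty$, with the corresponding inner product. For a left-invariant continuous linear operator $P:C^\infty(G)\to C^\infty(G)$ its symbol is $\sigma_P(\xi)=\xi(x)^*(P\xi)(x)$, which does not depend on $x\in G$; $P$ has order $m\in\mathbb R$ if for every $s\in\mathbb R$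 it extends to a bounded operator $H^{m+s}(G)\to H^s(G)$. In that case $P|_{H^1}:H^1(G)\to H^{1-m}(G)$ denotes the extension, and $(\ker P|_{H^1})^\perp\subset H^1(G)$ the orthogonal complement of its kernel in $H^1(G)$. For a matrix $A\ne0$ let $\lambda^{>0}_{\min}[A]$ be its smallest non-zero singular value. The $L^2$ norm of a distribution that is not in $L^2(G)$ is $\infty$. Let $\delta\ge 1$. (a) Let $Y=\alpha_1X_1+\dots+\alpha_nX_n$, $\alpha\in\mathbb R^n$, be a real left-invariant vector field. There exists $c>0$ such that $$\|\nabla_G f\|_{L^2(G)}^{\delta-1}\,\|Yf\|_{L^2(G)}\ \ge\ c\,\|f\|_{L^2(G)}^{\delta}\qquad\text{for every } f\in(\ker Y|_{H^1})^\perp$$ if and only if there exists $C>0$ such that $$\lambda^{>0}_{\min}[\sigma_Y(\xi)]\ \ge\ C\,\langle\xi\rangle^{-(\delta-1)}\qquad\text{for all } [\xi]\in\widehat G \text{ with } \sigma_Y(\xi)\neq 0 .$$ (b) Let $P:C^\infty(G)\to C^\infty(G)$ be a left-invariant continuous linear operator of order $m\in\mathbb R$. There exists $c>0$ such that $$\|\nabla_G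 f\|_{L^2(G)}^{\delta-1}\,\|Pf\|_{L^2(G)}\ \ge\ c\,\|f\|_{L^2(G)}^{\delta}$$ for every $f\in(\ker P|_{H^1})^\perp$, where in the case that $\delta>1$ and $P1\neq0$ only those $f$ of mean value zero are considered, if and only if there exists $C>0$ such that $$\lambda^{>0}_{\min}[\sigma_P(\xi)]\ \ge\ C\,\langle\xi\rangle^{-(\delta-1)}\qquad\text{for all } [\xi]\in\widehat G \text{ with } \sigma_P(\xi)\neq 0 .$$ -/

import Mathlib

open MeasureTheory Filter Topology
open scoped Manifold ContDiff ENNReal NNReal Matrix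

noncomputable section

namespace LiePoincare

/-! ### Smooth functions and left-invariant vector fields -/

section Smooth

variable (E : Type*) [NormedAddCommGroup E] [NormedSpace ℝ E]
  (G : Type*) [TopologicalSpace G] [ChartedSpace E G]

/-- The complex vector space of smooth complex-valued functions, inside all functions. -/
def smoothSubmodule : Submodule ℂ (G → ℂ) where
  carrier := {f | ContMDiff 𝓘(ℝ, E) 𝓘(ℝ, ℂ) ∞ f}
  add_mem' hf hg := ContMDiff.add hf hg
  zero_mem' := contMDiff_const
  smul_mem' c _ hf :=
    ((ContinuousLinearMap.mul ℝ ℂ c).contDiff.contMDiff (n := ∞)).comp hf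

/-- `C^∞(G)`, the complex-valued smooth functions.  This is a type of its own, so that it does not
inherit the topology of pointwise convergence. -/
def SmoothFn : Type _ := smoothSubmodule E G

instance : AddCommGroup (SmoothFn E G) := inferInstanceAs (AddCommGroup (smoothSubmodule E G))

instance : Module ℂ (SmoothFn E G) := inferInstanceAs (Module ℂ (smoothSubmodule E G))

instance : CoeFun (SmoothFn E G) (fun _ => G → ℂ) := ⟨fun f => f.1⟩

variable {E G}

theorem SmoothFn.contMDiff (f : SmoothFn E G) : ContMDiff 𝓘(ℝ, E) 𝓘(ℝ, ℂ) ∞ (f : G → ℂ) := f.2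

theorem SmoothFn.mdifferentiableAt (f : SmoothFn E G) (x : G) :
    MDifferentiableAt 𝓘(ℝ, E) 𝓘(ℝ, ℂ) (f : G → ℂ) x :=
  (f.contMDiff x).mdifferentiableAt (by simp)

/-- A smooth function as a continuous function. -/
def SmoothFn.toContinuousMap (f : SmoothFn E G) : C(G, ℂ) := ⟨f, f.contMDiff.continuous⟩

variable (E G) in
/-- The constant function `1`. -/
def SmoothFn.one : SmoothFn E G := ⟨fun _ => 1, contMDiff_const⟩

open scoped Classical in
variable (E) in
/-- A function on `G` as an element of `C^∞(G)` (with the junk value `0` if it is not smooth). It is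
applied to matrix coefficients of representations only, which are smooth. -/
def SmoothFn.ofFun (f : G → ℂ) : SmoothFn E G :=
  if h : ContMDiff 𝓘(ℝ, E) 𝓘(ℝ, ℂ) ∞ f then ⟨f, h⟩ else 0

theorem SmoothFn.integrable_mul [CompactSpace G] [MeasurableSpace G] [BorelSpace G]
    (μ : Measure G) [IsFiniteMeasure μ] (f φ : SmoothFn E G) :
    Integrable (fun x => f x * φ x) μ :=
  (f.contMDiff.continuous.mul φ.contMDiff.continuous).integrable_of_hasCompactSupport
    (HasCompactSupport.of_compactSpace _)

end Smooth

section VectorFields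

variable {E : Type*} [NormedAddCommGroup E] [NormedSpace ℝ E]
  {G : Type*} [TopologicalSpace G] [ChartedSpace E G] [Group G] [LieGroup 𝓘(ℝ, E) ∞ G]

/-- Left translation `f ↦ f(a ·)`. -/
def leftTranslate (a : G) (f : SmoothFn E G) : SmoothFn E G :=
  ⟨fun x => f (a * x), f.contMDiff.comp contMDiff_mul_left⟩

theorem contMDiff_invariantField (v : GroupLieAlgebra 𝓘(ℝ, E) G) :
    ContMDiff 𝓘(ℝ, E) 𝓘(ℝ, E).tangent ∞
      (fun g : G => (⟨g, mulInvariantVectorField v g⟩ : TangentBundle 𝓘(ℝ, E) G)) := by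
  let fg : G → TangentBundle 𝓘(ℝ, E) G := fun g => Bundle.TotalSpace.mk' E g 0
  have sfg : ContMDiff 𝓘(ℝ, E) 𝓘(ℝ, E).tangent ∞ fg := Bundle.contMDiff_zeroSection _ _
  let fv : G → TangentBundle 𝓘(ℝ, E) G := fun _ => Bundle.TotalSpace.mk' E 1 v
  have sfv : ContMDiff 𝓘(ℝ, E) 𝓘(ℝ, E).tangent ∞ fv := contMDiff_const
  let F₁ : G → (TangentBundle 𝓘(ℝ, E) G × TangentBundle 𝓘(ℝ, E) G) := fun g => (fg g, fv g)
  have S₁ : ContMDiff 𝓘(ℝ, E) (𝓘(ℝ, E).tangent.prod 𝓘(ℝ, E).tangent) ∞ F₁ := sfg.prodMk sfv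
  let F₂ : (TangentBundle 𝓘(ℝ, E) G × TangentBundle 𝓘(ℝ, E) G) →
      TangentBundle (𝓘(ℝ, E).prod 𝓘(ℝ, E)) (G × G) :=
    (equivTangentBundleProd 𝓘(ℝ, E) G 𝓘(ℝ, E) G).symm
  have S₂ : ContMDiff (𝓘(ℝ, E).tangent.prod 𝓘(ℝ, E).tangent)
      (𝓘(ℝ, E).prod 𝓘(ℝ, E)).tangent ∞ F₂ := contMDiff_equivTangentBundleProd_symm
  let F₃ : TangentBundle (𝓘(ℝ, E).prod 𝓘(ℝ, E)) (G × G) → TangentBundle 𝓘(ℝ, E) G :=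
    tangentMap (𝓘(ℝ, E).prod 𝓘(ℝ, E)) 𝓘(ℝ, E) (fun (p : G × G) => p.1 * p.2)
  have S₃ : ContMDiff (𝓘(ℝ, E).prod 𝓘(ℝ, E)).tangent 𝓘(ℝ, E).tangent ∞ F₃ :=
    (contMDiff_mul 𝓘(ℝ, E) ∞).contMDiff_tangentMap (m := ∞) (by simp)
  have S := (S₃.comp S₂).comp S₁
  convert! S with g
  · simp [F₁, F₂, F₃, fg, fv]
  · simp only [Function.comp_apply, tangentMap, F₃, F₂, F₁, fg, fv]
    rw [mfderiv_prod_eq_add_apply ((contMDiff_mul 𝓘(ℝ, E) ∞).mdifferentiableAt (by simp))]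
    exact ((congrArg (· + _) (map_zero _)).trans (zero_add _)).symm

/-- The left-invariant vector field with value `v` at the identity, acting as a first-order
differential operator on smooth functions. -/
def leftInvField (v : GroupLieAlgebra 𝓘(ℝ, E) G) : SmoothFn E G →ₗ[ℂ] SmoothFn E G where
  toFun f := ⟨fun x => (mfderiv 𝓘(ℝ, E) 𝓘(ℝ, ℂ) (f : G → ℂ) x (mulInvariantVectorField v x) : ℂ),
    (contMDiff_snd_tangentBundle_modelSpace ℂ 𝓘(ℝ, ℂ)).comp
      ((f.contMDiff.contMDiff_tangentMap (m := ∞) (by simp)).comp (contMDiff_invariantField v))⟩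
  map_add' f g := by
    apply Subtype.ext
    funext x
    have h := mfderiv_add (f.mdifferentiableAt x) (g.mdifferentiableAt x)
    exact congrArg (fun L => L (mulInvariantVectorField v x)) h
  map_smul' c f := by
    apply Subtype.ext
    funext x
    have h := ((ContinuousLinearMap.mul ℝ ℂ c).hasMFDerivAt (x := f x)).comp x
      (f.mdifferentiableAt x).hasMFDerivAt
    exact congrArg (fun L => L (mulInvariantVectorField v x)) h.mfderiv

/-- The iterated derivative `X_1 ⋯ X_k f` along a finite list of left-invariant vector fields. -/
def iteratedField (w : List (GroupLieAlgebra 𝓘(ℝ, E) G)) (f : SmoothFn E G) : SmoothFn E G :=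
  w.foldr (fun v h => leftInvField v h) f

/-- The usual Fréchet topology of `C^∞(G)`: uniform convergence on compact sets (on all of `G`, when
`G` is compact) of all iterated derivatives along left-invariant vector fields. -/
instance : TopologicalSpace (SmoothFn E G) :=
  ⨅ w : List (GroupLieAlgebra 𝓘(ℝ, E) G),
    TopologicalSpace.induced (fun f => (iteratedField w f).toContinuousMap) inferInstance

theorem continuous_leftInvField (v : GroupLieAlgebra 𝓘(ℝ, E) G) :
    Continuous (leftInvField v : SmoothFn E G → SmoothFn E G) := by
  refine continuous_iInf_rng.2 fun w => continuous_induced_rng.2 ?_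
  have h : (fun f => (iteratedField w f).toContinuousMap) ∘ (leftInvField v)
      = fun f : SmoothFn E G => (iteratedField (w ++ [v]) f).toContinuousMap := by
    funext f
    simp [iteratedField]
  rw [h]
  exact continuous_iInf_dom (i := w ++ [v]) continuous_induced_dom

theorem continuous_toContinuousMap :
    Continuous (SmoothFn.toContinuousMap : SmoothFn E G → C(G, ℂ)) :=
  continuous_iInf_dom (i := ([] : List (GroupLieAlgebra 𝓘(ℝ, E) G))) continuous_induced_dom

/-- The operator `-(X_1² + ⋯ + X_n²)`; it is the positive Laplace–Beltrami operator when the `X_j`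
form an orthonormal basis for a bi-invariant Riemannian metric. -/
def laplacian {n : ℕ} (X : Fin n → GroupLieAlgebra 𝓘(ℝ, E) G) :
    SmoothFn E G →ₗ[ℂ] SmoothFn E G :=
  -∑ j, leftInvField (X j) ∘ₗ leftInvField (X j)

/-- A Riemannian metric on `G` is bi-invariant if all left and all right translations are
isometries. -/
def IsBiInvariant (g : Bundle.ContMDiffRiemannianMetric 𝓘(ℝ, E) ∞ E
    (fun x : G => TangentSpace 𝓘(ℝ, E) x)) : Prop :=
  (∀ (a x : G) (v w : TangentSpace 𝓘(ℝ, E) x),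
    g.inner (a * x) (mfderiv 𝓘(ℝ, E) 𝓘(ℝ, E) (fun y => a * y) x v)
      (mfderiv 𝓘(ℝ, E) 𝓘(ℝ, E) (fun y => a * y) x w) = g.inner x v w) ∧
  (∀ (a x : G) (v w : TangentSpace 𝓘(ℝ, E) x),
    g.inner (x * a) (mfderiv 𝓘(ℝ, E) 𝓘(ℝ, E) (fun y => y * a) x v)
      (mfderiv 𝓘(ℝ, E) 𝓘(ℝ, E) (fun y => y * a) x w) = g.inner x v w)

end VectorFields

/-! ### The unitary dual -/

/-- Continuous irreducible unitary representations of `G` by matrices. -/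
structure UnitaryIrrep (G : Type*) [TopologicalSpace G] [Group G] where
  /-- the dimension `d_ξ` -/
  dim : ℕ
  /-- the representation -/
  hom : G →* Matrix.unitaryGroup (Fin dim) ℂ
  continuous_hom : Continuous hom
  irreducible : Representation.IsIrreducible
    ((Matrix.toLinAlgEquiv' (R := ℂ) (n := Fin dim) :
        Matrix (Fin dim) (Fin dim) ℂ →* ((Fin dim → ℂ) →ₗ[ℂ] (Fin dim → ℂ))).comp
      ((Matrix.unitaryGroup (Fin dim) ℂ).subtype.comp hom) : Representation ℂ G (Fin dim → ℂ))

section Dual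

variable (G : Type*) [TopologicalSpace G] [Group G]

variable {G} in
/-- The matrix `ξ(x)`. -/
def UnitaryIrrep.mat (ξ : UnitaryIrrep G) (x : G) : Matrix (Fin ξ.dim) (Fin ξ.dim) ℂ := ξ.hom x

/-- Unitary equivalence of representations. -/
def unitaryIrrepSetoid : Setoid (UnitaryIrrep G) where
  r ξ η := ∃ T : Matrix (Fin η.dim) (Fin ξ.dim) ℂ,
    Tᴴ * T = 1 ∧ T * Tᴴ = 1 ∧ ∀ x, T * ξ.mat x = η.mat x * T
  iseqv :=
    { refl := fun ξ => ⟨1, by simp, by simp, by simp⟩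
      symm := by
        rintro ξ η ⟨T, h1, h2, h⟩
        refine ⟨Tᴴ, by simpa using h2, by simpa using h1, fun x => ?_⟩
        calc Tᴴ * η.mat x = Tᴴ * (η.mat x * T) * Tᴴ := by
              rw [Matrix.mul_assoc, Matrix.mul_assoc, h2, Matrix.mul_one]
          _ = ξ.mat x * Tᴴ := by rw [← h, ← Matrix.mul_assoc, h1, Matrix.one_mul]
      trans := by
        rintro ξ η ζ ⟨T, h1, h2, h⟩ ⟨S, k1, k2, k⟩
        refine ⟨S * T, ?_, ?_, fun x => ?_⟩
        · rw [Matrix.conjTranspose_mul, Matrix.mul_assoc, ← Matrix.mul_assoc Sᴴ, k1,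
            Matrix.one_mul, h1]
        · rw [Matrix.conjTranspose_mul, Matrix.mul_assoc, ← Matrix.mul_assoc T, h2,
            Matrix.one_mul, k2]
        · rw [Matrix.mul_assoc, h, ← Matrix.mul_assoc, k, Matrix.mul_assoc] }

/-- The unitary dual `Ĝ`. -/
def UnitaryDual : Type _ := Quotient (unitaryIrrepSetoid G)

variable {G} in
/-- The chosen representative of a class in `Ĝ`. -/
def UnitaryDual.rep (c : UnitaryDual G) : UnitaryIrrep G := Quotient.out c

end Dual

/-- The square of the Hilbert–Schmidt norm. -/
def hsSq {d : ℕ} (A : Matrix (Fin d) (Fin d) ℂ) : ℝ := ∑ i, ∑ j, ‖A i j‖ ^ 2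

/-- The smallest non-zero singular value (meaningful for `A ≠ 0`). -/
def minPosSingularValue {d : ℕ} (A : Matrix (Fin d) (Fin d) ℂ) : ℝ :=
  sInf {s : ℝ | s ≠ 0 ∧ ∃ i : ℕ, i < d ∧ s = (Matrix.toEuclideanLin A).singularValues i}

/-! ### Distributions, symbols and Sobolev spaces -/

section Distributions

variable {E : Type*} [NormedAddCommGroup E] [NormedSpace ℝ E]
  {G : Type*} [TopologicalSpace G] [ChartedSpace E G] [Group G] [LieGroup 𝓘(ℝ, E) ∞ G]

variable (E G) in
/-- The space `𝓓'(G)` of distributions: continuous linear functionals on `C^∞(G)`. -/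
abbrev Distrib : Type _ := SmoothFn E G →L[ℂ] ℂ

/-- The eigenvalue `ν_ξ` of the Laplacian: the number with `ℒ ξ_{ij} = ν_ξ ξ_{ij}` for all matrix
coefficients of `ξ`. -/
def nu {n : ℕ} (X : Fin n → GroupLieAlgebra 𝓘(ℝ, E) G) (ξ : UnitaryIrrep G) : ℝ :=
  Classical.epsilon fun ν : ℝ => ∀ i j,
    laplacian X (SmoothFn.ofFun E fun x => ξ.mat x i j) =
      (ν : ℂ) • SmoothFn.ofFun E fun x => ξ.mat x i j

/-- The weight `⟨ξ⟩ = √(1 + ν_ξ)`. -/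
def japaneseBracket {n : ℕ} (X : Fin n → GroupLieAlgebra 𝓘(ℝ, E) G) (ξ : UnitaryIrrep G) : ℝ :=
  √(1 + nu X ξ)

/-- The matrix-valued symbol `σ_P(x, ξ) = ξ(x)^* (Pξ)(x)`. -/
def symbolAt (P : SmoothFn E G →ₗ[ℂ] SmoothFn E G) (x : G) (ξ : UnitaryIrrep G) :
    Matrix (Fin ξ.dim) (Fin ξ.dim) ℂ :=
  (ξ.mat x)ᴴ * Matrix.of fun i j => P (SmoothFn.ofFun E fun y => ξ.mat y i j) x

/-- The symbol `σ_P(ξ)` of a left-invariant operator: `σ_P(x, ξ)` does not depend on `x` then, and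
is evaluated at the identity. -/
def symbol (P : SmoothFn E G →ₗ[ℂ] SmoothFn E G) (ξ : UnitaryIrrep G) :
    Matrix (Fin ξ.dim) (Fin ξ.dim) ℂ :=
  symbolAt P 1 ξ

/-- The matrix-valued Fourier coefficient `û(ξ) = ⟨u, ξ^*⟩` of a distribution. -/
def fourierCoeff (u : Distrib E G) (ξ : UnitaryIrrep G) : Matrix (Fin ξ.dim) (Fin ξ.dim) ℂ :=
  Matrix.of fun i j => u (SmoothFn.ofFun E fun x => (ξ.mat x)ᴴ i j)

/-- The Sobolev norm `‖u‖_{H^s}`, with value `∞` if `u` is not in `H^s(G)`. -/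
def sobolevNorm {n : ℕ} (X : Fin n → GroupLieAlgebra 𝓘(ℝ, E) G) (s : ℝ) (u : Distrib E G) :
    ℝ≥0∞ :=
  (∑' c : UnitaryDual G, ENNReal.ofReal
    (c.rep.dim * japaneseBracket X c.rep ^ (2 * s) * hsSq (fourierCoeff u c.rep))) ^ (1 / 2 : ℝ)

/-- Membership in the Sobolev space `H^s(G)`. -/
def MemSobolev {n : ℕ} (X : Fin n → GroupLieAlgebra 𝓘(ℝ, E) G) (s : ℝ) (u : Distrib E G) : Prop :=
  sobolevNorm X s u < ⊤

/-- The inner product of `H^s(G)`. -/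
def sobolevInner {n : ℕ} (X : Fin n → GroupLieAlgebra 𝓘(ℝ, E) G) (s : ℝ) (u v : Distrib E G) :
    ℂ :=
  ∑' c : UnitaryDual G, ((c.rep.dim * japaneseBracket X c.rep ^ (2 * s) : ℝ) : ℂ) *
    Matrix.trace (fourierCoeff u c.rep * (fourierCoeff v c.rep)ᴴ)

/-- The orthogonal complement in `H^1(G)` of the kernel of an operator `T` defined on `H^1(G)`. -/
def kerPerp {n : ℕ} (X : Fin n → GroupLieAlgebra 𝓘(ℝ, E) G) (T : Distrib E G → Distrib E G) :
    Set (Distrib E G) :=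
  {f | MemSobolev X 1 f ∧
    ∀ u : Distrib E G, MemSobolev X 1 u → T u = 0 → sobolevInner X 1 f u = 0}

/-- The action of a left-invariant vector field on distributions, `⟨Yu, φ⟩ = -⟨u, Yφ⟩`. -/
def fieldDistrib (v : GroupLieAlgebra 𝓘(ℝ, E) G) (u : Distrib E G) : Distrib E G :=
  -(u.comp ⟨leftInvField v, continuous_leftInvField v⟩)

section Measure

variable [CompactSpace G] [MeasurableSpace G] [BorelSpace G] (μ : Measure G) [IsFiniteMeasure μ]

/-- The distribution `φ ↦ ∫ f φ dμ` defined by a smooth function `f`. -/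
def ofSmooth (f : SmoothFn E G) : Distrib E G where
  toFun φ := ∫ x, f x * φ x ∂μ
  map_add' φ ψ := by
    rw [← integral_add (f.integrable_mul μ φ) (f.integrable_mul μ ψ)]
    exact integral_congr_ae (ae_of_all _ fun x => mul_add (f x) (φ x) (ψ x))
  map_smul' c φ := by
    rw [RingHom.id_apply, smul_eq_mul, ← integral_const_mul]
    exact integral_congr_ae (ae_of_all _ fun x => mul_left_comm (f x) c (φ x))
  cont := by
    have h : Continuous fun h : C(G, ℂ) => ∫ x, f x * h x ∂μ := by
      have hi : ∀ h : C(G, ℂ), Integrable (fun x => f x * h x) μ := fun h =>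
        (f.contMDiff.continuous.mul h.continuous).integrable_of_hasCompactSupport
          (HasCompactSupport.of_compactSpace _)
      refine (LinearMap.mkContinuous
        ({ toFun := fun h : C(G, ℂ) => ∫ x, f x * h x ∂μ
           map_add' := fun h k => ?_
           map_smul' := fun c h => ?_ } : C(G, ℂ) →ₗ[ℂ] ℂ)
        (‖f.toContinuousMap‖ * μ.real Set.univ) fun h => ?_).continuous
      · rw [← integral_add (hi h) (hi k)]
        exact integral_congr_ae (ae_of_all _ fun x => mul_add (f x) (h x) (k x))
      · rw [RingHom.id_apply, smul_eq_mul, ← integral_const_mul]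
        exact integral_congr_ae (ae_of_all _ fun x => mul_left_comm (f x) c (h x))
      · refine (norm_integral_le_of_norm_le_const (C := ‖f.toContinuousMap‖ * ‖h‖)
          (ae_of_all _ fun x => ?_)).trans (le_of_eq (by ring))
        rw [norm_mul]
        exact mul_le_mul (f.toContinuousMap.norm_coe_le_norm x) (h.norm_coe_le_norm x)
          (norm_nonneg _) (norm_nonneg _)
    exact h.comp continuous_toContinuousMap

/-- The `L²` norm of a distribution: the norm of the square integrable function which represents it,
and `∞` if there is none. -/
def l2Norm (u : Distrib E G) : ℝ≥0∞ :=
  ⨅ (f : Lp ℂ 2 μ) (_ : ∀ φ : SmoothFn E G, u φ = ∫ x, f x * φ x ∂μ), ‖f‖ₑ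

/-- The norm `‖∇u‖_{L²}` of the gradient `∇u = (X_1 u, …, X_n u)`. -/
def gradNorm {n : ℕ} (X : Fin n → GroupLieAlgebra 𝓘(ℝ, E) G) (u : Distrib E G) : ℝ≥0∞ :=
  (∑ j, l2Norm μ (fieldDistrib (X j) u) ^ 2) ^ (1 / 2 : ℝ)

/-- `P` commutes with left translations. -/
def IsLeftInvariant (P : SmoothFn E G →ₗ[ℂ] SmoothFn E G) : Prop :=
  ∀ (a : G) (f : SmoothFn E G), P (leftTranslate a f) = leftTranslate a (P f)

/-- `P` is of order `m`: it is bounded from `H^{m+s}(G)` to `H^s(G)` for every real `s`. -/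
def HasOrder {n : ℕ} (X : Fin n → GroupLieAlgebra 𝓘(ℝ, E) G)
    (P : SmoothFn E G →ₗ[ℂ] SmoothFn E G) (m : ℝ) : Prop :=
  ∀ s : ℝ, ∃ K : ℝ≥0, ∀ f : SmoothFn E G,
    sobolevNorm X s (ofSmooth μ (P f)) ≤ K * sobolevNorm X (m + s) (ofSmooth μ f)

/-- `v` is the value at `u` of the extension by continuity of `P` to an operator from `H^r(G)`
to `H^s(G)`. -/
def IsExtensionValue {n : ℕ} (X : Fin n → GroupLieAlgebra 𝓘(ℝ, E) G)
    (P : SmoothFn E G →ₗ[ℂ] SmoothFn E G) (r s : ℝ) (u v : Distrib E G) : Prop :=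
  ∃ f : ℕ → SmoothFn E G,
    Tendsto (fun k => sobolevNorm X r (ofSmooth μ (f k) - u)) atTop (𝓝 0) ∧
    Tendsto (fun k => sobolevNorm X s (ofSmooth μ (P (f k)) - v)) atTop (𝓝 0)

/-- The extension by continuity of an operator `P` of order `m` to `H^1(G) → H^{1-m}(G)`. -/
def extendH1 {n : ℕ} (X : Fin n → GroupLieAlgebra 𝓘(ℝ, E) G)
    (P : SmoothFn E G →ₗ[ℂ] SmoothFn E G) (m : ℝ) (u : Distrib E G) : Distrib E G :=
  Classical.epsilon fun v => IsExtensionValue μ X P 1 (1 - m) u v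

end Measure

end Distributions

end LiePoincare

end

/-! Everything is diagonalised by the Fourier transform on `G`. If `T` acts on Fourier coefficients
by `fourierCoeff (T f) ξ = σ(ξ) * fourierCoeff f ξ`, Plancherel writes the squares of `‖f‖`, `‖∇f‖`
and `‖T f‖` as sums over the dual of `d_ξ` times the Hilbert–Schmidt squares `|f̂|²`, `ν_ξ |f̂|²`
and `|σ f̂|²`. Orthogonality to the kernel also splits into blocks: the columns of `f̂(ξ)` are
orthogonal to `ker σ(ξ)`, so that `|σ f̂| ≥ λ |f̂|` with `λ` the smallest non-zero singular value,
and `f̂(ξ) = 0` where `σ(ξ) = 0`.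

From the symbol to the inequality: the bound on `λ` controls `⟨ξ⟩^(-2(δ-1)) |f̂|²` by `|σ f̂|²`, and
a spectral gap controls `⟨ξ⟩² |f̂|²` by `ν_ξ |f̂|²` off the trivial representation. Hölder with
exponents `(δ-1)/δ` and `1/δ` makes the powers of `⟨ξ⟩` cancel (`poincare_of_symbol`). For `δ > 1`
the trivial block must vanish: it does if the symbol is zero there, and otherwise because `f` has
mean value zero. In the other direction, the inequality is tested on one block filled with a right
singular vector (`symbol_of_poincare`).

The harmonic analysis behind this rests on the following. Peter–Weyl (`orthogonal_trigPoly_eq_bot`)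
comes from the spectral theorem for compact self-adjoint convolution operators, whose eigenspaces
are finite-dimensional and invariant under right translation. Convolution with mollifiers shows that
matrix coefficients are smooth and dense in `C^∞(G)`, so a distribution is determined by its Fourier
coefficients. Bi-invariance of the metric makes the symbol of the Laplacian commute with `ξ`, hence
scalar by Schur's lemma. The spectral gap (`exists_pos_le_nu`) compares the oscillation of a matrix
coefficient with the diameter of `G`. Finally `fourierCoeff_extendH1` shows that the extension of
`P` to `H^1` acts blockwise by the symbol. -/

noncomputable section

set_option linter.unusedSectionVars false

namespace LiePoincare

/-! ### Smooth parametric integrals over a compact manifold -/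

section ParametricIntegral

variable {E : Type*} [NormedAddCommGroup E] [NormedSpace ℝ E]
  {E' : Type*} [NormedAddCommGroup E'] [NormedSpace ℝ E']
  {Y : Type*} [TopologicalSpace Y] [ChartedSpace E' Y] [IsManifold 𝓘(ℝ, E') ∞ Y]

theorem contMDiffOn_fderiv_fst {F : E × Y → ℂ} {U : Set E} (hU : IsOpen U)
    (hF : ContMDiffOn (𝓘(ℝ, E).prod 𝓘(ℝ, E')) 𝓘(ℝ, ℂ) ∞ F (U ×ˢ Set.univ)) :
    ContMDiffOn (𝓘(ℝ, E).prod 𝓘(ℝ, E')) 𝓘(ℝ, E →L[ℝ] ℂ) ∞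
      (fun p : E × Y => fderiv ℝ (fun e => F (e, p.2)) p.1) (U ×ˢ Set.univ) := by
  intro p hp
  have hopen : IsOpen (U ×ˢ (Set.univ : Set Y)) := hU.prod isOpen_univ
  have hFp : ContMDiffAt (𝓘(ℝ, E).prod 𝓘(ℝ, E')) 𝓘(ℝ, ℂ) ∞ F p :=
    hF.contMDiffAt (hopen.mem_nhds hp)
  have h := ContMDiffAt.mfderiv (J := 𝓘(ℝ, E).prod 𝓘(ℝ, E')) (I := 𝓘(ℝ, E)) (I' := 𝓘(ℝ, ℂ))
    (m := ∞) (n := ∞) (x₀ := p) (fun (q : E × Y) (e : E) => F (e, q.2)) Prod.fst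
    (ContMDiffAt.comp (p, p.1)
      (g := F) (f := fun r : (E × Y) × E => (r.2, r.1.2)) hFp
      ((contMDiff_snd.prodMk (contMDiff_snd.comp contMDiff_fst)) _))
    (contMDiff_fst _) (by simp)
  have e := inTangentCoordinates_model_space (I := 𝓘(ℝ, E)) (I' := 𝓘(ℝ, ℂ)) (Prod.fst : E × Y → E)
    (fun q : E × Y => F (q.1, q.2))
    (fun q : E × Y => fderiv ℝ (fun e => F (e, q.2)) q.1) p
  rw [← e]
  exact ContMDiffAt.contMDiffWithinAt (by simpa only [mfderiv_eq_fderiv] using h)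

theorem differentiableAt_fst {F : E × Y → ℂ} {U : Set E} (hU : IsOpen U)
    (hF : ContMDiffOn (𝓘(ℝ, E).prod 𝓘(ℝ, E')) 𝓘(ℝ, ℂ) ∞ F (U ×ˢ Set.univ)) {e : E} (he : e ∈ U)
    (y : Y) : DifferentiableAt ℝ (fun e => F (e, y)) e := by
  have h : ContMDiffAt 𝓘(ℝ, E) 𝓘(ℝ, ℂ) ∞ (fun e => F (e, y)) e :=
    ContMDiffAt.comp e (g := F) (f := fun e => (e, y))
      (hF.contMDiffAt ((hU.prod isOpen_univ).mem_nhds ⟨he, trivial⟩))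
      ((contMDiff_id.prodMk contMDiff_const) _)
  exact (contMDiffAt_iff_contDiffAt.1 h).differentiableAt (by simp)

variable [FiniteDimensional ℝ E] [CompactSpace Y] [MeasurableSpace Y] [BorelSpace Y]
  (μ : Measure Y) [IsFiniteMeasure μ]

/-- Dominated differentiation: the partial derivative is continuous, hence bounded on the compact
set `closedBall e r × Y`, and constants are integrable for a finite measure. -/
theorem hasFDerivAt_integral_fst {F : E × Y → ℂ} {U : Set E} (hU : IsOpen U)
    (hF : ContMDiffOn (𝓘(ℝ, E).prod 𝓘(ℝ, E')) 𝓘(ℝ, ℂ) ∞ F (U ×ˢ Set.univ))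
    (h : C(Y, ℂ)) {e : E} (he : e ∈ U) :
    HasFDerivAt (fun e => ∫ y, h y * F (e, y) ∂μ)
      (∫ y, h y • fderiv ℝ (fun e => F (e, y)) e ∂μ) e := by
  have hD := (contMDiffOn_fderiv_fst hU hF).continuousOn
  obtain ⟨r, hr, hrU⟩ := Metric.nhds_basis_closedBall.mem_iff.1 (hU.mem_nhds he)
  have hK : IsCompact (Metric.closedBall e r ×ˢ (Set.univ : Set Y)) :=
    (isCompact_closedBall e r).prod isCompact_univ
  obtain ⟨C, hC⟩ := hK.exists_bound_of_continuousOn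
    (hD.mono (Set.prod_mono hrU le_rfl))
  have hline : ∀ x ∈ U, Continuous fun y : Y => F (x, y) := fun x hx =>
    hF.continuousOn.comp_continuous (by fun_prop) (fun y => ⟨hx, trivial⟩)
  have hDline : ∀ x ∈ U, Continuous fun y : Y => fderiv ℝ (fun e => F (e, y)) x := fun x hx =>
    hD.comp_continuous (f := fun y : Y => (x, y)) (by fun_prop) (fun y => ⟨hx, trivial⟩)
  refine hasFDerivAt_integral_of_dominated_of_fderiv_le (𝕜 := ℝ)
    (F := fun e y => h y * F (e, y)) (F' := fun e y => h y • fderiv ℝ (fun e => F (e, y)) e)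
    (s := Metric.closedBall e r) (bound := fun _ => ‖h‖ * C)
    (Metric.closedBall_mem_nhds e hr) ?_ ?_ ?_ ?_ (integrable_const _) ?_
  · filter_upwards [hU.mem_nhds he] with x hx
    exact (h.continuous.mul (hline x hx)).aestronglyMeasurable
  · exact (h.continuous.mul (hline e he)).integrable_of_hasCompactSupport
      (HasCompactSupport.of_compactSpace _)
  · exact (h.continuous.smul (hDline e he)).aestronglyMeasurable
  · refine ae_of_all _ fun y x hx => ?_
    rw [norm_smul]
    exact mul_le_mul (h.norm_coe_le_norm y) (hC (x, y) ⟨hx, trivial⟩) (norm_nonneg _)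
      (norm_nonneg _)
  · refine ae_of_all _ fun y x hx => ?_
    exact (differentiableAt_fst hU hF (hrU hx) y).hasFDerivAt.const_smul (h y)

theorem fderiv_integral_fst_apply {F : E × Y → ℂ} {U : Set E} (hU : IsOpen U)
    (hF : ContMDiffOn (𝓘(ℝ, E).prod 𝓘(ℝ, E')) 𝓘(ℝ, ℂ) ∞ F (U ×ˢ Set.univ))
    (h : C(Y, ℂ)) {e : E} (he : e ∈ U) (w : E) :
    fderiv ℝ (fun e => ∫ y, h y * F (e, y) ∂μ) e w
      = ∫ y, h y * fderiv ℝ (fun e => F (e, y)) e w ∂μ := by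
  have hD := (contMDiffOn_fderiv_fst hU hF).continuousOn
  have hDline : Continuous fun y : Y => fderiv ℝ (fun e => F (e, y)) e :=
    hD.comp_continuous (f := fun y : Y => (e, y)) (by fun_prop) (fun y => ⟨he, trivial⟩)
  rw [(hasFDerivAt_integral_fst μ hU hF h he).fderiv, ContinuousLinearMap.integral_apply]
  · rfl
  · exact (h.continuous.smul hDline).integrable_of_hasCompactSupport
      (HasCompactSupport.of_compactSpace _)

/-- Induction over all `F` at once: the derivative of the integral in a fixed direction `w` is an
integral of the same shape, with `F` replaced by its partial derivative along `w`. As `E` is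
finite-dimensional, smoothness of the derivative can be tested on fixed directions. -/
theorem contDiffOn_integral_fst {U : Set E} (hU : IsOpen U) (h : C(Y, ℂ)) (k : ℕ) :
    ∀ F : E × Y → ℂ, ContMDiffOn (𝓘(ℝ, E).prod 𝓘(ℝ, E')) 𝓘(ℝ, ℂ) ∞ F (U ×ˢ Set.univ) →
      ContDiffOn ℝ k (fun e => ∫ y, h y * F (e, y) ∂μ) U := by
  induction k with
  | zero =>
    intro F hF
    exact contDiffOn_zero.2 fun e he =>
      (hasFDerivAt_integral_fst μ hU hF h he).continuousAt.continuousWithinAt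
  | succ k ih =>
    intro F hF
    have := contDiffOn_succ_iff_fderiv_of_isOpen (𝕜 := ℝ) (n := (k : WithTop ℕ∞))
      (f := fun e => ∫ y, h y * F (e, y) ∂μ) hU
    refine (this.2 ⟨fun e he =>
      (hasFDerivAt_integral_fst μ hU hF h he).differentiableAt.differentiableWithinAt,
      by simp, ?_⟩)
    refine contDiffOn_clm_apply.2 fun w => ?_
    refine (ih (fun p => fderiv ℝ (fun e => F (e, p.2)) p.1 w) ?_).congr fun e he =>
      fderiv_integral_fst_apply μ hU hF h he w
    exact (contMDiffOn_fderiv_fst hU hF).clm_apply contMDiffOn_const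

variable {M : Type*} [TopologicalSpace M] [ChartedSpace E M] [IsManifold 𝓘(ℝ, E) ∞ M]

theorem contMDiffOn_comp_extChartAt_symm_fst {Ψ : M × Y → ℂ}
    (hΨ : ContMDiff (𝓘(ℝ, E).prod 𝓘(ℝ, E')) 𝓘(ℝ, ℂ) ∞ Ψ) (x : M) :
    ContMDiffOn (𝓘(ℝ, E).prod 𝓘(ℝ, E')) 𝓘(ℝ, ℂ) ∞
      (fun p : E × Y => Ψ ((extChartAt 𝓘(ℝ, E) x).symm p.1, p.2))
      ((extChartAt 𝓘(ℝ, E) x).target ×ˢ Set.univ) := by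
  refine hΨ.comp_contMDiffOn
    (f := fun p : E × Y => ((extChartAt 𝓘(ℝ, E) x).symm p.1, p.2)) ?_
  exact ((contMDiffOn_extChartAt_symm (n := ∞) x).comp contMDiffOn_fst (fun p hp => hp.1)).prodMk
    contMDiffOn_snd

theorem integral_eq_comp_extChartAt {Ψ : M × Y → ℂ} (h : C(Y, ℂ)) (x : M) :
    (fun z => ∫ y, h y * Ψ (z, y) ∂μ) =ᶠ[𝓝 x]
      (fun e => ∫ y, h y * Ψ ((extChartAt 𝓘(ℝ, E) x).symm e, y) ∂μ) ∘ extChartAt 𝓘(ℝ, E) x := by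
  filter_upwards [extChartAt_source_mem_nhds (I := 𝓘(ℝ, E)) x] with z hz
  simp only [Function.comp_apply, (extChartAt 𝓘(ℝ, E) x).left_inv hz]

theorem contMDiff_integral {Ψ : M × Y → ℂ}
    (hΨ : ContMDiff (𝓘(ℝ, E).prod 𝓘(ℝ, E')) 𝓘(ℝ, ℂ) ∞ Ψ) (h : C(Y, ℂ)) :
    ContMDiff 𝓘(ℝ, E) 𝓘(ℝ, ℂ) ∞ (fun x => ∫ y, h y * Ψ (x, y) ∂μ) := by
  intro x
  refine ContMDiffAt.congr_of_eventuallyEq ?_ (integral_eq_comp_extChartAt (E := E) μ h x)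
  have hU : IsOpen (extChartAt 𝓘(ℝ, E) x).target := isOpen_extChartAt_target x
  have h1 : ContDiffOn ℝ ∞ (fun e => ∫ y, h y * Ψ ((extChartAt 𝓘(ℝ, E) x).symm e, y) ∂μ)
      (extChartAt 𝓘(ℝ, E) x).target :=
    contDiffOn_infty.2 fun k =>
      contDiffOn_integral_fst μ hU h k _ (contMDiffOn_comp_extChartAt_symm_fst hΨ x)
  exact ContMDiffAt.comp x
    ((h1.contDiffAt (hU.mem_nhds (mem_extChartAt_target x))).contMDiffAt) contMDiffAt_extChartAt

/-- The derivative of a complex-valued function along a tangent vector. -/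
def dirDeriv (f : M → ℂ) (x : M) (v : TangentSpace 𝓘(ℝ, E) x) : ℂ :=
  mfderiv 𝓘(ℝ, E) 𝓘(ℝ, ℂ) f x v

/-- Both sides are read in the same chart at `x`, where `key` turns the directional derivative into
a Fréchet derivative on `E` and differentiation under the integral applies. -/
theorem dirDeriv_integral {Ψ : M × Y → ℂ}
    (hΨ : ContMDiff (𝓘(ℝ, E).prod 𝓘(ℝ, E')) 𝓘(ℝ, ℂ) ∞ Ψ) (h : C(Y, ℂ)) (x : M)
    (v : TangentSpace 𝓘(ℝ, E) x) :
    dirDeriv (fun z => ∫ y, h y * Ψ (z, y) ∂μ) x v =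
      ∫ y, h y * dirDeriv (fun z => Ψ (z, y)) x v ∂μ := by
  have hU : IsOpen (extChartAt 𝓘(ℝ, E) x).target := isOpen_extChartAt_target x
  have hF := contMDiffOn_comp_extChartAt_symm_fst hΨ x
  have hx := mem_extChartAt_target (I := 𝓘(ℝ, E)) x
  have hφ : HasMFDerivAt 𝓘(ℝ, E) 𝓘(ℝ, E) (extChartAt 𝓘(ℝ, E) x) x
      (mfderiv 𝓘(ℝ, E) 𝓘(ℝ, E) (extChartAt 𝓘(ℝ, E) x) x) :=
    ((contMDiffAt_extChartAt (n := ∞)).mdifferentiableAt (by simp)).hasMFDerivAt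
  have key : ∀ (f : M → ℂ) (g : E → ℂ), f =ᶠ[𝓝 x] g ∘ extChartAt 𝓘(ℝ, E) x →
      DifferentiableAt ℝ g (extChartAt 𝓘(ℝ, E) x x) →
      dirDeriv f x v = fderiv ℝ g (extChartAt 𝓘(ℝ, E) x x)
        (mfderiv 𝓘(ℝ, E) 𝓘(ℝ, E) (extChartAt 𝓘(ℝ, E) x) x v) := by
    intro f g hfg hg
    have := (hg.hasFDerivAt.hasMFDerivAt.comp x hφ).congr_of_eventuallyEq hfg
    rw [dirDeriv, this.mfderiv]
    rfl
  rw [key _ _ (integral_eq_comp_extChartAt (E := E) μ h x)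
    (hasFDerivAt_integral_fst μ hU hF h hx).differentiableAt]
  have h2 := fderiv_integral_fst_apply μ hU hF h hx
    (mfderiv 𝓘(ℝ, E) 𝓘(ℝ, E) (extChartAt 𝓘(ℝ, E) x) x v)
  refine h2.trans (integral_congr_ae (ae_of_all _ fun y => ?_))
  refine congrArg (h y * ·)
    (key (fun z => Ψ (z, y)) _ ?_ (differentiableAt_fst hU hF hx y)).symm
  filter_upwards [extChartAt_source_mem_nhds (I := 𝓘(ℝ, E)) x] with z hz
  simp only [Function.comp_apply, (extChartAt 𝓘(ℝ, E) x).left_inv hz]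

end ParametricIntegral

/-! ### Integral operators with continuous kernels -/

section KernelOperator

variable {X H : Type*} [TopologicalSpace X] [CompactSpace X] [NormedAddCommGroup H]
  [InnerProductSpace ℂ H]

/-- The operator `f ↦ (x ↦ ⟪κ x, f⟫)` defined by a continuous family of vectors. -/
def kernelOp (κ : C(X, H)) : H →L[ℂ] C(X, ℂ) :=
  LinearMap.mkContinuous
    { toFun := fun f => ⟨fun x => inner ℂ (κ x) f, by fun_prop⟩
      map_add' := fun f g => by ext x; simp
      map_smul' := fun c f => by ext x; simp }
    ‖κ‖ fun f => by
      refine (ContinuousMap.norm_le _ (by positivity)).2 fun x => ?_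
      exact (norm_inner_le_norm _ _).trans
        (mul_le_mul_of_nonneg_right (κ.norm_coe_le_norm x) (norm_nonneg _))

/-- Arzelà–Ascoli: the image of the unit ball is bounded by `‖κ‖`, and all its members share the
modulus of continuity `x ↦ ‖κ x₀ - κ x‖` at `x₀`. -/
theorem isCompactOperator_kernelOp (κ : C(X, H)) : IsCompactOperator (kernelOp κ) := by
  refine (isCompactOperator_iff_image_closedBall_subset_compact (kernelOp κ).toLinearMap
    one_pos).2 ?_
  let e := ContinuousMap.isometryEquivBoundedOfCompact X ℂ
  let A : Set (BoundedContinuousFunction X ℂ) := e '' (kernelOp κ '' Metric.closedBall 0 1)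
  have hA : IsCompact (closure A) := by
    refine BoundedContinuousFunction.arzela_ascoli (Metric.closedBall 0 ‖κ‖)
      (isCompact_closedBall _ _) A ?_ ?_
    · rintro _ x ⟨_, ⟨f, hf, rfl⟩, rfl⟩
      have hf' : ‖f‖ ≤ 1 := by simpa using hf
      simp only [Metric.mem_closedBall, dist_zero_right]
      refine (norm_inner_le_norm (κ x) f).trans ?_
      exact (mul_le_of_le_one_right (norm_nonneg _) hf').trans (κ.norm_coe_le_norm x)
    · intro x₀
      refine Metric.equicontinuousAt_of_continuity_modulus (fun x => ‖κ x₀ - κ x‖) ?_ _ ?_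
      · have : ContinuousAt (fun x => ‖κ x₀ - κ x‖) x₀ := by fun_prop
        simpa [ContinuousAt] using this
      · refine Eventually.of_forall fun x => ?_
        rintro ⟨_, ⟨_, ⟨f, hf, rfl⟩, rfl⟩⟩
        have hf' : ‖f‖ ≤ 1 := by simpa using hf
        change dist (inner ℂ (κ x₀) f) (inner ℂ (κ x) f) ≤ _
        rw [dist_eq_norm, ← inner_sub_left]
        exact (norm_inner_le_norm _ _).trans (mul_le_of_le_one_right (norm_nonneg _) hf')
  refine ⟨e.symm '' closure A, hA.image e.symm.continuous, ?_⟩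
  rintro _ ⟨f, hf, rfl⟩
  exact ⟨e (kernelOp κ f), subset_closure ⟨_, ⟨f, hf, rfl⟩, rfl⟩, e.symm_apply_apply _⟩

end KernelOperator

/-! ### Haar measure and convolution on a compact group -/

section Convolution

variable {G : Type*} [TopologicalSpace G] [Group G] [IsTopologicalGroup G] [CompactSpace G]
  [MeasurableSpace G] [BorelSpace G] (μ : Measure G) [μ.IsHaarMeasure] [IsProbabilityMeasure μ]

/-- A right translate of `μ` is again a left Haar probability measure, and there is only one. -/
theorem isMulRightInvariant_of_compactSpace : μ.IsMulRightInvariant := by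
  refine ⟨fun a => ?_⟩
  have : IsProbabilityMeasure (Measure.map (· * a) μ) :=
    Measure.isProbabilityMeasure_map (by fun_prop)
  exact Measure.isHaarMeasure_eq_of_isProbabilityMeasure _ μ

theorem isInvInvariant_of_compactSpace : μ.IsInvInvariant := by
  have := isMulRightInvariant_of_compactSpace μ
  refine ⟨?_⟩
  have : IsProbabilityMeasure μ.inv := Measure.isProbabilityMeasure_map (by fun_prop)
  have : μ.inv.IsHaarMeasure := { }
  exact Measure.isHaarMeasure_eq_of_isProbabilityMeasure _ μ

theorem integral_mul_right (f : G → ℂ) (a : G) : ∫ x, f (x * a) ∂μ = ∫ x, f x ∂μ := by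
  have := isMulRightInvariant_of_compactSpace μ
  exact integral_mul_right_eq_self f a

theorem integral_inv (f : G → ℂ) : ∫ x, f x⁻¹ ∂μ = ∫ x, f x ∂μ := by
  have := isInvInvariant_of_compactSpace μ
  exact integral_inv_eq_self f μ

theorem integrable_of_continuous {f : G → ℂ} (hf : Continuous f) : Integrable f μ :=
  hf.integrable_of_hasCompactSupport (HasCompactSupport.of_compactSpace _)

/-- Continuous functions as elements of `L²`. -/
abbrev toL2 : C(G, ℂ) →L[ℂ] Lp ℂ 2 μ := ContinuousMap.toLp 2 μ ℂ

theorem inner_toL2 (f : C(G, ℂ)) (h : Lp ℂ 2 μ) :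
    inner ℂ (toL2 μ f) h = ∫ x, h x * star (f x) ∂μ := by
  rw [L2.inner_def]
  refine integral_congr_ae ?_
  filter_upwards [ContinuousMap.coeFn_toLp (p := 2) (𝕜 := ℂ) μ f] with x hx
  rw [hx]
  rfl

theorem inner_toL2_toL2 (f h : C(G, ℂ)) :
    inner ℂ (toL2 μ f) (toL2 μ h) = ∫ x, h x * star (f x) ∂μ :=
  ContinuousMap.inner_toLp (𝕜 := ℂ) μ f h

theorem norm_toL2_le (f : C(G, ℂ)) : ‖toL2 μ f‖ ≤ ‖f‖ := by
  have h := (toL2 μ).le_opNorm f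
  have h2 := ContinuousMap.toLp_norm_le (α := G) (E := ℂ) (p := 2) (𝕜 := ℂ) μ
  simp only [measureUnivNNReal, measure_univ, ENNReal.toNNReal_one] at h2
  exact h.trans (mul_le_of_le_one_left (norm_nonneg _) (by simpa using h2))

theorem toL2_injective : Function.Injective (toL2 μ) := ContinuousMap.toLp_injective μ

/-- The continuous family of functions `y ↦ conj p(x y⁻¹)`. -/
def convKernel (p : C(G, ℂ)) : C(G, Lp ℂ 2 μ) :=
  ((toL2 μ : C(C(G, ℂ), Lp ℂ 2 μ))).comp
    (ContinuousMap.curry ⟨fun z : G × G => star (p (z.1 * z.2⁻¹)), by fun_prop⟩)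

/-- Convolution `f ↦ p * f` by a continuous function, as an operator from `L²` to continuous
functions. -/
def convL2 (p : C(G, ℂ)) : Lp ℂ 2 μ →L[ℂ] C(G, ℂ) := kernelOp (convKernel μ p)

theorem convL2_apply (p : C(G, ℂ)) (f : Lp ℂ 2 μ) (x : G) :
    convL2 μ p f x = ∫ y, p (x * y⁻¹) * f y ∂μ := by
  change inner ℂ (toL2 μ _) f = _
  rw [inner_toL2]
  refine integral_congr_ae (ae_of_all _ fun y => ?_)
  simp [mul_comm]

/-- Convolution of continuous functions. -/
def conv (p f : C(G, ℂ)) : C(G, ℂ) := convL2 μ p (toL2 μ f)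

theorem conv_apply (p f : C(G, ℂ)) (x : G) : conv μ p f x = ∫ y, p (x * y⁻¹) * f y ∂μ := by
  rw [conv, convL2_apply]
  refine integral_congr_ae ?_
  filter_upwards [ContinuousMap.coeFn_toLp (p := 2) (𝕜 := ℂ) μ f] with x hx
  rw [hx]

theorem conv_apply' (p f : C(G, ℂ)) (x : G) : conv μ p f x = ∫ y, p y * f (y⁻¹ * x) ∂μ := by
  rw [conv_apply, ← integral_inv μ, ← integral_mul_left_eq_self _ x⁻¹]
  refine integral_congr_ae (ae_of_all _ fun y => ?_)
  simp

theorem conv_apply_right (p f : C(G, ℂ)) (x : G) :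
    conv μ p f x = ∫ y, p y⁻¹ * f (y * x) ∂μ := by
  rw [conv_apply, ← integral_mul_right μ _ x]
  refine integral_congr_ae (ae_of_all _ fun y => ?_)
  simp

/-- Only the `L²` norm of `p` enters. This is what later allows a mollifier to be replaced by a
trigonometric polynomial that is close to it merely in `L²`. -/
theorem norm_conv_le (p f : C(G, ℂ)) : ‖conv μ p f‖ ≤ ‖toL2 μ p‖ * ‖f‖ := by
  refine (ContinuousMap.norm_le _ (by positivity)).2 fun x => ?_
  let q : C(G, ℂ) := ⟨fun y => star (f (y⁻¹ * x)), by fun_prop⟩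
  have h : conv μ p f x = inner ℂ (toL2 μ q) (toL2 μ p) := by
    rw [conv_apply', inner_toL2_toL2]
    simp [q]
  have hq : ‖q‖ ≤ ‖f‖ := (ContinuousMap.norm_le _ (norm_nonneg _)).2 fun y => by
    simpa [q] using f.norm_coe_le_norm _
  rw [h, mul_comm]
  exact (norm_inner_le_norm _ _).trans
    (mul_le_mul_of_nonneg_right ((norm_toL2_le μ q).trans hq) (norm_nonneg _))

theorem conv_sub_left (p q f : C(G, ℂ)) : conv μ (p - q) f = conv μ p f - conv μ q f := by
  ext x
  simp only [ContinuousMap.sub_apply, conv_apply', sub_mul]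
  exact integral_sub (integrable_of_continuous μ (by fun_prop))
    (integrable_of_continuous μ (by fun_prop))

theorem conv_add_left (p q f : C(G, ℂ)) : conv μ (p + q) f = conv μ p f + conv μ q f := by
  ext x
  simp only [ContinuousMap.add_apply, conv_apply', add_mul]
  exact integral_add (integrable_of_continuous μ (by fun_prop))
    (integrable_of_continuous μ (by fun_prop))

theorem conv_smul_left (c : ℂ) (p f : C(G, ℂ)) : conv μ (c • p) f = c • conv μ p f := by
  ext x
  simp only [ContinuousMap.smul_apply, conv_apply', smul_eq_mul, mul_assoc]
  exact integral_const_mul _ _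

/-- Right translation of continuous functions. -/
def rightTranslate (a : G) : C(G, ℂ) →ₗ[ℂ] C(G, ℂ) where
  toFun f := ⟨fun x => f (x * a), by fun_prop⟩
  map_add' f g := rfl
  map_smul' c f := rfl

@[simp]
theorem rightTranslate_apply (a : G) (f : C(G, ℂ)) (x : G) : rightTranslate a f x = f (x * a) := rfl

theorem conv_rightTranslate (p f : C(G, ℂ)) (a : G) :
    conv μ p (rightTranslate a f) = rightTranslate a (conv μ p f) := by
  ext x
  rw [rightTranslate_apply, conv_apply_right, conv_apply_right]
  simp [mul_assoc]

theorem inner_rightTranslate (f h : C(G, ℂ)) (a : G) :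
    inner ℂ (toL2 μ (rightTranslate a f)) (toL2 μ (rightTranslate a h)) =
      inner ℂ (toL2 μ f) (toL2 μ h) := by
  rw [inner_toL2_toL2, inner_toL2_toL2]
  exact integral_mul_right μ (fun x => h x * star (f x)) a

theorem continuous_rightTranslate (f : C(G, ℂ)) : Continuous fun a => rightTranslate a f :=
  (ContinuousMap.curry ⟨fun z : G × G => f (z.2 * z.1), by fun_prop⟩).continuous

/-- Fubini: `hp` says that the kernel `p (x * y⁻¹)` is Hermitian. -/
theorem inner_conv_left (p f h : C(G, ℂ)) (hp : ∀ x, p x⁻¹ = star (p x)) :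
    inner ℂ (toL2 μ (conv μ p f)) (toL2 μ h) = inner ℂ (toL2 μ f) (toL2 μ (conv μ p h)) := by
  have h1 : inner ℂ (toL2 μ (conv μ p f)) (toL2 μ h) =
      ∫ x, ∫ y, h x * star (p (x * y⁻¹)) * star (f y) ∂μ ∂μ := by
    rw [inner_toL2_toL2]
    refine integral_congr_ae (ae_of_all _ fun x => ?_)
    simp only [conv_apply]
    rw [← starRingEnd_apply, ← integral_conj, ← integral_const_mul]
    simp [mul_assoc]
  have h2 : inner ℂ (toL2 μ f) (toL2 μ (conv μ p h)) =
      ∫ y, ∫ x, h x * star (p (x * y⁻¹)) * star (f y) ∂μ ∂μ := by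
    rw [inner_toL2_toL2]
    refine integral_congr_ae (ae_of_all _ fun y => ?_)
    simp only [conv_apply]
    rw [← integral_mul_const]
    refine integral_congr_ae (ae_of_all _ fun x => ?_)
    simp only [← hp, mul_inv_rev, inv_inv]
    ring
  rw [h1, h2]
  exact integral_integral_swap_of_hasCompactSupport (by fun_prop)
    (HasCompactSupport.of_compactSpace _)

/-- Convolution by a continuous function as an operator on `L²`. -/
def convOp (p : C(G, ℂ)) : Lp ℂ 2 μ →L[ℂ] Lp ℂ 2 μ := toL2 μ ∘L convL2 μ p

theorem convOp_toL2 (p f : C(G, ℂ)) : convOp μ p (toL2 μ f) = toL2 μ (conv μ p f) := rfl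

theorem isCompactOperator_convOp (p : C(G, ℂ)) : IsCompactOperator (convOp μ p) :=
  (isCompactOperator_kernelOp (convKernel μ p)).clm_comp (toL2 μ)

theorem denseRange_toL2 [T2Space G] : DenseRange (toL2 μ) :=
  ContinuousMap.toLp_denseRange ℂ μ ℂ (by simp)

theorem isSymmetric_convOp [T2Space G] (p : C(G, ℂ)) (hp : ∀ x, p x⁻¹ = star (p x)) :
    (convOp μ p).IsSymmetric := by
  intro f h
  refine (denseRange_toL2 μ).induction_on₂
    (p := fun f h => inner ℂ (convOp μ p f) h = inner ℂ f (convOp μ p h)) ?_ ?_ f h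
  · exact isClosed_eq (by fun_prop) (by fun_prop)
  · intro f h
    exact inner_conv_left μ p f h hp

end Convolution

/-! ### Smooth approximate identities -/

section Mollifier

variable {E : Type*} [NormedAddCommGroup E] [NormedSpace ℝ E] [FiniteDimensional ℝ E]
  {G : Type*} [TopologicalSpace G] [T2Space G] [CompactSpace G]
  [ChartedSpace E G] [Group G] [LieGroup 𝓘(ℝ, E) ∞ G] [IsTopologicalGroup G]
  [MeasurableSpace G] [BorelSpace G] (μ : Measure G) [μ.IsHaarMeasure] [IsProbabilityMeasure μ]

variable (E) in
theorem exists_smooth_mollifier {U : Set G} (hU : U ∈ 𝓝 (1 : G)) :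
    ∃ ψ : G → ℝ, ContMDiff 𝓘(ℝ, E) 𝓘(ℝ, ℝ) ∞ ψ ∧ (∀ x, 0 ≤ ψ x) ∧ (∀ x, ψ x⁻¹ = ψ x) ∧
      (∀ x, x ∉ U → ψ x = 0) ∧ ∫ x, ψ x ∂μ = 1 := by
  -- The bump will be symmetrised to `b x + b x⁻¹`; both terms vanish off `U` if `b` is supported in
  -- `U ∩ U⁻¹`.
  have hV : U ∩ U⁻¹ ∈ 𝓝 (1 : G) := inter_mem hU (inv_mem_nhds_one G hU)
  obtain ⟨b, -, hb⟩ := (SmoothBumpFunction.nhds_basis_tsupport (I := 𝓘(ℝ, E)) (1 : G)).mem_iff.1 hV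
  have hb0 : ∀ x, x ∉ U ∩ U⁻¹ → b x = 0 := fun x hx => by
    by_contra h
    exact hx (hb (subset_closure h))
  let φ : G → ℝ := fun x => b x + b x⁻¹
  have hφs : ContMDiff 𝓘(ℝ, E) 𝓘(ℝ, ℝ) ∞ φ :=
    b.contMDiff.add (b.contMDiff.comp (contMDiff_inv 𝓘(ℝ, E) ∞))
  have hφ0 : ∀ x, 0 ≤ φ x := fun x => add_nonneg b.nonneg b.nonneg
  have hpos : 0 < ∫ x, φ x ∂μ := by
    refine hφs.continuous.integral_pos_of_hasCompactSupport_nonneg_nonzero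
      (HasCompactSupport.of_compactSpace _) hφ0 (x := 1) ?_
    simp [φ]
  refine ⟨fun x => (∫ x, φ x ∂μ)⁻¹ * φ x, contMDiff_const.mul hφs, fun x => ?_, fun x => ?_,
    fun x hx => ?_, ?_⟩
  · exact mul_nonneg (inv_nonneg.2 hpos.le) (hφ0 x)
  · simp [φ, add_comm]
  · have h1 : b x = 0 := hb0 x fun h => hx h.1
    have h2 : b x⁻¹ = 0 := hb0 _ fun h => hx (by simpa using h.2)
    simp [φ, h1, h2]
  · rw [integral_const_mul, inv_mul_cancel₀ hpos.ne']

/-- Uniform continuity of `h`, obtained as continuity at `1` of the `C(G, ℂ)`-valued map `y ↦ h (y⁻¹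
* ·)`. -/
theorem exists_nhds_one_norm_sub_lt (h : C(G, ℂ)) {ε : ℝ} (hε : 0 < ε) :
    ∃ U ∈ 𝓝 (1 : G), ∀ y ∈ U, ∀ x, ‖h (y⁻¹ * x) - h x‖ ≤ ε := by
  let F : C(G, C(G, ℂ)) := ContinuousMap.curry ⟨fun z : G × G => h (z.1⁻¹ * z.2), by fun_prop⟩
  have h1 : F 1 = h := by ext x; simp [F]
  refine ⟨F ⁻¹' Metric.closedBall h ε, ?_, fun y hy x => ?_⟩
  · exact F.continuous.continuousAt.preimage_mem_nhds
      (by rw [h1]; exact Metric.closedBall_mem_nhds _ hε)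
  · have hy' : ‖F y - h‖ ≤ ε := by simpa [dist_eq_norm] using hy
    exact ((F y - h).norm_coe_le_norm x).trans hy'

variable (E) in
/-- There is an approximate identity consisting of smooth symmetric functions. -/
theorem exists_smooth_approximate_identity :
    ∃ ψ : ℕ → C(G, ℂ), (∀ k, ContMDiff 𝓘(ℝ, E) 𝓘(ℝ, ℂ) ∞ (ψ k)) ∧
      (∀ k x, ψ k x⁻¹ = star (ψ k x)) ∧
      ∀ h : C(G, ℂ), Tendsto (fun k => conv μ (ψ k) h) atTop (𝓝 h) := by
  -- Second countability provides a countable neighbourhood basis at `1`, so that a sequence of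
  -- mollifiers is enough.
  have : SecondCountableTopology G := ChartedSpace.secondCountable_of_sigmaCompact E G
  obtain ⟨U, hU⟩ := (𝓝 (1 : G)).exists_antitone_basis
  choose φ hφs hφ0 hφi hφU hφ1 using fun k => exists_smooth_mollifier E μ (hU.mem k)
  let ψ : ℕ → C(G, ℂ) := fun k => ⟨fun x => (φ k x : ℂ), by
    have := (hφs k).continuous
    fun_prop⟩
  have hψ : ∀ k x, ψ k x = (φ k x : ℂ) := fun _ _ => rfl
  refine ⟨ψ, fun k => ?_, fun k x => by simp [hψ, hφi], fun h => ?_⟩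
  · exact Complex.ofRealCLM.contDiff.contMDiff.comp (hφs k)
  rw [Metric.tendsto_atTop]
  intro ε hε
  obtain ⟨V, hV, hVh⟩ := exists_nhds_one_norm_sub_lt h (half_pos hε)
  obtain ⟨N, hN⟩ := hU.mem_iff.1 hV
  refine ⟨N, fun k hk => lt_of_le_of_lt ?_ (half_lt_self hε)⟩
  rw [dist_eq_norm]
  refine (ContinuousMap.norm_le _ (half_pos hε).le).2 fun x => ?_
  have hint : Integrable (φ k) μ := (hφs k).continuous.integrable_of_hasCompactSupport
      (HasCompactSupport.of_compactSpace _)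
  have e : (conv μ (ψ k) h - h) x = ∫ y, (φ k y : ℂ) * (h (y⁻¹ * x) - h x) ∂μ := by
    have hi : Integrable (fun y => (φ k y : ℂ) * h (y⁻¹ * x)) μ := integrable_of_continuous μ
      (by have := (hφs k).continuous; fun_prop)
    have hi' : Integrable (fun y => (φ k y : ℂ) * h x) μ := hint.ofReal.mul_const _
    simp only [mul_sub]
    rw [integral_sub hi hi', integral_mul_const, integral_complex_ofReal, hφ1]
    simp [conv_apply', hψ]
  rw [e]
  calc ‖∫ y, (φ k y : ℂ) * (h (y⁻¹ * x) - h x) ∂μ‖ ≤ ∫ y, φ k y * (ε / 2) ∂μ := by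
        refine norm_integral_le_of_norm_le (hint.mul_const _) (ae_of_all _ fun y => ?_)
        rw [norm_mul, Complex.norm_real, Real.norm_of_nonneg (hφ0 k y)]
        by_cases hy : y ∈ U k
        · exact mul_le_mul_of_nonneg_left (hVh y (hN (hU.antitone hk hy)) x) (hφ0 k y)
        · simp [hφU k y hy]
    _ = ε / 2 := by rw [integral_mul_const, hφ1, one_mul]

end Mollifier

/-! ### Schur's lemma and the orthogonality relations -/

namespace UnitaryIrrep

variable {G : Type*} [TopologicalSpace G] [Group G] (ξ η : UnitaryIrrep G)

theorem mat_one : ξ.mat 1 = 1 := by simp [mat]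

theorem mat_mul (x y : G) : ξ.mat (x * y) = ξ.mat x * ξ.mat y := by simp [mat]

theorem conjTranspose_mul_mat (x : G) : (ξ.mat x)ᴴ * ξ.mat x = 1 :=
  Matrix.mem_unitaryGroup_iff'.1 (ξ.hom x).2

theorem mat_mul_conjTranspose (x : G) : ξ.mat x * (ξ.mat x)ᴴ = 1 :=
  Matrix.mem_unitaryGroup_iff.1 (ξ.hom x).2

theorem mat_inv (x : G) : ξ.mat x⁻¹ = (ξ.mat x)ᴴ := by
  have h : ξ.mat x⁻¹ * ξ.mat x = 1 := by rw [← mat_mul, inv_mul_cancel, mat_one]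
  calc ξ.mat x⁻¹ = ξ.mat x⁻¹ * (ξ.mat x * (ξ.mat x)ᴴ) := by rw [mat_mul_conjTranspose, mul_one]
    _ = (ξ.mat x)ᴴ := by rw [← mul_assoc, h, one_mul]

theorem mat_inv_apply (x : G) (i j : Fin ξ.dim) : ξ.mat x⁻¹ i j = star (ξ.mat x j i) := by
  rw [mat_inv, Matrix.conjTranspose_apply]

theorem mat_mul_apply (x y : G) (i j : Fin ξ.dim) :
    ξ.mat (x * y) i j = ∑ k, ξ.mat x i k * ξ.mat y k j := by
  rw [mat_mul, Matrix.mul_apply]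

theorem continuous_mat_apply (i j : Fin ξ.dim) : Continuous fun x => ξ.mat x i j := by
  have h : Continuous fun x => ξ.mat x := continuous_subtype_val.comp ξ.continuous_hom
  exact h.matrix_elem i j

/-- The matrix coefficient `ξ_{ij}` as a continuous function. -/
def coeff (i j : Fin ξ.dim) : C(G, ℂ) := ⟨fun x => ξ.mat x i j, ξ.continuous_mat_apply i j⟩

@[simp]
theorem coeff_apply (i j : Fin ξ.dim) (x : G) : ξ.coeff i j x = ξ.mat x i j := rfl

theorem eq_bot_or_eq_top (S : Submodule ℂ (Fin ξ.dim → ℂ))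
    (hS : ∀ x, ∀ v ∈ S, ξ.mat x *ᵥ v ∈ S) : S = ⊥ ∨ S = ⊤ := by
  have := ξ.irreducible
  let S' : Subrepresentation ((Matrix.toLinAlgEquiv' (R := ℂ) (n := Fin ξ.dim) :
        Matrix (Fin ξ.dim) (Fin ξ.dim) ℂ →* ((Fin ξ.dim → ℂ) →ₗ[ℂ] (Fin ξ.dim → ℂ))).comp
      ((Matrix.unitaryGroup (Fin ξ.dim) ℂ).subtype.comp ξ.hom) :
        Representation ℂ G (Fin ξ.dim → ℂ)) := ⟨S, fun x v hv => hS x v hv⟩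
  rcases IsSimpleOrder.eq_bot_or_eq_top S' with h | h
  · exact Or.inl (congrArg Subrepresentation.toSubmodule h)
  · exact Or.inr (congrArg Subrepresentation.toSubmodule h)

theorem dim_pos : 0 < ξ.dim := by
  have := ξ.irreducible
  rcases Nat.eq_zero_or_pos ξ.dim with h | h
  · exfalso
    have h0 : ∀ v w : Fin ξ.dim → ℂ, v = w := fun v w => by
      funext i
      exact absurd i.2 (by omega)
    refine bot_ne_top (α := Subrepresentation ((Matrix.toLinAlgEquiv' (R := ℂ) (n := Fin ξ.dim) :
        Matrix (Fin ξ.dim) (Fin ξ.dim) ℂ →* ((Fin ξ.dim → ℂ) →ₗ[ℂ] (Fin ξ.dim → ℂ))).comp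
      ((Matrix.unitaryGroup (Fin ξ.dim) ℂ).subtype.comp ξ.hom) :
        Representation ℂ G (Fin ξ.dim → ℂ))) ?_
    refine le_antisymm bot_le fun v _ => ?_
    rw [h0 v 0]
    exact zero_mem (⊥ : Submodule ℂ (Fin ξ.dim → ℂ))
  · exact h

instance : NeZero ξ.dim := ⟨ξ.dim_pos.ne'⟩

/-- **Schur's lemma**: a matrix commuting with an irreducible representation is scalar. -/
theorem eq_smul_one_of_commute (A : Matrix (Fin ξ.dim) (Fin ξ.dim) ℂ)
    (hA : ∀ x, A * ξ.mat x = ξ.mat x * A) : ∃ c : ℂ, A = c • 1 := by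
  obtain ⟨c, hc⟩ := Module.End.exists_eigenvalue (Matrix.toLin' A)
  refine ⟨c, ?_⟩
  have hmem : ∀ v, v ∈ Module.End.eigenspace (Matrix.toLin' A) c ↔ A *ᵥ v = c • v := fun v => by
    rw [Module.End.mem_eigenspace_iff, Matrix.toLin'_apply]
  -- The eigenspace is invariant because `A` commutes with `ξ`, and it is non-zero, so
  -- irreducibility makes it the whole space.
  have htop : Module.End.eigenspace (Matrix.toLin' A) c = ⊤ := by
    refine (ξ.eq_bot_or_eq_top _ fun x v hv => ?_).resolve_left hc
    rw [hmem] at hv ⊢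
    rw [Matrix.mulVec_mulVec, hA, ← Matrix.mulVec_mulVec, hv, Matrix.mulVec_smul]
  ext i j
  have := (hmem (Pi.single j 1)).1 (htop ▸ Submodule.mem_top)
  have := congrFun this i
  simpa [Matrix.one_apply, Pi.single_apply] using this

/-- **Schur's lemma**: intertwiners between inequivalent irreducible representations vanish. -/
theorem intertwiner_eq_zero (T : Matrix (Fin η.dim) (Fin ξ.dim) ℂ)
    (hT : ∀ x, T * ξ.mat x = η.mat x * T) (hne : ¬ (unitaryIrrepSetoid G).r ξ η) : T = 0 := by
  by_contra hT0
  have hT' : ∀ x, Tᴴ * η.mat x = ξ.mat x * Tᴴ := fun x => by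
    have := congrArg Matrix.conjTranspose (hT x⁻¹)
    simpa [Matrix.conjTranspose_mul, mat_inv] using this.symm
  obtain ⟨c, hc⟩ := ξ.eq_smul_one_of_commute (Tᴴ * T) fun x => by
    rw [Matrix.mul_assoc, hT, ← Matrix.mul_assoc, hT', Matrix.mul_assoc]
  obtain ⟨c', hc'⟩ := η.eq_smul_one_of_commute (T * Tᴴ) fun x => by
    rw [Matrix.mul_assoc, hT', ← Matrix.mul_assoc, hT, Matrix.mul_assoc]
  -- The product `T * Tᴴ * T` equals both `c' • T` and `c • T`.
  have hcc : c' = c := by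
    have h1 : c' • T = c • T := by
      calc c' • T = (T * Tᴴ) * T := by rw [hc']; simp
        _ = c • T := by rw [Matrix.mul_assoc, hc]; simp
    exact smul_left_injective ℂ hT0 h1
  -- The scalar is the squared norm of a column of `T`, so it is real and non-negative; being
  -- non-zero it is positive, and `T / √c` is then a unitary equivalence, contradicting `hne`.
  have hcr : c = ((∑ i, ‖T i 0‖ ^ 2 : ℝ) : ℂ) := by
    have := congrFun (congrFun hc 0) 0
    simp only [Matrix.mul_apply, Matrix.conjTranspose_apply, Matrix.smul_apply, Matrix.one_apply_eq,
      smul_eq_mul, mul_one] at this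
    rw [← this]
    push_cast
    exact Finset.sum_congr rfl fun i _ => by
      rw [mul_comm]; exact Complex.mul_conj' (T i 0)
  have hc0 : c ≠ 0 := by
    intro h0
    open scoped ComplexOrder in refine hT0 (Matrix.conjTranspose_mul_self_eq_zero.1 ?_)
    rw [hc, h0, zero_smul]
  set r : ℝ := ∑ i, ‖T i 0‖ ^ 2 with hr
  have hr0 : 0 ≤ r := Finset.sum_nonneg fun i _ => by positivity
  have hrr : (((√r)⁻¹ : ℝ) : ℂ) * (((√r)⁻¹ : ℝ) : ℂ) * c = 1 := by
    have h1 : r ≠ 0 := fun h => hc0 (by rw [hcr, h]; simp)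
    rw [hcr, ← Complex.ofReal_mul, ← Complex.ofReal_mul, ← mul_inv, Real.mul_self_sqrt hr0,
      inv_mul_cancel₀ h1, Complex.ofReal_one]
  refine hne ⟨((((√r)⁻¹ : ℝ) : ℂ)) • T, ?_, ?_, fun x => ?_⟩
  · rw [Matrix.conjTranspose_smul, Matrix.smul_mul, Matrix.mul_smul, hc, smul_smul, smul_smul]
    simp only [RCLike.star_def, Complex.conj_ofReal]
    rw [hrr, one_smul]
  · rw [Matrix.conjTranspose_smul, Matrix.smul_mul, Matrix.mul_smul, hc', hcc, smul_smul, smul_smul]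
    simp only [RCLike.star_def, Complex.conj_ofReal]
    rw [hrr, one_smul]
  · rw [Matrix.smul_mul, Matrix.mul_smul, hT]

variable [IsTopologicalGroup G] [CompactSpace G]
  [MeasurableSpace G] [BorelSpace G] (μ : Measure G) [μ.IsHaarMeasure] [IsProbabilityMeasure μ]

/-- The matrix `∫ η_{ia} conj ξ_{jb}`, for fixed `a` and `b`. -/
def coeffInner (a : Fin η.dim) (b : Fin ξ.dim) : Matrix (Fin η.dim) (Fin ξ.dim) ℂ :=
  Matrix.of fun i j => ∫ x, η.mat x i a * star (ξ.mat x j b) ∂μ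

/-- The matrix is the average of `η(x) E_{ab} ξ(x)ᴴ` over `G`, with `E_{ab}` a matrix unit; the
substitution `x ↦ y * x` shows that it intertwines. -/
theorem coeffInner_intertwines (a : Fin η.dim) (b : Fin ξ.dim) (y : G) :
    coeffInner ξ η μ a b * ξ.mat y = η.mat y * coeffInner ξ η μ a b := by
  have hξ := ξ.continuous_mat_apply
  have hη := η.continuous_mat_apply
  have hi : ∀ i k j l, Integrable (fun x => η.mat x i k * star (ξ.mat x j l)) μ := fun i k j l =>
    integrable_of_continuous μ ((hη i k).mul (continuous_star.comp (hξ j l)))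
  ext i j
  have h1 : (η.mat y * coeffInner ξ η μ a b) i j
      = ∫ x, η.mat (y * x) i a * star (ξ.mat x j b) ∂μ := by
    simp only [Matrix.mul_apply, coeffInner, Matrix.of_apply, mat_mul_apply, Finset.sum_mul]
    rw [integral_finsetSum _ fun k _ => ?_]
    · simp only [mul_assoc, integral_const_mul]
    · simpa only [mul_assoc] using (hi k a j b).const_mul (η.mat y i k)
  have h2 : (coeffInner ξ η μ a b * ξ.mat y) i j
      = ∫ x, η.mat x i a * star (ξ.mat (y⁻¹ * x) j b) ∂μ := by
    simp only [Matrix.mul_apply, coeffInner, Matrix.of_apply, mat_mul_apply, star_sum, star_mul',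
      Finset.mul_sum, mat_inv_apply, star_star]
    rw [integral_finsetSum _ fun k _ => ?_]
    · refine Finset.sum_congr rfl fun k _ => ?_
      rw [← integral_mul_const]
      refine integral_congr_ae (ae_of_all _ fun x => ?_)
      simp only
      ring
    · convert! (hi i a k b).const_mul (ξ.mat y k j) using 2
      ring
  rw [h1, h2, ← integral_mul_left_eq_self _ y]
  simp

/-- Schur orthogonality for inequivalent representations. -/
theorem integral_coeff_eq_zero (hne : ¬ (unitaryIrrepSetoid G).r ξ η) (i a : Fin η.dim)
    (j b : Fin ξ.dim) : ∫ x, η.mat x i a * star (ξ.mat x j b) ∂μ = 0 := by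
  have := intertwiner_eq_zero ξ η _ (coeffInner_intertwines ξ η μ a b) hne
  exact congrFun (congrFun this i) j

/-- Schur orthogonality for the coefficients of one representation. -/
theorem integral_coeff_mul_star (i a j b : Fin ξ.dim) :
    ∫ x, ξ.mat x i a * star (ξ.mat x j b) ∂μ =
      if i = j ∧ a = b then (ξ.dim : ℂ)⁻¹ else 0 := by
  obtain ⟨c, hc⟩ := ξ.eq_smul_one_of_commute _ (coeffInner_intertwines ξ ξ μ a b)
  have hξ := ξ.continuous_mat_apply
  -- Taking the trace identifies the Schur scalar, since the columns of `ξ(x)` are orthonormal for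
  -- every `x`.
  have htr : (ξ.dim : ℂ) * c = if a = b then 1 else 0 := by
    have h1 : (coeffInner ξ ξ μ a b).trace = ξ.dim * c := by
      rw [hc]; simp [mul_comm]
    rw [← h1]
    simp only [Matrix.trace, coeffInner, Matrix.diag_apply, Matrix.of_apply]
    have hi : ∀ k, Integrable (fun x => ξ.mat x k a * star (ξ.mat x k b)) μ := fun k =>
      integrable_of_continuous μ ((hξ k a).mul (continuous_star.comp (hξ k b)))
    rw [← integral_finsetSum _ fun k _ => hi k]
    have h2 : ∀ x, ∑ k, ξ.mat x k a * star (ξ.mat x k b) = if a = b then 1 else 0 := fun x => by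
      have := congrFun (congrFun (ξ.conjTranspose_mul_mat x) b) a
      simp only [Matrix.mul_apply, Matrix.conjTranspose_apply, Matrix.one_apply] at this
      simp only [mul_comm _ (star _), this, eq_comm]
    simp only [h2, integral_const, probReal_univ, one_smul]
  have h := congrFun (congrFun hc i) j
  simp only [coeffInner, Matrix.of_apply, Matrix.smul_apply, Matrix.one_apply, smul_eq_mul] at h
  rw [h]
  have hd : (ξ.dim : ℂ) ≠ 0 := by exact_mod_cast ξ.dim_pos.ne'
  have hc' : c = (ξ.dim : ℂ)⁻¹ * if a = b then 1 else 0 := by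
    rw [← htr, inv_mul_cancel_left₀ hd]
  rw [hc']
  split_ifs <;> simp_all

end UnitaryIrrep

/-- A unitary matrix representation without proper invariant subspaces. -/
def UnitaryIrrep.ofInvariant {G : Type*} [TopologicalSpace G] [Group G] {d : ℕ} (hd : 0 < d)
    (φ : G →* Matrix.unitaryGroup (Fin d) ℂ) (hφ : Continuous φ)
    (h : ∀ S : Submodule ℂ (Fin d → ℂ),
      (∀ x, ∀ v ∈ S, (φ x : Matrix (Fin d) (Fin d) ℂ) *ᵥ v ∈ S) → S = ⊥ ∨ S = ⊤) :
    UnitaryIrrep G where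
  dim := d
  hom := φ
  continuous_hom := hφ
  irreducible :=
    { exists_pair_ne := by
        refine ⟨⊥, ⊤, fun hbt => ?_⟩
        have h1 : (⊥ : Submodule ℂ (Fin d → ℂ)) = ⊤ :=
          congrArg Subrepresentation.toSubmodule hbt
        have : Nonempty (Fin d) := ⟨⟨0, hd⟩⟩
        exact bot_ne_top h1
      eq_bot_or_eq_top := fun S => by
        rcases h S.toSubmodule fun x v hv => S.apply_mem_toSubmodule x hv with h | h
        · exact Or.inl (Subrepresentation.toSubmodule_injective h)
        · exact Or.inr (Subrepresentation.toSubmodule_injective h) }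

/-- The trivial representation. -/
def trivialIrrep (G : Type*) [TopologicalSpace G] [Group G] : UnitaryIrrep G :=
  UnitaryIrrep.ofInvariant one_pos 1 continuous_const fun S _ =>
    (is_simple_module_of_finrank_eq_one (K := ℂ) (V := Fin 1 → ℂ) (by simp)).eq_bot_or_eq_top S

@[simp]
theorem trivialIrrep_mat {G : Type*} [TopologicalSpace G] [Group G] (x : G) :
    (trivialIrrep G).mat x = 1 := rfl

/-! ### The Peter–Weyl theorem -/

/-- The restriction of `T` to the closed invariant subspace `Q` is compact and self-adjoint, and
such an operator vanishes when it has no non-zero eigenvalue. -/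
theorem eq_zero_of_no_eigenvector {H : Type*} [NormedAddCommGroup H] [InnerProductSpace ℂ H]
    [CompleteSpace H] {T : H →L[ℂ] H} (hT : IsCompactOperator T) (hT' : T.IsSymmetric)
    {Q : Submodule ℂ H} (hQ : IsClosed (Q : Set H)) (hTQ : ∀ v ∈ Q, (T : H →ₗ[ℂ] H) v ∈ Q)
    (h : ∀ l : ℂ, l ≠ 0 → ∀ v ∈ Q, T v = l • v → v = 0) {q : H} (hq : q ∈ Q) : T q = 0 := by
  have : CompleteSpace Q := hQ.completeSpace_coe
  let S : Q →L[ℂ] Q := T.restrict hTQ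
  have hSc : IsCompactOperator S := hT.restrict' hTQ
  have hSs : S.IsSymmetric := hT'.restrict_invariant hTQ
  have hS0 : S = 0 := by
    refine (ContinuousLinearMap.eq_zero_of_forall_hasEigenvalue_eq_zero hSc hSs).1 fun l hl => ?_
    by_contra hl0
    obtain ⟨v, hv⟩ := hl.exists_hasEigenvector
    have hTv : T v = l • (v : H) := congrArg Subtype.val hv.apply_eq_smul
    exact hv.2 (Subtype.ext (h l hl0 v v.2 hTv))
  exact congrArg Subtype.val (DFunLike.congr_fun hS0 ⟨q, hq⟩)

section PeterWeyl

variable (G : Type*) [TopologicalSpace G] [Group G]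

/-- The span of the matrix coefficients of irreducible unitary representations. -/
def trigPoly : Submodule ℂ C(G, ℂ) :=
  Submodule.span ℂ {f | ∃ (ξ : UnitaryIrrep G) (i j : Fin ξ.dim), f = ξ.coeff i j}

variable {G}

theorem coeff_mem_trigPoly (ξ : UnitaryIrrep G) (i j : Fin ξ.dim) : ξ.coeff i j ∈ trigPoly G :=
  Submodule.subset_span ⟨ξ, i, j, rfl⟩

variable [IsTopologicalGroup G] [CompactSpace G] [MeasurableSpace G] [BorelSpace G]

theorem rightTranslate_mem_trigPoly {f : C(G, ℂ)} (hf : f ∈ trigPoly G) (a : G) :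
    rightTranslate a f ∈ trigPoly G := by
  suffices h : trigPoly G ≤ (trigPoly G).comap (rightTranslate a) from h hf
  refine Submodule.span_le.2 ?_
  rintro _ ⟨ξ, i, j, rfl⟩
  have : rightTranslate a (ξ.coeff i j) = ∑ k, ξ.mat a k j • ξ.coeff i k := by
    ext x
    rw [rightTranslate_apply, UnitaryIrrep.coeff_apply, UnitaryIrrep.mat_mul_apply]
    simp [mul_comm]
  change rightTranslate a (ξ.coeff i j) ∈ trigPoly G
  rw [this]
  exact Submodule.sum_mem _ fun k _ => Submodule.smul_mem _ _ (coeff_mem_trigPoly ξ i k)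

variable (μ : Measure G) [μ.IsHaarMeasure] [IsProbabilityMeasure μ]

/-- From `ξ(y x) = ξ(y) ξ(x)`: convolution multiplies the matrix function `ξ` on the left by the
constant matrix `(p * ξ)(1)`. -/
theorem conv_coeff (p : C(G, ℂ)) (ξ : UnitaryIrrep G) (i j : Fin ξ.dim) :
    conv μ p (ξ.coeff i j) = ∑ k, conv μ p (ξ.coeff i k) 1 • ξ.coeff k j := by
  ext x
  simp only [conv_apply_right, ContinuousMap.coe_sum, Finset.sum_apply, ContinuousMap.smul_apply,
    UnitaryIrrep.coeff_apply, smul_eq_mul, mul_one, UnitaryIrrep.mat_mul_apply, Finset.mul_sum]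
  have hi : ∀ k, Integrable (fun y => p y⁻¹ * ξ.mat y i k) μ := fun k =>
    integrable_of_continuous μ ((p.continuous.comp continuous_inv).mul (ξ.continuous_mat_apply i k))
  rw [integral_finsetSum _ fun k _ => ?_]
  · simp only [← mul_assoc, integral_mul_const]
  · simpa only [mul_assoc] using (hi k).mul_const (ξ.mat x k j)

theorem conv_mem_trigPoly (p : C(G, ℂ)) {f : C(G, ℂ)} (hf : f ∈ trigPoly G) :
    conv μ p f ∈ trigPoly G := by
  suffices h : trigPoly G ≤ (trigPoly G).comap ((convL2 μ p ∘L toL2 μ).toLinearMap) from h hf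
  refine Submodule.span_le.2 ?_
  rintro _ ⟨ξ, i, j, rfl⟩
  change conv μ p (ξ.coeff i j) ∈ trigPoly G
  rw [conv_coeff]
  exact Submodule.sum_mem _ fun k _ => Submodule.smul_mem _ _ (coeff_mem_trigPoly ξ k j)

theorem conv_mem_trigPoly_left {p : C(G, ℂ)} (hp : p ∈ trigPoly G) (f : C(G, ℂ)) :
    conv μ p f ∈ trigPoly G := by
  let L : C(G, ℂ) →ₗ[ℂ] C(G, ℂ) :=
    { toFun := fun p => conv μ p f
      map_add' := fun p q => conv_add_left μ p q f
      map_smul' := fun c p => conv_smul_left μ c p f }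
  suffices h : trigPoly G ≤ (trigPoly G).comap L from h hp
  refine Submodule.span_le.2 ?_
  rintro _ ⟨ξ, i, j, rfl⟩
  have : conv μ (ξ.coeff i j) f = ∑ k, (∫ y, ξ.mat y⁻¹ k j * f y ∂μ) • ξ.coeff i k := by
    ext x
    simp only [conv_apply, ContinuousMap.coe_sum, Finset.sum_apply, ContinuousMap.smul_apply,
      UnitaryIrrep.coeff_apply, smul_eq_mul, UnitaryIrrep.mat_mul_apply, Finset.sum_mul]
    have hi : ∀ k, Integrable (fun y => ξ.mat y⁻¹ k j * f y) μ := fun k =>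
      integrable_of_continuous μ
        (((ξ.continuous_mat_apply k j).comp continuous_inv).mul f.continuous)
    rw [integral_finsetSum _ fun k _ => ?_]
    · refine Finset.sum_congr rfl fun k _ => ?_
      rw [mul_comm, ← integral_const_mul]
      simp only [mul_assoc]
    · simpa only [mul_assoc] using (hi k).const_mul (ξ.mat x i k)
  change conv μ (ξ.coeff i j) f ∈ trigPoly G
  rw [this]
  exact Submodule.sum_mem _ fun k _ => Submodule.smul_mem _ _ (coeff_mem_trigPoly ξ i k)

/-- The orthonormal basis is taken for the `L²` inner product but consists of continuous functions,
so that the expansion holds pointwise and can be evaluated at `1`. -/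
theorem exists_orthonormal_span (W : Submodule ℂ C(G, ℂ)) [FiniteDimensional ℂ W] (hW : W ≠ ⊥) :
    ∃ d : ℕ, 0 < d ∧ ∃ c : Fin d → C(G, ℂ), (∀ i, c i ∈ W) ∧
      Orthonormal ℂ (fun i => toL2 μ (c i)) ∧
      ∀ w ∈ W, w = ∑ i, inner ℂ (toL2 μ (c i)) (toL2 μ w) • c i := by
  let W' := W.map (toL2 μ).toLinearMap
  have : FiniteDimensional ℂ W' := inferInstance
  let b := stdOrthonormalBasis ℂ W'
  have hex : ∀ i, ∃ f ∈ W, toL2 μ f = (b i : Lp ℂ 2 μ) := fun i => (b i).2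
  choose c hcW hc using hex
  refine ⟨_, ?_, c, hcW, ?_, fun w hw => ?_⟩
  · rw [Nat.pos_iff_ne_zero]
    intro h0
    have : W' = ⊥ := Submodule.finrank_eq_zero.1 h0
    refine hW ((Submodule.eq_bot_iff _).2 fun w hw => toL2_injective μ ?_)
    have h1 : toL2 μ w ∈ W' := Submodule.mem_map_of_mem hw
    rw [this] at h1
    rw [map_zero]
    exact h1
  · simp only [hc]
    exact b.orthonormal.comp_linearIsometry W'.subtypeₗᵢ
  · apply toL2_injective μ
    have h1 := b.sum_repr' ⟨toL2 μ w, Submodule.mem_map_of_mem hw⟩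
    have h2 := congrArg (Subtype.val) h1
    rw [map_sum]
    simp only [map_smul, hc]
    refine h2.symm.trans ?_
    simp [Submodule.coe_inner]

/-- A minimal finite-dimensional translation-invariant space of continuous functions contains a
non-zero combination of matrix coefficients. -/
theorem exists_mem_trigPoly_of_minimal (μ : Measure G) [μ.IsHaarMeasure]
    [IsProbabilityMeasure μ] (W : Submodule ℂ C(G, ℂ)) [FiniteDimensional ℂ W]
    (hW : W ≠ ⊥) (hinv : ∀ a, ∀ f ∈ W, rightTranslate a f ∈ W)
    (hmin : ∀ S ≤ W, (∀ a, ∀ f ∈ S, rightTranslate a f ∈ S) → S = ⊥ ∨ S = W) :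
    ∃ f ∈ W, f ≠ 0 ∧ f ∈ trigPoly G := by
  obtain ⟨d, hd, c, hcW, hon, hexp⟩ := exists_orthonormal_span μ W hW
  -- The matrix of right translation by `a` in the orthonormal basis `c`. Right invariance of Haar
  -- measure makes it unitary, and minimality of `W` makes it irreducible.
  let A : G → Matrix (Fin d) (Fin d) ℂ := fun a => Matrix.of fun i j =>
    inner ℂ (toL2 μ (c i)) (toL2 μ (rightTranslate a (c j)))
  have hR : ∀ a j, rightTranslate a (c j) = ∑ i, A a i j • c i := fun a j =>
    hexp _ (hinv a _ (hcW j))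
  have hdel : ∀ i j, inner ℂ (toL2 μ (c i)) (toL2 μ (c j)) = (1 : Matrix (Fin d) (Fin d) ℂ) i j :=
    fun i j => by rw [orthonormal_iff_ite.1 hon i j, Matrix.one_apply]
  have hA1 : A 1 = 1 := by
    ext i j
    have : rightTranslate 1 (c j) = c j := by ext x; simp
    simp only [A, Matrix.of_apply, this, hdel]
  have hAmul : ∀ a b, A (a * b) = A a * A b := fun a b => by
    ext i j
    have h1 : rightTranslate (a * b) (c j) = rightTranslate a (rightTranslate b (c j)) := by
      ext x; simp [mul_assoc]
    change inner ℂ (toL2 μ (c i)) (toL2 μ (rightTranslate (a * b) (c j))) = _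
    rw [h1, hR b j, map_sum, map_sum, inner_sum, Matrix.mul_apply]
    refine Finset.sum_congr rfl fun k _ => ?_
    rw [map_smul, map_smul, inner_smul_right, mul_comm]
    rfl
  have hAu : ∀ a, star (A a) * A a = 1 := fun a => by
    ext i j
    rw [← hdel, ← inner_rightTranslate μ (c i) (c j) a, hR a i, hR a j]
    simp only [map_sum, map_smul, sum_inner, inner_sum, inner_smul_left, inner_smul_right, hdel,
      Matrix.one_apply, Matrix.mul_apply, Matrix.star_apply]
    simp [mul_comm]
  let φ : G →* Matrix.unitaryGroup (Fin d) ℂ :=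
    MonoidHom.mk' (fun a => ⟨A a, Matrix.mem_unitaryGroup_iff'.2 (hAu a)⟩)
      fun a b => Subtype.ext (hAmul a b)
  have hφ : Continuous φ := by
    refine Continuous.subtype_mk (continuous_matrix fun i j => ?_) _
    exact continuous_const.inner ((toL2 μ).continuous.comp (continuous_rightTranslate (c j)))
  let Φ : (Fin d → ℂ) →ₗ[ℂ] C(G, ℂ) := Fintype.linearCombination ℂ c
  have hΦ : ∀ v, Φ v = ∑ i, v i • c i := fun v => Fintype.linearCombination_apply ℂ c v
  have hΦinj : Function.Injective Φ := by
    refine (injective_iff_map_eq_zero Φ).2 fun v hv => ?_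
    funext i
    have h1 : inner ℂ (toL2 μ (c i)) (toL2 μ (Φ v)) = v i := by
      rw [hΦ, map_sum, inner_sum]
      simp [inner_smul_right, hdel, Matrix.one_apply]
    rw [← h1, hv]
    simp
  have hΦR : ∀ a v, rightTranslate a (Φ v) = Φ (A a *ᵥ v) := fun a v => by
    simp only [hΦ, map_sum, map_smul, hR, Matrix.mulVec, dotProduct, Finset.smul_sum,
      Finset.sum_smul, smul_smul]
    rw [Finset.sum_comm]
    simp only [mul_comm]
  have hirr : ∀ S : Submodule ℂ (Fin d → ℂ),
      (∀ x, ∀ v ∈ S, (φ x : Matrix (Fin d) (Fin d) ℂ) *ᵥ v ∈ S) → S = ⊥ ∨ S = ⊤ := by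
    intro S hS
    have hle : S.map Φ ≤ W := by
      rintro _ ⟨v, -, rfl⟩
      rw [hΦ]
      exact Submodule.sum_mem _ fun i _ => Submodule.smul_mem _ _ (hcW i)
    have hinvS : ∀ a, ∀ f ∈ S.map Φ, rightTranslate a f ∈ S.map Φ := by
      rintro a _ ⟨v, hv, rfl⟩
      exact ⟨A a *ᵥ v, hS a v hv, (hΦR a v).symm⟩
    rcases hmin (S.map Φ) hle hinvS with h | h
    · refine Or.inl ((Submodule.eq_bot_iff _).2 fun v hv => hΦinj ?_)
      have h1 : Φ v ∈ S.map Φ := Submodule.mem_map_of_mem hv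
      rw [h] at h1
      rw [map_zero]
      exact h1
    · refine Or.inr (Submodule.eq_top_iff'.2 fun v => ?_)
      have : Φ v ∈ S.map Φ := by
        rw [h, hΦ]
        exact Submodule.sum_mem _ fun i _ => Submodule.smul_mem _ _ (hcW i)
      obtain ⟨w, hw, hwv⟩ := this
      rwa [← hΦinj hwv]
  let ξ : UnitaryIrrep G := UnitaryIrrep.ofInvariant hd φ hφ hirr
  refine ⟨c ⟨0, hd⟩, hcW _, ?_, ?_⟩
  · intro h0
    have := hon.ne_zero ⟨0, hd⟩
    rw [h0] at this
    simp at this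
  -- Evaluating the right translate by `x` at the identity recovers the value at `x`, and expands it
  -- in matrix coefficients.
  · have : c ⟨0, hd⟩ = ∑ i, c i 1 • ξ.coeff i ⟨0, hd⟩ := by
      ext x
      have h1 := DFunLike.congr_fun (hR x ⟨0, hd⟩) 1
      simp only [rightTranslate_apply, one_mul, ContinuousMap.coe_sum, Finset.sum_apply,
        ContinuousMap.smul_apply, smul_eq_mul] at h1
      rw [h1]
      simp only [ContinuousMap.coe_sum, Finset.sum_apply, ContinuousMap.smul_apply, smul_eq_mul,
        mul_comm (A x _ _)]
      rfl
    rw [this]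
    exact Submodule.sum_mem _ fun k _ => Submodule.smul_mem _ _ (coeff_mem_trigPoly ξ k _)

/-- Descent on the dimension: a space that is not minimal contains a non-zero invariant subspace of
smaller dimension. -/
theorem exists_mem_trigPoly_of_finrank (μ : Measure G) [μ.IsHaarMeasure]
    [IsProbabilityMeasure μ] (m : ℕ) : ∀ W : Submodule ℂ C(G, ℂ),
    FiniteDimensional ℂ W → Module.finrank ℂ W = m → W ≠ ⊥ →
    (∀ a, ∀ f ∈ W, rightTranslate a f ∈ W) → ∃ f ∈ W, f ≠ 0 ∧ f ∈ trigPoly G := by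
  induction m using Nat.strong_induction_on with
  | _ m ih =>
    intro W hfin hm hW hinv
    by_cases hmin : ∀ S ≤ W, (∀ a, ∀ f ∈ S, rightTranslate a f ∈ S) → S = ⊥ ∨ S = W
    · exact exists_mem_trigPoly_of_minimal μ W hW hinv hmin
    · push Not at hmin
      obtain ⟨S, hSW, hSinv, hS0, hSne⟩ := hmin
      have hSfin : FiniteDimensional ℂ S := Submodule.finiteDimensional_of_le hSW
      have hlt : Module.finrank ℂ S < m := by
        rw [← hm]
        exact Submodule.finrank_lt_finrank_of_lt (lt_of_le_of_ne hSW hSne)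
      obtain ⟨f, hf, hf'⟩ := ih _ hlt S hSfin rfl hS0 hSinv
      exact ⟨f, hSW hf, hf'⟩

theorem mem_orthogonal_trigPoly_iff (v : Lp ℂ 2 μ) :
    v ∈ ((trigPoly G).map (toL2 μ).toLinearMap)ᗮ ↔
      ∀ f ∈ trigPoly G, inner ℂ (toL2 μ f) v = 0 := by
  rw [Submodule.mem_orthogonal]
  exact ⟨fun h f hf => h _ (Submodule.mem_map_of_mem hf),
    by rintro h _ ⟨f, hf, rfl⟩; exact h f hf⟩

/-- The continuous eigenfunctions of a convolution operator which are orthogonal to the matrix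
coefficients. -/
def convEigenspace (p : C(G, ℂ)) (l : ℂ) : Submodule ℂ C(G, ℂ) where
  carrier := {f | (∀ t ∈ trigPoly G, inner ℂ (toL2 μ t) (toL2 μ f) = 0) ∧ conv μ p f = l • f}
  add_mem' := by
    rintro f g ⟨hf, hf'⟩ ⟨hg, hg'⟩
    refine ⟨fun t ht => ?_, ?_⟩
    · rw [map_add, inner_add_right, hf t ht, hg t ht, add_zero]
    · rw [conv, map_add, map_add, smul_add, ← hf', ← hg', conv, conv]
  zero_mem' := ⟨fun t _ => by rw [map_zero, inner_zero_right],
    by rw [conv, map_zero, map_zero, smul_zero]⟩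
  smul_mem' := by
    rintro c f ⟨hf, hf'⟩
    refine ⟨fun t ht => ?_, ?_⟩
    · rw [map_smul, inner_smul_right, hf t ht, mul_zero]
    · rw [conv, map_smul, map_smul, smul_comm, ← hf', conv]

/-- The space embeds in an eigenspace of a compact operator on `L²` with non-zero eigenvalue. -/
theorem finiteDimensional_convEigenspace (p : C(G, ℂ)) {l : ℂ} (hl : l ≠ 0) :
    FiniteDimensional ℂ (convEigenspace μ p l) := by
  have hfd := ContinuousLinearMap.finite_dimensional_eigenspace
    (isCompactOperator_convOp μ p) l hl
  let J : convEigenspace μ p l →ₗ[ℂ] Module.End.eigenspace (convOp μ p).toLinearMap l :=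
    ((toL2 μ).toLinearMap.comp (convEigenspace μ p l).subtype).codRestrict _ fun f => by
      rw [Module.End.mem_eigenspace_iff]
      have := congrArg (toL2 μ) f.2.2
      rw [map_smul] at this
      exact this
  refine Module.Finite.of_injective J fun f g hfg => ?_
  exact Subtype.ext (toL2_injective μ (congrArg Subtype.val hfg))

theorem rightTranslate_mem_convEigenspace (p : C(G, ℂ)) (l : ℂ) (a : G) {f : C(G, ℂ)}
    (hf : f ∈ convEigenspace μ p l) : rightTranslate a f ∈ convEigenspace μ p l := by
  refine ⟨fun t ht => ?_, ?_⟩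
  · have := hf.1 _ (rightTranslate_mem_trigPoly ht a⁻¹)
    rw [← inner_rightTranslate μ _ _ a] at this
    have e : rightTranslate a (rightTranslate a⁻¹ t) = t := by ext x; simp
    rwa [e] at this
  · rw [conv_rightTranslate, hf.2, map_smul]

/-- Otherwise this finite-dimensional invariant space would contain a non-zero trigonometric
polynomial, which is orthogonal to all trigonometric polynomials and so to itself. -/
theorem convEigenspace_eq_bot (p : C(G, ℂ)) {l : ℂ} (hl : l ≠ 0) : convEigenspace μ p l = ⊥ := by
  by_contra hW
  obtain ⟨f, hfW, hf0, hft⟩ := exists_mem_trigPoly_of_finrank μ _ (convEigenspace μ p l)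
    (finiteDimensional_convEigenspace μ p hl) rfl hW
    fun a f hf => rightTranslate_mem_convEigenspace μ p l a hf
  have := hfW.1 f hft
  rw [inner_self_eq_zero] at this
  exact hf0 (toL2_injective μ (by rw [this, map_zero]))

/-- An `L²` eigenvector with `l ≠ 0` has a continuous representative, namely `l⁻¹ • convL2 μ p v`,
which lies in `convEigenspace`. -/
theorem eq_zero_of_convOp_eq_smul (p : C(G, ℂ)) {l : ℂ} (hl : l ≠ 0) {v : Lp ℂ 2 μ}
    (hv : v ∈ ((trigPoly G).map (toL2 μ).toLinearMap)ᗮ) (hTv : convOp μ p v = l • v) : v = 0 := by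
  let f₀ : C(G, ℂ) := l⁻¹ • convL2 μ p v
  have hf₀ : toL2 μ f₀ = v := by
    have h1 : toL2 μ (convL2 μ p v) = l • v := hTv
    rw [map_smul, h1, smul_smul, inv_mul_cancel₀ hl, one_smul]
  have hf₀W : f₀ ∈ convEigenspace μ p l := by
    refine ⟨fun t ht => ?_, ?_⟩
    · rw [hf₀]
      exact (mem_orthogonal_trigPoly_iff μ v).1 hv t ht
    · rw [conv, hf₀, smul_smul, mul_inv_cancel₀ hl, one_smul]
  rw [convEigenspace_eq_bot μ p hl, Submodule.mem_bot] at hf₀W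
  rw [← hf₀, hf₀W, map_zero]

theorem convOp_eq_zero_of_mem_orthogonal [T2Space G] (p : C(G, ℂ)) (hp : ∀ x, p x⁻¹ = star (p x))
    {q : Lp ℂ 2 μ} (hq : q ∈ ((trigPoly G).map (toL2 μ).toLinearMap)ᗮ) : convOp μ p q = 0 := by
  have hsymm := isSymmetric_convOp μ p hp
  have hTQ : ∀ v ∈ ((trigPoly G).map (toL2 μ).toLinearMap)ᗮ,
      (convOp μ p : Lp ℂ 2 μ →ₗ[ℂ] Lp ℂ 2 μ) v ∈ ((trigPoly G).map (toL2 μ).toLinearMap)ᗮ := by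
    intro v hv
    rw [mem_orthogonal_trigPoly_iff] at hv ⊢
    intro f hf
    refine (hsymm (toL2 μ f) v).symm.trans ?_
    exact hv _ (conv_mem_trigPoly μ p hf)
  exact eq_zero_of_no_eigenvector (isCompactOperator_convOp μ p) hsymm
    (Submodule.isClosed_orthogonal _) hTQ
    (fun l hl v hv hTv => eq_zero_of_convOp_eq_smul μ p hl hv hTv) hq

end PeterWeyl

/-! ### Completeness of the matrix coefficients in `L²`, and smooth convolutions -/

section LieGroup

variable (E : Type*) [NormedAddCommGroup E] [NormedSpace ℝ E] [FiniteDimensional ℝ E]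
  {G : Type*} [TopologicalSpace G] [T2Space G] [CompactSpace G]
  [ChartedSpace E G] [Group G] [LieGroup 𝓘(ℝ, E) ∞ G] [IsTopologicalGroup G]
  [MeasurableSpace G] [BorelSpace G] (μ : Measure G) [μ.IsHaarMeasure] [IsProbabilityMeasure μ]

/-- **Peter–Weyl**: the matrix coefficients span a dense subspace of `L²`. -/
theorem orthogonal_trigPoly_eq_bot (E : Type*) [NormedAddCommGroup E] [NormedSpace ℝ E]
    [FiniteDimensional ℝ E] [ChartedSpace E G] [LieGroup 𝓘(ℝ, E) ∞ G] :
    ((trigPoly G).map (toL2 μ).toLinearMap)ᗮ = ⊥ := by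
  obtain ⟨ψ, -, hψs, hψ⟩ := exists_smooth_approximate_identity E μ
  refine (Submodule.eq_bot_iff _).2 fun q hq => ?_
  -- Each `ψ k` annihilates `q` under convolution. By symmetry `q` is orthogonal to every `ψ k * f`,
  -- and these converge to `f` for continuous `f`.
  have h : ∀ f : Lp ℂ 2 μ, inner ℂ q f = 0 := fun f => by
    refine (denseRange_toL2 μ).induction_on f (isClosed_eq (by fun_prop) (by fun_prop)) fun f => ?_
    have h1 : Tendsto (fun k => inner ℂ q (toL2 μ (conv μ (ψ k) f))) atTop
        (𝓝 (inner ℂ q (toL2 μ f))) :=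
      tendsto_const_nhds.inner (((toL2 μ).continuous.tendsto _).comp (hψ f))
    refine tendsto_nhds_unique h1 (tendsto_const_nhds.congr fun k => ?_)
    rw [← convOp_toL2]
    refine Eq.trans ?_ (isSymmetric_convOp μ (ψ k) (hψs k) q (toL2 μ f))
    change 0 = inner ℂ (convOp μ (ψ k) q) _
    rw [convOp_eq_zero_of_mem_orthogonal μ (ψ k) (hψs k) hq, inner_zero_left]
  exact inner_self_eq_zero.1 (h q)

theorem contMDiff_conv {p : C(G, ℂ)} (hp : ContMDiff 𝓘(ℝ, E) 𝓘(ℝ, ℂ) ∞ p) (f : C(G, ℂ)) :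
    ContMDiff 𝓘(ℝ, E) 𝓘(ℝ, ℂ) ∞ (conv μ p f) := by
  have h : (conv μ p f : G → ℂ) = fun x => ∫ y, f y * p (x * y⁻¹) ∂μ := by
    funext x
    rw [conv_apply]
    simp only [mul_comm]
  rw [h]
  refine contMDiff_integral (E := E) (E' := E) μ (Ψ := fun z : G × G => p (z.1 * z.2⁻¹)) ?_ f
  exact hp.comp (contMDiff_fst.mul (contMDiff_snd.inv))

end LieGroup

/-! ### Smoothness of matrix coefficients -/

section Smoothness

variable (E : Type*) [NormedAddCommGroup E] [NormedSpace ℝ E] [FiniteDimensional ℝ E]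
  {G : Type*} [TopologicalSpace G] [T2Space G] [CompactSpace G]
  [ChartedSpace E G] [Group G] [LieGroup 𝓘(ℝ, E) ∞ G] [IsTopologicalGroup G]

/-- Matrix coefficients are smooth. -/
theorem UnitaryIrrep.contMDiff_mat_apply (ξ : UnitaryIrrep G) (i j : Fin ξ.dim) :
    ContMDiff 𝓘(ℝ, E) 𝓘(ℝ, ℂ) ∞ (fun x => ξ.mat x i j) := by
  let _ : MeasurableSpace G := borel G
  have : BorelSpace G := ⟨rfl⟩
  let μ : Measure G := Measure.haarMeasure ⊤
  have : IsProbabilityMeasure μ := ⟨Measure.haarMeasure_self (K₀ := ⊤)⟩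
  obtain ⟨ψ, hψ, -, hlim⟩ := exists_smooth_approximate_identity E μ
  -- Entrywise `ψ k * ξ = M k · ξ`, and `M k` tends to the identity. For some `k` it is invertible,
  -- and `ξ = (M k)⁻¹ (ψ k * ξ)` is smooth since `ψ k` is.
  let M : ℕ → Matrix (Fin ξ.dim) (Fin ξ.dim) ℂ := fun k => Matrix.of fun i j =>
    conv μ (ψ k) (ξ.coeff i j) 1
  have hM : Tendsto M atTop (𝓝 1) := by
    refine tendsto_pi_nhds.2 fun i => tendsto_pi_nhds.2 fun j => ?_
    have h1 := ((continuous_eval_const (F := C(G, ℂ)) (1 : G)).tendsto _).comp (hlim (ξ.coeff i j))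
    rw [← ξ.mat_one]
    exact h1
  have hdet : ∀ᶠ k in atTop, (M k).det ≠ 0 := by
    have h1 : Tendsto (fun k => (M k).det) atTop (𝓝 1) := by
      have := ((continuous_id (X := Matrix (Fin ξ.dim) (Fin ξ.dim) ℂ)).matrix_det.tendsto 1).comp hM
      simpa [Function.comp_def] using this
    exact h1.eventually_ne one_ne_zero
  obtain ⟨k, hk⟩ := hdet.exists
  have hsm : ∀ i j, ContMDiff 𝓘(ℝ, E) 𝓘(ℝ, ℂ) ∞ (conv μ (ψ k) (ξ.coeff i j)) := fun i j =>
    contMDiff_conv E μ (hψ k) _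
  have heq : ∀ x, ξ.mat x =
      (M k)⁻¹ * Matrix.of fun i j => conv μ (ψ k) (ξ.coeff i j) x := fun x => by
    have h1 : (Matrix.of fun i j => conv μ (ψ k) (ξ.coeff i j) x) = M k * ξ.mat x := by
      ext i j
      rw [Matrix.of_apply, conv_coeff]
      simp [Matrix.mul_apply, M]
    rw [h1, ← mul_assoc, Matrix.nonsing_inv_mul _ (Ne.isUnit hk), one_mul]
  have h2 : (fun x => ξ.mat x i j)
      = ∑ l, (M k)⁻¹ i l • (conv μ (ψ k) (ξ.coeff l j) : G → ℂ) := by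
    funext x
    rw [heq x, Matrix.mul_apply, Finset.sum_apply]
    rfl
  rw [h2]
  exact (smoothSubmodule E G).sum_mem fun l _ => (smoothSubmodule E G).smul_mem _ (hsm l j)

end Smoothness

/-! ### Left-invariant vector fields, conjugation and convolution on smooth functions -/

section Fields

variable {E : Type*} [NormedAddCommGroup E] [NormedSpace ℝ E]
  {G : Type*} [TopologicalSpace G] [ChartedSpace E G]

theorem SmoothFn.ext {f g : SmoothFn E G} (h : ∀ x, f x = g x) : f = g :=
  Subtype.ext (funext h)

@[simp]
theorem SmoothFn.add_apply (f g : SmoothFn E G) (x : G) : (f + g) x = f x + g x := rfl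

@[simp]
theorem SmoothFn.neg_apply (f : SmoothFn E G) (x : G) : (-f) x = -f x := rfl

@[simp]
theorem SmoothFn.smul_apply (c : ℂ) (f : SmoothFn E G) (x : G) : (c • f) x = c * f x := rfl

@[simp]
theorem SmoothFn.zero_apply (x : G) : (0 : SmoothFn E G) x = 0 := rfl

@[simp]
theorem SmoothFn.one_apply (x : G) : SmoothFn.one E G x = 1 := rfl

/-- Evaluation of smooth functions at a point. -/
def SmoothFn.evalₗ (x : G) : SmoothFn E G →ₗ[ℂ] ℂ where
  toFun f := f x
  map_add' _ _ := rfl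
  map_smul' _ _ := rfl

@[simp]
theorem SmoothFn.sum_apply {ι : Type*} (s : Finset ι) (f : ι → SmoothFn E G) (x : G) :
    (∑ i ∈ s, f i) x = ∑ i ∈ s, f i x :=
  map_sum (SmoothFn.evalₗ x) f s

theorem SmoothFn.ofFun_apply {f : G → ℂ} (hf : ContMDiff 𝓘(ℝ, E) 𝓘(ℝ, ℂ) ∞ f) (x : G) :
    SmoothFn.ofFun E f x = f x := by
  have h : SmoothFn.ofFun E f = ⟨f, hf⟩ := dif_pos hf
  rw [h]

@[simp]
theorem SmoothFn.toContinuousMap_apply (f : SmoothFn E G) (x : G) : f.toContinuousMap x = f x := rfl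

/-- Complex conjugation of smooth functions. -/
def SmoothFn.conj (f : SmoothFn E G) : SmoothFn E G :=
  ⟨fun x => star (f x), (Complex.conjCLE.contDiff.contMDiff (n := ∞)).comp f.contMDiff⟩

@[simp]
theorem SmoothFn.conj_apply (f : SmoothFn E G) (x : G) : f.conj x = star (f x) := rfl

theorem SmoothFn.conj_conj (f : SmoothFn E G) : f.conj.conj = f := SmoothFn.ext fun x => by simp

variable [Group G] [LieGroup 𝓘(ℝ, E) ∞ G]

theorem leftInvField_apply (v : GroupLieAlgebra 𝓘(ℝ, E) G) (f : SmoothFn E G) (x : G) :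
    leftInvField v f x = dirDeriv (E := E) (f : G → ℂ) x (mulInvariantVectorField v x) := rfl

theorem leftInvField_conj (v : GroupLieAlgebra 𝓘(ℝ, E) G) (f : SmoothFn E G) :
    leftInvField v f.conj = (leftInvField v f).conj := by
  refine SmoothFn.ext fun x => ?_
  have h := (Complex.conjCLE.toContinuousLinearMap.hasMFDerivAt (x := f x)).comp x
    (f.mdifferentiableAt x).hasMFDerivAt
  exact congrArg (fun L => L (mulInvariantVectorField v x)) h.mfderiv

theorem mfderiv_mul_left_mulInvariantVectorField (a x : G) (v : GroupLieAlgebra 𝓘(ℝ, E) G) :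
    mfderiv 𝓘(ℝ, E) 𝓘(ℝ, E) (fun y => a * y) x (mulInvariantVectorField v x) =
      mulInvariantVectorField v (a * x) := by
  have h1 : MDifferentiableAt 𝓘(ℝ, E) 𝓘(ℝ, E) (fun y : G => a * y) (x * 1) :=
    (contMDiff_mul_left (n := ∞)).mdifferentiableAt (by simp)
  have h2 : MDifferentiableAt 𝓘(ℝ, E) 𝓘(ℝ, E) (fun y : G => x * y) 1 :=
    (contMDiff_mul_left (n := ∞)).mdifferentiableAt (by simp)
  have h3 := mfderiv_comp (1 : G) h1 h2
  have h4 : (fun y => a * y) ∘ (fun y => x * y) = fun y => a * x * y := by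
    funext y; simp [mul_assoc]
  rw [h4] at h3
  have h5 := congrArg (fun L => L v) h3
  -- The chain rule produces the base point `x * 1`, whose tangent space is not syntactically the
  -- one at `x`; viewing all derivatives as maps of `E` permits the substitution.
  have e : ∀ z, z = x → (mfderiv 𝓘(ℝ, E) 𝓘(ℝ, E) (fun y => a * y) z : E →L[ℝ] E) =
      (mfderiv 𝓘(ℝ, E) 𝓘(ℝ, E) (fun y => a * y) x : E →L[ℝ] E) := by
    rintro _ rfl
    rfl
  exact Eq.trans (congrArg (fun L : E →L[ℝ] E => L (mulInvariantVectorField v x))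
    (e _ (mul_one x)).symm) h5.symm

theorem isLeftInvariant_leftInvField (v : GroupLieAlgebra 𝓘(ℝ, E) G) :
    IsLeftInvariant (leftInvField v : SmoothFn E G →ₗ[ℂ] SmoothFn E G) := by
  intro a f
  refine SmoothFn.ext fun x => ?_
  have h1 : MDifferentiableAt 𝓘(ℝ, E) 𝓘(ℝ, E) (fun y : G => a * y) x :=
    (contMDiff_mul_left (n := ∞)).mdifferentiableAt (by simp)
  have h := (f.mdifferentiableAt (a * x)).hasMFDerivAt.comp x h1.hasMFDerivAt
  refine (congrArg (fun L => L (mulInvariantVectorField v x)) h.mfderiv).trans ?_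
  exact congrArg (mfderiv 𝓘(ℝ, E) 𝓘(ℝ, ℂ) (f : G → ℂ) (a * x))
    (mfderiv_mul_left_mulInvariantVectorField a x v)

theorem iteratedField_cons (v : GroupLieAlgebra 𝓘(ℝ, E) G)
    (w : List (GroupLieAlgebra 𝓘(ℝ, E) G)) (f : SmoothFn E G) :
    iteratedField (v :: w) f = leftInvField v (iteratedField w f) := rfl

theorem iteratedField_conj (w : List (GroupLieAlgebra 𝓘(ℝ, E) G)) (f : SmoothFn E G) :
    iteratedField w f.conj = (iteratedField w f).conj := by
  induction w with
  | nil => rfl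
  | cons v w ih => rw [iteratedField_cons, ih, leftInvField_conj, ← iteratedField_cons]

theorem SmoothFn.continuous_conj [CompactSpace G] :
    Continuous (SmoothFn.conj : SmoothFn E G → SmoothFn E G) := by
  refine continuous_iInf_rng.2 fun w => continuous_induced_rng.2 ?_
  have h : (fun f => (iteratedField w f).toContinuousMap) ∘ SmoothFn.conj
      = fun f : SmoothFn E G => star (iteratedField w f).toContinuousMap := by
    funext f
    ext x
    simp [iteratedField_conj]
  rw [h]
  exact continuous_star.comp (continuous_iInf_dom (i := w) continuous_induced_dom)

theorem SmoothFn.tendsto_nhds {ι : Type*} {l : Filter ι} {F : ι → SmoothFn E G} {f : SmoothFn E G}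
    (h : ∀ w : List (GroupLieAlgebra 𝓘(ℝ, E) G),
      Tendsto (fun k => (iteratedField w (F k)).toContinuousMap) l
        (𝓝 (iteratedField w f).toContinuousMap)) : Tendsto F l (𝓝 f) := by
  rw [nhds_iInf]
  refine tendsto_iInf.2 fun w => ?_
  rw [nhds_induced]
  exact tendsto_comap_iff.2 (h w)

end Fields

section SmoothConvolution

variable {E : Type*} [NormedAddCommGroup E] [NormedSpace ℝ E] [FiniteDimensional ℝ E]
  {G : Type*} [TopologicalSpace G] [T2Space G] [CompactSpace G]
  [ChartedSpace E G] [Group G] [LieGroup 𝓘(ℝ, E) ∞ G] [IsTopologicalGroup G]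
  [MeasurableSpace G] [BorelSpace G] (μ : Measure G) [μ.IsHaarMeasure] [IsProbabilityMeasure μ]

theorem contMDiff_inv_mul (f : SmoothFn E G) :
    ContMDiff (𝓘(ℝ, E).prod 𝓘(ℝ, E)) 𝓘(ℝ, ℂ) ∞ (fun z : G × G => f (z.2⁻¹ * z.1)) :=
  f.contMDiff.comp ((contMDiff_snd.inv).mul contMDiff_fst)

/-- The convolution of a continuous and a smooth function. -/
def smoothConv (p : C(G, ℂ)) (f : SmoothFn E G) : SmoothFn E G :=
  ⟨fun x => ∫ y, p y * f (y⁻¹ * x) ∂μ, contMDiff_integral μ (contMDiff_inv_mul f) p⟩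

theorem toContinuousMap_smoothConv (p : C(G, ℂ)) (f : SmoothFn E G) :
    (smoothConv μ p f).toContinuousMap = conv μ p f.toContinuousMap := by
  ext x
  rw [conv_apply']
  rfl

/-- `p * f` is an average of left translates of `f`, with which left-invariant fields commute. Hence
convolution on the left respects the whole topology of `C^∞(G)`. -/
theorem leftInvField_smoothConv (p : C(G, ℂ)) (f : SmoothFn E G)
    (v : GroupLieAlgebra 𝓘(ℝ, E) G) :
    leftInvField v (smoothConv μ p f) = smoothConv μ p (leftInvField v f) := by
  refine SmoothFn.ext fun x => ?_
  refine (dirDeriv_integral μ (contMDiff_inv_mul f) p x (mulInvariantVectorField v x)).trans ?_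
  refine integral_congr_ae (ae_of_all _ fun y => ?_)
  have := congrArg (fun h : SmoothFn E G => h x) (isLeftInvariant_leftInvField v y⁻¹ f)
  exact congrArg (p y * ·) this

theorem iteratedField_smoothConv (p : C(G, ℂ)) (f : SmoothFn E G)
    (w : List (GroupLieAlgebra 𝓘(ℝ, E) G)) :
    iteratedField w (smoothConv μ p f) = smoothConv μ p (iteratedField w f) := by
  induction w with
  | nil => rfl
  | cons v w ih => rw [iteratedField_cons, ih, leftInvField_smoothConv, ← iteratedField_cons]

/-- By Peter–Weyl the mollifier `ψ k` is within `1 / (k + 1)` in `L²` of some trigonometric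
polynomial `p k`, and `norm_conv_le` turns this into a uniform error for `p k * h`. -/
theorem exists_trigPoly_approximate_identity (E : Type*) [NormedAddCommGroup E] [NormedSpace ℝ E]
    [FiniteDimensional ℝ E] [ChartedSpace E G] [LieGroup 𝓘(ℝ, E) ∞ G] :
    ∃ p : ℕ → C(G, ℂ), (∀ k, p k ∈ trigPoly G) ∧
      ∀ h : C(G, ℂ), Tendsto (fun k => conv μ (p k) h) atTop (𝓝 h) := by
  obtain ⟨ψ, -, -, hψ⟩ := exists_smooth_approximate_identity E μ
  have hdense : Dense (((trigPoly G).map (toL2 μ).toLinearMap : Submodule ℂ (Lp ℂ 2 μ)) :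
      Set (Lp ℂ 2 μ)) :=
    Submodule.dense_iff_topologicalClosure_eq_top.2
      ((Submodule.topologicalClosure_eq_top_iff).2 (orthogonal_trigPoly_eq_bot μ E))
  have hex : ∀ k : ℕ, ∃ p ∈ trigPoly G, ‖toL2 μ (p - ψ k)‖ < 1 / ((k : ℝ) + 1) := fun k => by
    obtain ⟨_, ⟨p, hp, rfl⟩, hd⟩ := hdense.exists_dist_lt (toL2 μ (ψ k))
      (ε := 1 / ((k : ℝ) + 1)) (by positivity)
    refine ⟨p, hp, ?_⟩
    rw [map_sub, ← dist_eq_norm, dist_comm]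
    exact hd
  choose p hp hpψ using hex
  refine ⟨p, hp, fun h => ?_⟩
  have h1 : Tendsto (fun k => conv μ (p k - ψ k) h) atTop (𝓝 0) := by
    refine squeeze_zero_norm (a := fun k : ℕ => 1 / ((k : ℝ) + 1) * ‖h‖) (fun k => ?_) ?_
    · exact (norm_conv_le μ _ _).trans
        (mul_le_mul_of_nonneg_right (hpψ k).le (norm_nonneg _))
    · simpa using tendsto_one_div_add_atTop_nhds_zero_nat.mul_const ‖h‖
  have h2 := h1.add (hψ h)
  simpa [conv_sub_left] using h2

end SmoothConvolution

/-! ### Density of matrix coefficients in `C^∞(G)` and uniqueness of Fourier coefficients -/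

section Density

variable {E : Type*} [NormedAddCommGroup E] [NormedSpace ℝ E] [FiniteDimensional ℝ E]
  {G : Type*} [TopologicalSpace G] [T2Space G] [CompactSpace G]
  [ChartedSpace E G] [Group G] [LieGroup 𝓘(ℝ, E) ∞ G] [IsTopologicalGroup G]

variable (E) in
/-- The matrix coefficient `ξ_{ij}` as a smooth function. -/
def UnitaryIrrep.smoothCoeff (ξ : UnitaryIrrep G) (i j : Fin ξ.dim) : SmoothFn E G :=
  ⟨fun x => ξ.mat x i j, ξ.contMDiff_mat_apply E i j⟩

@[simp]
theorem UnitaryIrrep.smoothCoeff_apply (ξ : UnitaryIrrep G) (i j : Fin ξ.dim) (x : G) :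
    ξ.smoothCoeff E i j x = ξ.mat x i j := rfl

theorem ofFun_mat (ξ : UnitaryIrrep G) (i j : Fin ξ.dim) :
    SmoothFn.ofFun E (fun x => ξ.mat x i j) = ξ.smoothCoeff E i j :=
  SmoothFn.ext fun x => SmoothFn.ofFun_apply (ξ.contMDiff_mat_apply E i j) x

theorem ofFun_conjTranspose (ξ : UnitaryIrrep G) (i j : Fin ξ.dim) :
    SmoothFn.ofFun E (fun x => (ξ.mat x)ᴴ i j) = (ξ.smoothCoeff E j i).conj :=
  SmoothFn.ext fun x => SmoothFn.ofFun_apply (ξ.smoothCoeff E j i).conj.contMDiff x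

variable (E G) in
/-- The span of the matrix coefficients in `C^∞(G)`. -/
def smoothTrigPoly : Submodule ℂ (SmoothFn E G) :=
  Submodule.span ℂ {f | ∃ (ξ : UnitaryIrrep G) (i j : Fin ξ.dim), f = ξ.smoothCoeff E i j}

theorem mem_smoothTrigPoly {f : SmoothFn E G} (hf : f.toContinuousMap ∈ trigPoly G) :
    f ∈ smoothTrigPoly E G := by
  suffices h : ∀ g ∈ trigPoly G, ∃ f ∈ smoothTrigPoly E G, f.toContinuousMap = g by
    obtain ⟨f', hf', he⟩ := h _ hf
    have : f' = f := SmoothFn.ext fun x => DFunLike.congr_fun he x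
    exact this ▸ hf'
  intro g hg
  induction hg using Submodule.span_induction with
  | mem g hg =>
    obtain ⟨ξ, i, j, rfl⟩ := hg
    exact ⟨ξ.smoothCoeff E i j, Submodule.subset_span ⟨ξ, i, j, rfl⟩, rfl⟩
  | zero => exact ⟨0, zero_mem _, rfl⟩
  | add g h _ _ hg hh =>
    obtain ⟨f, hf, rfl⟩ := hg
    obtain ⟨f', hf', rfl⟩ := hh
    exact ⟨f + f', add_mem hf hf', rfl⟩
  | smul c g _ hg =>
    obtain ⟨f, hf, rfl⟩ := hg
    exact ⟨c • f, Submodule.smul_mem _ c hf, rfl⟩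

variable (E G) in
/-- The matrix coefficients span a dense subspace of `C^∞(G)`. -/
theorem dense_smoothTrigPoly : Dense (smoothTrigPoly E G : Set (SmoothFn E G)) := by
  let _ : MeasurableSpace G := borel G
  have : BorelSpace G := ⟨rfl⟩
  let μ : Measure G := Measure.haarMeasure ⊤
  have : IsProbabilityMeasure μ := ⟨Measure.haarMeasure_self (K₀ := ⊤)⟩
  obtain ⟨p, hp, hlim⟩ := exists_trigPoly_approximate_identity μ E
  intro f
  refine mem_closure_of_tendsto (f := fun k => smoothConv μ (p k) f) (b := atTop)
    (SmoothFn.tendsto_nhds fun w => ?_) (Eventually.of_forall fun k => ?_)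
  · simp only [iteratedField_smoothConv, toContinuousMap_smoothConv]
    exact hlim _
  · refine mem_smoothTrigPoly ?_
    rw [toContinuousMap_smoothConv]
    exact conv_mem_trigPoly_left μ (hp k) _

theorem continuousLinearMap_ext_smoothCoeff {F : Type*} [AddCommGroup F] [Module ℂ F]
    [TopologicalSpace F] [T2Space F] {A B : SmoothFn E G →ₗ[ℂ] F} (hA : Continuous A)
    (hB : Continuous B)
    (h : ∀ (ξ : UnitaryIrrep G) (i j : Fin ξ.dim),
      A (ξ.smoothCoeff E i j) = B (ξ.smoothCoeff E i j)) :
    A = B := by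
  have h1 : smoothTrigPoly E G ≤ LinearMap.eqLocus A B := by
    refine Submodule.span_le.2 ?_
    rintro _ ⟨ξ, i, j, rfl⟩
    exact h ξ i j
  exact LinearMap.ext fun f =>
    congrFun (Continuous.ext_on (dense_smoothTrigPoly E G) hA hB fun f hf => h1 hf) f

/-- A distribution is determined by its values on the conjugates of the matrix coefficients. -/
theorem distrib_eq_zero {u : Distrib E G}
    (h : ∀ (ξ : UnitaryIrrep G) (i j : Fin ξ.dim), u (ξ.smoothCoeff E i j).conj = 0) : u = 0 := by
  -- The two conjugations keep `A` linear and turn conjugated coefficients into coefficients, so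
  -- that density applies.
  let A : SmoothFn E G →ₗ[ℂ] ℂ :=
    { toFun := fun f => star (u f.conj)
      map_add' := fun f g => by
        have : (f + g).conj = f.conj + g.conj := SmoothFn.ext fun x => by simp
        rw [this, map_add, star_add]
      map_smul' := fun c f => by
        have : (c • f).conj = star c • f.conj := SmoothFn.ext fun x => by simp
        rw [this, map_smul, smul_eq_mul, star_mul', star_star, RingHom.id_apply, smul_eq_mul] }
  have hA : Continuous A := continuous_star.comp (u.continuous.comp SmoothFn.continuous_conj)
  have hA0 : A = 0 := continuousLinearMap_ext_smoothCoeff hA continuous_const fun ξ i j => by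
    change star (u (ξ.smoothCoeff E i j).conj) = 0
    rw [h, star_zero]
  ext f
  have := DFunLike.congr_fun hA0 f.conj
  change star (u f.conj.conj) = 0 at this
  rw [SmoothFn.conj_conj, star_eq_zero] at this
  exact this

end Density

/-! ### Symbols of left-invariant operators -/

section Symbols

variable {E : Type*} [NormedAddCommGroup E] [NormedSpace ℝ E] [FiniteDimensional ℝ E]
  {G : Type*} [TopologicalSpace G] [T2Space G] [CompactSpace G]
  [ChartedSpace E G] [Group G] [LieGroup 𝓘(ℝ, E) ∞ G] [IsTopologicalGroup G]

theorem symbol_apply (P : SmoothFn E G →ₗ[ℂ] SmoothFn E G) (ξ : UnitaryIrrep G)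
    (i j : Fin ξ.dim) : symbol P ξ i j = P (ξ.smoothCoeff E i j) 1 := by
  rw [symbol, symbolAt, ξ.mat_one, Matrix.conjTranspose_one, Matrix.one_mul, Matrix.of_apply,
    ofFun_mat]

/-- This is `Pξ = ξ σ_P(ξ)`: by left invariance the value at `x` is that at `1` of `P` applied to
`ξ(x ·) = ξ(x) ξ(·)`. -/
theorem IsLeftInvariant.apply_smoothCoeff {P : SmoothFn E G →ₗ[ℂ] SmoothFn E G}
    (hP : IsLeftInvariant P) (ξ : UnitaryIrrep G) (i j : Fin ξ.dim) :
    P (ξ.smoothCoeff E i j) = ∑ k, symbol P ξ k j • ξ.smoothCoeff E i k := by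
  refine SmoothFn.ext fun x => ?_
  have h1 : leftTranslate x (ξ.smoothCoeff E i j) = ∑ k, ξ.mat x i k • ξ.smoothCoeff E k j := by
    refine SmoothFn.ext fun y => ?_
    rw [SmoothFn.sum_apply]
    exact ξ.mat_mul_apply x y i j
  have h2 : P (ξ.smoothCoeff E i j) x = P (leftTranslate x (ξ.smoothCoeff E i j)) 1 := by
    rw [hP]
    change _ = P (ξ.smoothCoeff E i j) (x * 1)
    rw [mul_one]
  rw [h2, h1, map_sum, SmoothFn.sum_apply, SmoothFn.sum_apply]
  refine Finset.sum_congr rfl fun k _ => ?_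
  rw [map_smul, SmoothFn.smul_apply, SmoothFn.smul_apply, symbol_apply, mul_comm]
  rfl

theorem symbol_comp {P Q : SmoothFn E G →ₗ[ℂ] SmoothFn E G} (hQ : IsLeftInvariant Q)
    (ξ : UnitaryIrrep G) : symbol (P ∘ₗ Q) ξ = symbol P ξ * symbol Q ξ := by
  ext i j
  rw [symbol_apply, LinearMap.comp_apply, hQ.apply_smoothCoeff, map_sum, SmoothFn.sum_apply,
    Matrix.mul_apply]
  refine Finset.sum_congr rfl fun k _ => ?_
  rw [map_smul, SmoothFn.smul_apply, symbol_apply P, mul_comm]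

theorem symbol_equiv (P : SmoothFn E G →ₗ[ℂ] SmoothFn E G) {ξ η : UnitaryIrrep G}
    {T : Matrix (Fin η.dim) (Fin ξ.dim) ℂ} (hT : T * Tᴴ = 1)
    (h : ∀ x, T * ξ.mat x = η.mat x * T) : symbol P η = T * symbol P ξ * Tᴴ := by
  ext i j
  have h1 : η.smoothCoeff E i j = ∑ l, ∑ k, (T i k * star (T j l)) • ξ.smoothCoeff E k l := by
    refine SmoothFn.ext fun x => ?_
    have h2 : η.mat x = T * ξ.mat x * Tᴴ := by rw [h, Matrix.mul_assoc, hT, Matrix.mul_one]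
    rw [UnitaryIrrep.smoothCoeff_apply, h2]
    simp only [Matrix.mul_apply, Matrix.conjTranspose_apply, SmoothFn.sum_apply,
      SmoothFn.smul_apply, UnitaryIrrep.smoothCoeff_apply, Finset.sum_mul]
    refine Finset.sum_congr rfl fun l _ => Finset.sum_congr rfl fun k _ => ?_
    ring
  rw [symbol_apply, h1]
  simp only [map_sum, map_smul, Matrix.mul_apply, Matrix.conjTranspose_apply, SmoothFn.sum_apply,
    SmoothFn.smul_apply, symbol_apply, Finset.sum_mul]
  refine Finset.sum_congr rfl fun l _ => Finset.sum_congr rfl fun k _ => ?_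
  ring

theorem leftInvField_apply_one (v : GroupLieAlgebra 𝓘(ℝ, E) G) (f : SmoothFn E G) :
    leftInvField v f 1 = dirDeriv (E := E) (f : G → ℂ) 1 v := by
  rw [leftInvField_apply]
  congr 1
  have : (fun y : G => (1 : G) * y) = id := by funext y; simp
  simp only [mulInvariantVectorField]
  rw [this, mfderiv_id]
  rfl

/-- The symbol of a left-invariant vector field, as a linear map on the Lie algebra. -/
def fieldSymbol (ξ : UnitaryIrrep G) :
    GroupLieAlgebra 𝓘(ℝ, E) G →ₗ[ℝ] Matrix (Fin ξ.dim) (Fin ξ.dim) ℂ where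
  toFun v := symbol (leftInvField v : SmoothFn E G →ₗ[ℂ] SmoothFn E G) ξ
  map_add' v w := by
    ext i j
    rw [Matrix.add_apply]
    simp only [symbol_apply, leftInvField_apply_one]
    exact map_add (mfderiv 𝓘(ℝ, E) 𝓘(ℝ, ℂ) (ξ.smoothCoeff E i j : G → ℂ) 1) v w
  map_smul' c v := by
    ext i j
    rw [Matrix.smul_apply]
    simp only [symbol_apply, leftInvField_apply_one]
    exact map_smul (mfderiv 𝓘(ℝ, E) 𝓘(ℝ, ℂ) (ξ.smoothCoeff E i j : G → ℂ) 1) c v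

theorem fieldSymbol_eq (ξ : UnitaryIrrep G) (v : GroupLieAlgebra 𝓘(ℝ, E) G) :
    fieldSymbol ξ v = symbol (leftInvField v : SmoothFn E G →ₗ[ℂ] SmoothFn E G) ξ := rfl

theorem fieldSymbol_apply (ξ : UnitaryIrrep G) (v : GroupLieAlgebra 𝓘(ℝ, E) G)
    (i j : Fin ξ.dim) :
    fieldSymbol ξ v i j = dirDeriv (E := E) (fun x => ξ.mat x i j) 1 v := by
  rw [fieldSymbol_eq, symbol_apply, leftInvField_apply_one]
  rfl

theorem dirDeriv_mul {f g : G → ℂ} {x : G} (hf : MDifferentiableAt 𝓘(ℝ, E) 𝓘(ℝ, ℂ) f x)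
    (hg : MDifferentiableAt 𝓘(ℝ, E) 𝓘(ℝ, ℂ) g x) (v : TangentSpace 𝓘(ℝ, E) x) :
    dirDeriv (fun y => f y * g y) x v = f x * dirDeriv g x v + g x * dirDeriv f x v := by
  have h := hf.hasMFDerivAt.mul hg.hasMFDerivAt
  exact congrArg (fun L => L v) h.mfderiv

/-- The product of two smooth functions. -/
def SmoothFn.mul (f g : SmoothFn E G) : SmoothFn E G :=
  ⟨fun x => f x * g x, ((contDiff_mul (𝕜 := ℝ) (𝔸 := ℂ)).contMDiff (n := ∞)).comp
    (f.contMDiff.prodMk_space g.contMDiff)⟩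

theorem leftInvField_mul_apply (v : GroupLieAlgebra 𝓘(ℝ, E) G) (f g : SmoothFn E G) (x : G) :
    leftInvField v (f.mul g) x = f x * leftInvField v g x + g x * leftInvField v f x :=
  dirDeriv_mul (f.mdifferentiableAt x) (g.mdifferentiableAt x) _

theorem leftInvField_const (v : GroupLieAlgebra 𝓘(ℝ, E) G) (c : ℂ) :
    leftInvField v (c • SmoothFn.one E G) = 0 := by
  rw [map_smul]
  have : leftInvField v (SmoothFn.one E G) = 0 := by
    refine SmoothFn.ext fun x => ?_
    rw [leftInvField_apply]
    have h : mfderiv 𝓘(ℝ, E) 𝓘(ℝ, ℂ) (fun _ : G => (1 : ℂ)) x = 0 := mfderiv_const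
    exact congrArg (fun L => L (mulInvariantVectorField v x)) h
  rw [this, smul_zero]

/-- Differentiate `ξ(x)ᴴ ξ(x) = 1` at the identity along the real vector `v`. -/
theorem conjTranspose_fieldSymbol (ξ : UnitaryIrrep G) (v : GroupLieAlgebra 𝓘(ℝ, E) G) :
    (fieldSymbol ξ v)ᴴ = -fieldSymbol ξ v := by
  ext i j
  have h1 : ∑ k, ((ξ.smoothCoeff E k i).conj).mul (ξ.smoothCoeff E k j)
      = (1 : Matrix (Fin ξ.dim) (Fin ξ.dim) ℂ) i j • SmoothFn.one E G := by
    refine SmoothFn.ext fun x => ?_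
    have := congrFun (congrFun (ξ.conjTranspose_mul_mat x) i) j
    rw [SmoothFn.sum_apply, SmoothFn.smul_apply, SmoothFn.one_apply, mul_one, ← this,
      Matrix.mul_apply]
    rfl
  have h2 := congrArg (fun f : SmoothFn E G => leftInvField v f 1) h1
  simp only [map_sum, leftInvField_const, SmoothFn.sum_apply, leftInvField_mul_apply,
    leftInvField_conj, SmoothFn.conj_apply, UnitaryIrrep.smoothCoeff_apply, SmoothFn.zero_apply,
    ξ.mat_one, ← symbol_apply, ← fieldSymbol_eq, Finset.sum_add_distrib, Matrix.one_apply] at h2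
  rw [Matrix.conjTranspose_apply, Matrix.neg_apply]
  refine eq_neg_of_add_eq_zero_right ?_
  simpa using h2

/-! ### Invariance under the adjoint action -/

/-- The adjoint action of `a` on the Lie algebra. -/
def adjointAction (a : G) (v : GroupLieAlgebra 𝓘(ℝ, E) G) : GroupLieAlgebra 𝓘(ℝ, E) G :=
  (mfderiv 𝓘(ℝ, E) 𝓘(ℝ, E) (fun x => a * (x * a⁻¹)) 1 : E →L[ℝ] E) v

theorem mdifferentiableAt_mul_left (a x : G) :
    MDifferentiableAt 𝓘(ℝ, E) 𝓘(ℝ, E) (fun y : G => a * y) x :=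
  (contMDiff_mul_left (n := ∞)).mdifferentiableAt (by simp)

theorem mdifferentiableAt_mul_right (a x : G) :
    MDifferentiableAt 𝓘(ℝ, E) 𝓘(ℝ, E) (fun y : G => y * a) x :=
  (contMDiff_mul_right (n := ∞)).mdifferentiableAt (by simp)

/-- Differentiate `ξ(a x a⁻¹) = ξ(a) ξ(x) ξ(a)ᴴ` at the identity. -/
theorem fieldSymbol_adjointAction (ξ : UnitaryIrrep G) (a : G) (v : GroupLieAlgebra 𝓘(ℝ, E) G) :
    fieldSymbol ξ (adjointAction a v) = ξ.mat a * fieldSymbol ξ v * (ξ.mat a)ᴴ := by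
  ext i j
  have hc : MDifferentiableAt 𝓘(ℝ, E) 𝓘(ℝ, E) (fun x : G => a * (x * a⁻¹)) 1 :=
    (mdifferentiableAt_mul_left a (1 * a⁻¹)).comp 1 (mdifferentiableAt_mul_right a⁻¹ 1)
  let f := ξ.smoothCoeff E i j
  have h1 : dirDeriv (E := E) (fun x => f (a * (x * a⁻¹))) 1 v =
      dirDeriv (E := E) (f : G → ℂ) 1 (adjointAction a v) := by
    have h := ((f.mdifferentiableAt (a * (1 * a⁻¹))).hasMFDerivAt.comp 1 hc.hasMFDerivAt).mfderiv
    have e : ∀ z, z = 1 → (mfderiv 𝓘(ℝ, E) 𝓘(ℝ, ℂ) (f : G → ℂ) z : E →L[ℝ] ℂ) =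
        (mfderiv 𝓘(ℝ, E) 𝓘(ℝ, ℂ) (f : G → ℂ) 1 : E →L[ℝ] ℂ) := by
      rintro _ rfl
      rfl
    refine (congrArg (fun L => L v) h).trans ?_
    exact congrArg (fun L : E →L[ℝ] ℂ => L (adjointAction a v)) (e (a * (1 * a⁻¹)) (by simp))
  have h2 : (fun x => f (a * (x * a⁻¹))) =
      (∑ l, ∑ k, (ξ.mat a i k * star (ξ.mat a j l)) • ξ.smoothCoeff E k l : SmoothFn E G) := by
    funext x
    change ξ.mat (a * (x * a⁻¹)) i j = _
    rw [← mul_assoc, ξ.mat_mul, ξ.mat_mul, ξ.mat_inv]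
    simp only [Matrix.mul_apply, Matrix.conjTranspose_apply, SmoothFn.sum_apply,
      SmoothFn.smul_apply, UnitaryIrrep.smoothCoeff_apply, Finset.sum_mul]
    refine Finset.sum_congr rfl fun l _ => Finset.sum_congr rfl fun k _ => ?_
    ring
  rw [fieldSymbol_apply]
  refine h1.symm.trans ?_
  rw [h2, ← leftInvField_apply_one]
  simp only [map_sum, map_smul, Matrix.mul_apply, Matrix.conjTranspose_apply, SmoothFn.sum_apply,
    SmoothFn.smul_apply, fieldSymbol_eq, symbol_apply, Finset.sum_mul]
  refine Finset.sum_congr rfl fun l _ => Finset.sum_congr rfl fun k _ => ?_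
  ring

variable {g : Bundle.ContMDiffRiemannianMetric 𝓘(ℝ, E) ∞ E (fun x : G => TangentSpace 𝓘(ℝ, E) x)}

theorem IsBiInvariant.inner_adjointAction (hg : IsBiInvariant g) (a : G)
    (v w : GroupLieAlgebra 𝓘(ℝ, E) G) :
    g.inner 1 (adjointAction a v) (adjointAction a w) = g.inner 1 v w := by
  have hc := mfderiv_comp (1 : G) (mdifferentiableAt_mul_left (E := E) a (1 * a⁻¹))
    (mdifferentiableAt_mul_right (E := E) a⁻¹ 1)
  have hAd : ∀ v, adjointAction a v =
      mfderiv 𝓘(ℝ, E) 𝓘(ℝ, E) (fun y : G => a * y) (1 * a⁻¹)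
        (mfderiv 𝓘(ℝ, E) 𝓘(ℝ, E) (fun y : G => y * a⁻¹) 1 v) := fun v =>
    congrArg (fun L => L v) hc
  have h1 := hg.1 a (1 * a⁻¹) (mfderiv 𝓘(ℝ, E) 𝓘(ℝ, E) (fun y : G => y * a⁻¹) 1 v)
    (mfderiv 𝓘(ℝ, E) 𝓘(ℝ, E) (fun y : G => y * a⁻¹) 1 w)
  rw [hg.2 a⁻¹ 1 v w] at h1
  have e : ∀ z, z = 1 → (g.inner z : E →L[ℝ] E →L[ℝ] ℝ) = (g.inner 1 : E →L[ℝ] E →L[ℝ] ℝ) := by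
    rintro _ rfl
    rfl
  rw [← h1, hAd, hAd]
  exact (congrArg (fun L : E →L[ℝ] E →L[ℝ] ℝ =>
    L (mfderiv 𝓘(ℝ, E) 𝓘(ℝ, E) (fun y : G => a * y) (1 * a⁻¹)
        (mfderiv 𝓘(ℝ, E) 𝓘(ℝ, E) (fun y : G => y * a⁻¹) 1 v))
      (mfderiv 𝓘(ℝ, E) 𝓘(ℝ, E) (fun y : G => a * y) (1 * a⁻¹)
        (mfderiv 𝓘(ℝ, E) 𝓘(ℝ, E) (fun y : G => y * a⁻¹) 1 w)))
    (e (a * (1 * a⁻¹)) (by simp))).symm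

variable {n : ℕ} {X : Module.Basis (Fin n) ℝ (GroupLieAlgebra 𝓘(ℝ, E) G)}

theorem inner_basis_eq_repr (hX : ∀ i j, g.inner 1 (X i) (X j) = if i = j then 1 else 0)
    (k : Fin n) (v : GroupLieAlgebra 𝓘(ℝ, E) G) : g.inner 1 (X k) v = X.repr v k := by
  conv_lhs => rw [← X.sum_repr v]
  rw [map_sum]
  simp [hX]

theorem inner_eq_sum_repr (hX : ∀ i j, g.inner 1 (X i) (X j) = if i = j then 1 else 0)
    (v w : GroupLieAlgebra 𝓘(ℝ, E) G) : g.inner 1 v w = ∑ k, X.repr v k * X.repr w k := by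
  conv_lhs => rw [← X.sum_repr v]
  rw [map_sum, sum_apply]
  refine Finset.sum_congr rfl fun k _ => ?_
  rw [map_smul, smul_apply, inner_basis_eq_repr hX, smul_eq_mul]

/-- The adjoint action is isometric, so it carries `X` to another orthonormal basis, and the sum of
squares does not depend on the orthonormal basis. -/
theorem sum_fieldSymbol_sq_adjointAction (hg : IsBiInvariant g)
    (hX : ∀ i j, g.inner 1 (X i) (X j) = if i = j then 1 else 0) (ξ : UnitaryIrrep G) (a : G) :
    ∑ j, fieldSymbol ξ (adjointAction a (X j)) * fieldSymbol ξ (adjointAction a (X j)) =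
      ∑ j, fieldSymbol ξ (X j) * fieldSymbol ξ (X j) := by
  let O : Matrix (Fin n) (Fin n) ℝ := Matrix.of fun k j => X.repr (adjointAction a (X j)) k
  have hO : Oᵀ * O = 1 := by
    ext i j
    rw [Matrix.mul_apply, Matrix.one_apply, ← hX i j, ← hg.inner_adjointAction a,
      inner_eq_sum_repr hX]
    rfl
  have hO' : O * Oᵀ = 1 := mul_eq_one_comm.1 hO
  have hAd : ∀ j, fieldSymbol ξ (adjointAction a (X j)) = ∑ k, O k j • fieldSymbol ξ (X k) := by
    intro j
    conv_lhs => rw [← X.sum_repr (adjointAction a (X j))]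
    rw [map_sum]
    simp only [map_smul]
    rfl
  simp only [hAd, Finset.sum_mul_sum, smul_mul_smul_comm]
  rw [Finset.sum_comm]
  refine Finset.sum_congr rfl fun k _ => ?_
  rw [Finset.sum_comm]
  have h3 : ∀ l, ∑ j, (O k j * O l j) • (fieldSymbol ξ (X k) * fieldSymbol ξ (X l)) =
      (1 : Matrix (Fin n) (Fin n) ℝ) k l • (fieldSymbol ξ (X k) * fieldSymbol ξ (X l)) := by
    intro l
    rw [← Finset.sum_smul, ← hO', Matrix.mul_apply]
    rfl
  simp only [h3, Matrix.one_apply, ite_smul, one_smul, zero_smul, Finset.sum_ite_eq,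
    Finset.mem_univ, if_true]

theorem isLeftInvariant_laplacian (X : Fin n → GroupLieAlgebra 𝓘(ℝ, E) G) :
    IsLeftInvariant (laplacian X : SmoothFn E G →ₗ[ℂ] SmoothFn E G) := by
  intro a f
  refine SmoothFn.ext fun x => ?_
  simp only [laplacian, LinearMap.neg_apply, LinearMap.sum_apply, LinearMap.comp_apply]
  change -(∑ j, _ : SmoothFn E G) x = -(∑ j, _ : SmoothFn E G) (a * x)
  rw [SmoothFn.sum_apply, SmoothFn.sum_apply]
  refine congrArg Neg.neg (Finset.sum_congr rfl fun j _ => ?_)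
  rw [isLeftInvariant_leftInvField, isLeftInvariant_leftInvField]
  rfl

theorem symbol_laplacian (X : Fin n → GroupLieAlgebra 𝓘(ℝ, E) G) (ξ : UnitaryIrrep G) :
    symbol (laplacian X : SmoothFn E G →ₗ[ℂ] SmoothFn E G) ξ =
      ∑ j, (fieldSymbol ξ (X j))ᴴ * fieldSymbol ξ (X j) := by
  have h : ∀ j, (fieldSymbol ξ (X j))ᴴ * fieldSymbol ξ (X j) =
      -symbol (leftInvField (X j) ∘ₗ leftInvField (X j) : SmoothFn E G →ₗ[ℂ] SmoothFn E G) ξ := by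
    intro j
    rw [conjTranspose_fieldSymbol, symbol_comp (isLeftInvariant_leftInvField _), Matrix.neg_mul]
    rfl
  simp only [h, Finset.sum_neg_distrib]
  ext i j
  rw [symbol_apply, laplacian, LinearMap.neg_apply, LinearMap.sum_apply, SmoothFn.neg_apply,
    SmoothFn.sum_apply, Matrix.neg_apply, Matrix.sum_apply]
  simp only [symbol_apply]

theorem hsSq_nonneg {d : ℕ} (A : Matrix (Fin d) (Fin d) ℂ) : 0 ≤ hsSq A :=
  Finset.sum_nonneg fun _ _ => Finset.sum_nonneg fun _ _ => by positivity

/-- Invariance under the adjoint action means that the symbol commutes with every `ξ(a)`, so Schur's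
lemma applies. The sum of `σᴴ σ` in `symbol_laplacian` shows that the scalar is non-negative. -/
theorem exists_symbol_laplacian_eq (hg : IsBiInvariant g)
    (hX : ∀ i j, g.inner 1 (X i) (X j) = if i = j then 1 else 0) (ξ : UnitaryIrrep G) :
    ∃ ν : ℝ, 0 ≤ ν ∧ symbol (laplacian X : SmoothFn E G →ₗ[ℂ] SmoothFn E G) ξ = (ν : ℂ) • 1 := by
  obtain ⟨c, hc⟩ := ξ.eq_smul_one_of_commute
      (symbol (laplacian X : SmoothFn E G →ₗ[ℂ] SmoothFn E G) ξ) fun a => by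
    have h1 : ∑ j, (fieldSymbol ξ (X j))ᴴ * fieldSymbol ξ (X j) =
        -∑ j, fieldSymbol ξ (X j) * fieldSymbol ξ (X j) := by
      simp only [conjTranspose_fieldSymbol, Matrix.neg_mul, Finset.sum_neg_distrib]
    have h2 := sum_fieldSymbol_sq_adjointAction hg hX ξ a
    have h3 : ∀ j, fieldSymbol ξ (adjointAction a (X j)) * fieldSymbol ξ (adjointAction a (X j)) =
        ξ.mat a * (fieldSymbol ξ (X j) * fieldSymbol ξ (X j)) * (ξ.mat a)ᴴ := fun j => by
      rw [fieldSymbol_adjointAction]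
      calc _ = ξ.mat a * fieldSymbol ξ (X j) * ((ξ.mat a)ᴴ * ξ.mat a) * fieldSymbol ξ (X j)
            * (ξ.mat a)ᴴ := by simp only [Matrix.mul_assoc]
        _ = _ := by rw [ξ.conjTranspose_mul_mat, Matrix.mul_one]; simp only [Matrix.mul_assoc]
    simp only [h3, ← Finset.sum_mul, ← Finset.mul_sum] at h2
    rw [symbol_laplacian, h1, Matrix.neg_mul, Matrix.mul_neg]
    conv_lhs => rw [← h2]
    rw [Matrix.mul_assoc, ξ.conjTranspose_mul_mat, Matrix.mul_one]
  refine ⟨∑ j, ∑ k, ‖fieldSymbol ξ (X j) k 0‖ ^ 2, by positivity, ?_⟩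
  rw [hc]
  congr 1
  have h4 := congrFun (congrFun (symbol_laplacian X ξ) 0) 0
  rw [hc] at h4
  simp only [Matrix.smul_apply, Matrix.one_apply_eq, smul_eq_mul, mul_one, Matrix.sum_apply,
    Matrix.mul_apply, Matrix.conjTranspose_apply] at h4
  rw [h4]
  push_cast
  refine Finset.sum_congr rfl fun j _ => Finset.sum_congr rfl fun k _ => ?_
  rw [mul_comm]
  exact Complex.mul_conj' _

theorem laplacian_smoothCoeff (hg : IsBiInvariant g)
    (hX : ∀ i j, g.inner 1 (X i) (X j) = if i = j then 1 else 0) (ξ : UnitaryIrrep G)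
    (i j : Fin ξ.dim) :
    laplacian X (ξ.smoothCoeff E i j) = (nu X ξ : ℂ) • ξ.smoothCoeff E i j := by
  have hex : ∃ ν : ℝ, ∀ i j, laplacian X (SmoothFn.ofFun E fun x => ξ.mat x i j) =
      (ν : ℂ) • SmoothFn.ofFun E fun x => ξ.mat x i j := by
    obtain ⟨ν, -, hν⟩ := exists_symbol_laplacian_eq hg hX ξ
    refine ⟨ν, fun i j => ?_⟩
    rw [ofFun_mat, (isLeftInvariant_laplacian X).apply_smoothCoeff, hν]
    simp [Matrix.one_apply]
  have := Classical.epsilon_spec hex i j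
  rw [ofFun_mat] at this
  exact this

theorem symbol_laplacian_eq_nu (hg : IsBiInvariant g)
    (hX : ∀ i j, g.inner 1 (X i) (X j) = if i = j then 1 else 0) (ξ : UnitaryIrrep G) :
    symbol (laplacian X : SmoothFn E G →ₗ[ℂ] SmoothFn E G) ξ = (nu X ξ : ℂ) • 1 := by
  ext i j
  rw [symbol_apply, laplacian_smoothCoeff hg hX, SmoothFn.smul_apply, ← ξ.mat_one]
  rfl

theorem sum_conjTranspose_mul_fieldSymbol (hg : IsBiInvariant g)
    (hX : ∀ i j, g.inner 1 (X i) (X j) = if i = j then 1 else 0) (ξ : UnitaryIrrep G) :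
    ∑ j, (fieldSymbol ξ (X j))ᴴ * fieldSymbol ξ (X j) = (nu X ξ : ℂ) • 1 := by
  rw [← symbol_laplacian, symbol_laplacian_eq_nu hg hX]

theorem nu_nonneg (hg : IsBiInvariant g)
    (hX : ∀ i j, g.inner 1 (X i) (X j) = if i = j then 1 else 0) (ξ : UnitaryIrrep G) :
    0 ≤ nu X ξ := by
  obtain ⟨ν, hν0, hν⟩ := exists_symbol_laplacian_eq hg hX ξ
  rw [symbol_laplacian_eq_nu hg hX] at hν
  have := congrFun (congrFun hν 0) 0
  simp only [Matrix.smul_apply, Matrix.one_apply_eq, smul_eq_mul, mul_one] at this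
  rw [Complex.ofReal_injective this]
  exact hν0

theorem nu_equiv (hg : IsBiInvariant g)
    (hX : ∀ i j, g.inner 1 (X i) (X j) = if i = j then 1 else 0) {ξ η : UnitaryIrrep G}
    (h : (unitaryIrrepSetoid G).r ξ η) : nu X ξ = nu X η := by
  obtain ⟨T, h1, h2, h3⟩ := h
  have := symbol_equiv (laplacian X : SmoothFn E G →ₗ[ℂ] SmoothFn E G) h2 h3
  rw [symbol_laplacian_eq_nu hg hX, symbol_laplacian_eq_nu hg hX] at this
  rw [Matrix.mul_smul, Matrix.mul_one, Matrix.smul_mul, h2] at this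
  have := congrFun (congrFun this 0) 0
  simp only [Matrix.smul_apply, Matrix.one_apply_eq, smul_eq_mul, mul_one] at this
  exact (Complex.ofReal_injective this).symm

end Symbols

/-! ### The spectral gap -/

section RiemannianDistance

open scoped Bundle

variable {E : Type*} [NormedAddCommGroup E] [NormedSpace ℝ E]
  {M : Type*} [TopologicalSpace M] [ChartedSpace E M] [IsManifold 𝓘(ℝ, E) 1 M]
  [Bundle.RiemannianBundle (fun x : M => TangentSpace 𝓘(ℝ, E) x)]

/-- Integrate the derivative of `f` along a curve from `x` to `y` of length less than `r`. -/
theorem enorm_sub_le_mul_of_riemannianEDist_lt {f : M → ℂ}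
    (hf : ContMDiff 𝓘(ℝ, E) 𝓘(ℝ, ℂ) 1 f) {K : ℝ≥0}
    (h : ∀ x (v : TangentSpace 𝓘(ℝ, E) x), ‖dirDeriv f x v‖ₑ ≤ K * ‖v‖ₑ) {x y : M} {r : ℝ≥0∞}
    (hr : Manifold.riemannianEDist 𝓘(ℝ, E) x y < r) : ‖f y - f x‖ₑ ≤ K * r := by
  obtain ⟨γ, rfl, rfl, hγ, hlen⟩ := Manifold.exists_lt_of_riemannianEDist_lt hr
  have hD : ContDiffOn ℝ 1 (f ∘ γ) (Set.Icc 0 1) :=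
    contMDiffOn_iff_contDiffOn.mp (hf.comp_contMDiffOn hγ)
  refine (enorm_sub_le_lintegral_derivWithin_Icc_of_contDiffOn_Icc hD zero_le_one).trans ?_
  refine le_trans ?_ (mul_le_mul_right hlen.le (K : ℝ≥0∞))
  rw [Manifold.pathELength_eq_lintegral_mfderivWithin_Icc,
    ← lintegral_const_mul' _ _ ENNReal.coe_ne_top]
  refine setLIntegral_mono' measurableSet_Icc fun t ht => ?_
  refine le_trans (le_of_eq ?_) (h (γ t) _)
  have hc : HasMFDerivWithinAt 𝓘(ℝ, ℝ) 𝓘(ℝ, ℂ) (f ∘ γ) (Set.Icc 0 1) t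
      ((mfderiv 𝓘(ℝ, E) 𝓘(ℝ, ℂ) f (γ t)).comp
        (mfderivWithin 𝓘(ℝ, ℝ) 𝓘(ℝ, E) γ (Set.Icc 0 1) t)) :=
    ((hf (γ t)).mdifferentiableAt one_ne_zero).hasMFDerivAt.comp_hasMFDerivWithinAt t
      (hγ.mdifferentiableOn one_ne_zero t ht).hasMFDerivWithinAt
  let L : ℝ →L[ℝ] ℂ := (mfderiv 𝓘(ℝ, E) 𝓘(ℝ, ℂ) f (γ t) : E →L[ℝ] ℂ).comp
    (mfderivWithin 𝓘(ℝ, ℝ) 𝓘(ℝ, E) γ (Set.Icc 0 1) t : ℝ →L[ℝ] E)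
  have hF : HasFDerivWithinAt (f ∘ γ) L (Set.Icc 0 1) t :=
    hasMFDerivWithinAt_iff_hasFDerivWithinAt.1 hc
  have hd := hF.hasDerivWithinAt.derivWithin (uniqueDiffOn_Icc zero_lt_one t ht)
  rw [hd]
  rfl

variable [IsContinuousRiemannianBundle E (fun x : M => TangentSpace 𝓘(ℝ, E) x)]

/-- The points at finite distance from `x` form a clopen set, hence everything by connectedness;
compactness then makes the bound uniform. -/
theorem exists_riemannianEDist_le [CompactSpace M] [ConnectedSpace M] (x : M) :
    ∃ D : ℝ≥0, ∀ y, Manifold.riemannianEDist 𝓘(ℝ, E) x y ≤ D := by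
  have hfin : ∀ y, Manifold.riemannianEDist 𝓘(ℝ, E) x y < ⊤ := by
    have hcl : IsClopen {y | Manifold.riemannianEDist 𝓘(ℝ, E) x y < ⊤} := by
      constructor
      · refine ⟨isOpen_iff_mem_nhds.2 fun y hy => ?_⟩
        filter_upwards [eventually_riemannianEDist_lt 𝓘(ℝ, E) y one_pos] with z hz hz'
        refine hy ((Manifold.riemannianEDist_triangle (y := z)).trans_lt
          (ENNReal.add_lt_top.2 ⟨hz', ?_⟩))
        rw [Manifold.riemannianEDist_comm]
        exact hz.trans ENNReal.one_lt_top
      · refine isOpen_iff_mem_nhds.2 fun y hy => ?_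
        filter_upwards [eventually_riemannianEDist_lt 𝓘(ℝ, E) y one_pos] with z hz
        exact (Manifold.riemannianEDist_triangle (y := y)).trans_lt
          (ENNReal.add_lt_top.2 ⟨hy, hz.trans ENNReal.one_lt_top⟩)
    have := hcl.eq_univ ⟨x, by simp [Manifold.riemannianEDist_self]⟩
    exact Set.eq_univ_iff_forall.1 this
  have hb := (isCompact_univ (X := M)).induction_on
    (p := fun s => ∃ D : ℝ≥0, ∀ y ∈ s, Manifold.riemannianEDist 𝓘(ℝ, E) x y ≤ D) ⟨0, by simp⟩
    (fun s t hst ⟨D, hD⟩ => ⟨D, fun y hy => hD y (hst hy)⟩)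
    (fun s t ⟨D, hD⟩ ⟨D', hD'⟩ => ⟨max D D', fun y hy => hy.elim
      (fun h => (hD y h).trans (by simp)) (fun h => (hD' y h).trans (by simp))⟩)
    (fun y _ => by
      refine ⟨_, mem_nhdsWithin_of_mem_nhds
        (eventually_riemannianEDist_lt 𝓘(ℝ, E) y one_pos),
        (Manifold.riemannianEDist 𝓘(ℝ, E) x y).toNNReal + 1, fun z hz => ?_⟩
      refine (Manifold.riemannianEDist_triangle (y := y)).trans ?_
      rw [ENNReal.coe_add, ENNReal.coe_toNNReal (hfin y).ne]
      exact add_le_add le_rfl (le_of_lt hz))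
  obtain ⟨D, hD⟩ := hb
  exact ⟨D, fun y => hD y trivial⟩

end RiemannianDistance

/-! ### A positive lower bound for the non-trivial eigenvalues -/

section Gap

open scoped Bundle

variable {E : Type*} [NormedAddCommGroup E] [NormedSpace ℝ E] [FiniteDimensional ℝ E]
  {G : Type*} [TopologicalSpace G] [T2Space G] [CompactSpace G]
  [ChartedSpace E G] [Group G] [LieGroup 𝓘(ℝ, E) ∞ G] [IsTopologicalGroup G]
  {g : Bundle.ContMDiffRiemannianMetric 𝓘(ℝ, E) ∞ E (fun x : G => TangentSpace 𝓘(ℝ, E) x)}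
  {n : ℕ} {X : Module.Basis (Fin n) ℝ (GroupLieAlgebra 𝓘(ℝ, E) G)}

/-- Cauchy–Schwarz twice: the rows of `ξ(x)` are unit vectors, and `ν_ξ` is a diagonal entry of the
sum of `σ(X_l)ᴴ σ(X_l)`. -/
theorem normSq_leftInvField_smoothCoeff_le (hg : IsBiInvariant g)
    (hX : ∀ i j, g.inner 1 (X i) (X j) = if i = j then 1 else 0) (ξ : UnitaryIrrep G)
    (i j : Fin ξ.dim) (w : GroupLieAlgebra 𝓘(ℝ, E) G) (x : G) :
    ‖leftInvField w (ξ.smoothCoeff E i j) x‖ ^ 2 ≤ nu X ξ * g.inner 1 w w := by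
  let σ := fieldSymbol ξ w
  have h1 : leftInvField w (ξ.smoothCoeff E i j) x = ∑ k, ξ.mat x i k * σ k j := by
    rw [(isLeftInvariant_leftInvField w).apply_smoothCoeff, SmoothFn.sum_apply]
    refine Finset.sum_congr rfl fun k _ => ?_
    rw [SmoothFn.smul_apply, mul_comm]
    rfl
  have hrow : ∑ k, ‖ξ.mat x i k‖ ^ 2 = 1 := by
    have := congrFun (congrFun (ξ.mat_mul_conjTranspose x) i) i
    rw [Matrix.mul_apply, Matrix.one_apply_eq] at this
    have h2 : ((∑ k, ‖ξ.mat x i k‖ ^ 2 : ℝ) : ℂ) = 1 := by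
      rw [← this]
      push_cast
      exact Finset.sum_congr rfl fun k _ => (Complex.mul_conj' _).symm
    exact_mod_cast h2
  have hcs1 : ‖∑ k, ξ.mat x i k * σ k j‖ ^ 2 ≤ ∑ k, ‖σ k j‖ ^ 2 := by
    calc ‖∑ k, ξ.mat x i k * σ k j‖ ^ 2 ≤ (∑ k, ‖ξ.mat x i k‖ * ‖σ k j‖) ^ 2 := by
          gcongr
          exact (norm_sum_le _ _).trans (le_of_eq (by simp only [norm_mul]))
      _ ≤ (∑ k, ‖ξ.mat x i k‖ ^ 2) * ∑ k, ‖σ k j‖ ^ 2 := Finset.sum_mul_sq_le_sq_mul_sq _ _ _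
      _ = _ := by rw [hrow, one_mul]
  have hnu : nu X ξ = ∑ l, ∑ k, ‖fieldSymbol ξ (X l) k j‖ ^ 2 := by
    have := congrFun (congrFun (sum_conjTranspose_mul_fieldSymbol hg hX ξ) j) j
    simp only [Matrix.sum_apply, Matrix.mul_apply, Matrix.conjTranspose_apply, Matrix.smul_apply,
      Matrix.one_apply_eq, smul_eq_mul, mul_one] at this
    have h2 : ((nu X ξ : ℝ) : ℂ) = ((∑ l, ∑ k, ‖fieldSymbol ξ (X l) k j‖ ^ 2 : ℝ) : ℂ) := by
      rw [← this]
      push_cast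
      refine Finset.sum_congr rfl fun l _ => Finset.sum_congr rfl fun k _ => ?_
      rw [mul_comm]
      exact Complex.mul_conj' _
    exact_mod_cast h2
  have hσ : ∀ k, ‖σ k j‖ ^ 2 ≤ (∑ l, X.repr w l ^ 2) * ∑ l, ‖fieldSymbol ξ (X l) k j‖ ^ 2 := by
    intro k
    have : σ = ∑ l, X.repr w l • fieldSymbol ξ (X l) := by
      simp only [σ]
      conv_lhs => rw [← X.sum_repr w]
      rw [map_sum]
      simp only [map_smul]
    rw [this, Matrix.sum_apply]
    calc ‖∑ l, (X.repr w l • fieldSymbol ξ (X l)) k j‖ ^ 2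
        ≤ (∑ l, |X.repr w l| * ‖fieldSymbol ξ (X l) k j‖) ^ 2 := by
          gcongr
          refine (norm_sum_le _ _).trans (le_of_eq ?_)
          simp only [Matrix.smul_apply, norm_smul, Real.norm_eq_abs]
      _ ≤ (∑ l, |X.repr w l| ^ 2) * ∑ l, ‖fieldSymbol ξ (X l) k j‖ ^ 2 :=
          Finset.sum_mul_sq_le_sq_mul_sq _ _ _
      _ = _ := by simp only [sq_abs]
  rw [h1]
  refine hcs1.trans ((Finset.sum_le_sum fun k _ => hσ k).trans (le_of_eq ?_))
  rw [← Finset.mul_sum, Finset.sum_comm, ← hnu, inner_eq_sum_repr hX, mul_comm]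
  simp only [sq]

theorem exists_mulInvariantVectorField_eq (hg : IsBiInvariant g) (x : G)
    (v : TangentSpace 𝓘(ℝ, E) x) :
    ∃ w : GroupLieAlgebra 𝓘(ℝ, E) G, mulInvariantVectorField w x = v ∧
      g.inner 1 w w = g.inner x v v := by
  have hd : ∀ a : G, MDifferentiableAt 𝓘(ℝ, E) 𝓘(ℝ, E) (fun y : G => x⁻¹ * y) a := fun a =>
    mdifferentiableAt_mul_left x⁻¹ a
  let w : E := (mfderiv 𝓘(ℝ, E) 𝓘(ℝ, E) (fun y : G => x⁻¹ * y) x : E →L[ℝ] E) v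
  have e : ∀ z, z = (1 : G) → (g.inner z : E →L[ℝ] E →L[ℝ] ℝ) =
      (g.inner 1 : E →L[ℝ] E →L[ℝ] ℝ) := by
    rintro _ rfl
    rfl
  have e' : ∀ z, z = (1 : G) →
      (mfderiv 𝓘(ℝ, E) 𝓘(ℝ, E) (fun y : G => x * y) z : E →L[ℝ] E) =
      (mfderiv 𝓘(ℝ, E) 𝓘(ℝ, E) (fun y : G => x * y) 1 : E →L[ℝ] E) := by
    rintro _ rfl
    rfl
  refine ⟨w, ?_, ?_⟩
  · have h3 := mfderiv_comp x (mdifferentiableAt_mul_left (E := E) x (x⁻¹ * x))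
      (mdifferentiableAt_mul_left (E := E) x⁻¹ x)
    have h4 : (fun y => x * y) ∘ (fun y => x⁻¹ * y) = (id : G → G) := by
      funext y
      simp
    rw [h4, mfderiv_id] at h3
    have h5 := congrArg (fun L : E →L[ℝ] E => L v) h3
    exact (congrArg (fun L : E →L[ℝ] E => L w) (e' (x⁻¹ * x) (by simp))).symm.trans h5.symm
  · rw [← hg.1 x⁻¹ x v v]
    exact (congrArg (fun L : E →L[ℝ] E →L[ℝ] ℝ => L w w) (e (x⁻¹ * x) (by simp))).symm

/-- The coefficient `ξ_00` equals `1` at the identity, is Lipschitz with constant `√ν_ξ`, and has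
mean zero because `ξ` is not trivial. Hence `1 = |∫ (ξ_00 - 1)| ≤ √ν_ξ (D + 1)`, where `D` bounds
the distances from the identity; the `+ 1` makes the distance bound strict. -/
theorem exists_pos_le_nu [ConnectedSpace G] [MeasurableSpace G] [BorelSpace G]
    (μ : Measure G) [μ.IsHaarMeasure] [IsProbabilityMeasure μ] (hg : IsBiInvariant g)
    (hX : ∀ i j, g.inner 1 (X i) (X j) = if i = j then 1 else 0) :
    ∃ ν₀ : ℝ, 0 < ν₀ ∧ ∀ ξ : UnitaryIrrep G, ¬ (unitaryIrrepSetoid G).r (trivialIrrep G) ξ →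
      ν₀ ≤ nu X ξ := by
  let : Bundle.RiemannianBundle (fun x : G => TangentSpace 𝓘(ℝ, E) x) := ⟨g.toRiemannianMetric⟩
  have : IsContinuousRiemannianBundle E (fun x : G => TangentSpace 𝓘(ℝ, E) x) :=
    ⟨⟨g.inner, g.contMDiff.continuous, fun _ _ _ => rfl⟩⟩
  obtain ⟨D, hD⟩ := exists_riemannianEDist_le (E := E) (1 : G)
  refine ⟨((D + 1 : ℝ) ^ 2)⁻¹, by positivity, fun ξ hξ => ?_⟩
  let f := ξ.smoothCoeff E 0 0
  have hν := nu_nonneg hg hX ξ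
  have hLip : ∀ x (v : TangentSpace 𝓘(ℝ, E) x),
      ‖dirDeriv (f : G → ℂ) x v‖ₑ ≤ (√(nu X ξ)).toNNReal * ‖v‖ₑ := by
    intro x v
    obtain ⟨w, rfl, hw⟩ := exists_mulInvariantVectorField_eq hg x v
    have h1 := normSq_leftInvField_smoothCoeff_le hg hX ξ 0 0 w x
    rw [hw] at h1
    have h2 : ‖mulInvariantVectorField w x‖ ^ 2 =
        g.inner x (mulInvariantVectorField w x) (mulInvariantVectorField w x) :=
      (real_inner_self_eq_norm_sq (mulInvariantVectorField w x)).symm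
    rw [← h2] at h1
    have h3 : ‖leftInvField w f x‖ ≤ √(nu X ξ) * ‖mulInvariantVectorField w x‖ := by
      refine le_of_sq_le_sq ?_ (by positivity)
      rw [mul_pow, Real.sq_sqrt hν]
      exact h1
    have h4 : ENNReal.ofReal ‖leftInvField w f x‖ ≤
        ENNReal.ofReal (√(nu X ξ) * ‖mulInvariantVectorField w x‖) := ENNReal.ofReal_le_ofReal h3
    rw [ENNReal.ofReal_mul (by positivity), ofReal_norm, ofReal_norm] at h4
    exact h4
  have hdist : ∀ y, ‖f y - 1‖ ≤ √(nu X ξ) * (D + 1) := by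
    intro y
    have h1 := enorm_sub_le_mul_of_riemannianEDist_lt (f.contMDiff.of_le (by simp)) hLip
      (x := 1) (y := y) (r := D + 1) ((hD y).trans_lt
        (ENNReal.lt_add_right ENNReal.coe_ne_top one_ne_zero))
    have h2 : f 1 = 1 := by
      change ξ.mat 1 0 0 = 1
      rw [ξ.mat_one, Matrix.one_apply_eq]
    rw [h2] at h1
    have h3 := ENNReal.toReal_mono (by finiteness) h1
    rw [ENNReal.toReal_mul, ENNReal.toReal_add ENNReal.coe_ne_top ENNReal.one_ne_top] at h3
    simpa using h3
  have hint : ∫ x, (f x - 1) ∂μ = -1 := by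
    have h1 := UnitaryIrrep.integral_coeff_eq_zero (trivialIrrep G) ξ μ hξ 0 0
      (0 : Fin 1) (0 : Fin 1)
    have h2 : ∫ x, f x ∂μ = 0 := by
      rw [← h1]
      refine integral_congr_ae (ae_of_all _ fun x => ?_)
      change f x = ξ.mat x 0 0 * star ((1 : Matrix (Fin 1) (Fin 1) ℂ) 0 0)
      simp [f]
    rw [integral_sub (integrable_of_continuous μ f.contMDiff.continuous) (integrable_const _), h2]
    simp
  have h1 : (1 : ℝ) ≤ √(nu X ξ) * (D + 1) := by
    have := norm_integral_le_of_norm_le_const (μ := μ) (ae_of_all _ hdist)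
    rw [hint] at this
    simpa using this
  have h2 : 1 ≤ nu X ξ * (D + 1) ^ 2 := by
    have : (1 : ℝ) ^ 2 ≤ (√(nu X ξ) * (D + 1)) ^ 2 := by gcongr
    rwa [mul_pow, Real.sq_sqrt hν, one_pow] at this
  rw [inv_le_iff_one_le_mul₀ (by positivity)]
  exact h2

end Gap

/-! ### The Plancherel formula -/

theorem ofReal_hsSq_eq_trace {d : ℕ} (A : Matrix (Fin d) (Fin d) ℂ) :
    ((hsSq A : ℝ) : ℂ) = Matrix.trace (Aᴴ * A) := by
  simp only [hsSq, Matrix.trace, Matrix.diag_apply, Matrix.mul_apply, Matrix.conjTranspose_apply]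
  rw [Finset.sum_comm]
  push_cast
  refine Finset.sum_congr rfl fun j _ => Finset.sum_congr rfl fun i _ => ?_
  rw [mul_comm]
  exact (Complex.mul_conj' _).symm

/-- The class of a representation. -/
def UnitaryDual.mk {G : Type*} [TopologicalSpace G] [Group G] (ξ : UnitaryIrrep G) :
    UnitaryDual G :=
  Quotient.mk (unitaryIrrepSetoid G) ξ

theorem UnitaryDual.rep_equiv {G : Type*} [TopologicalSpace G] [Group G] (ξ : UnitaryIrrep G) :
    (unitaryIrrepSetoid G).r (UnitaryDual.mk ξ).rep ξ :=
  Quotient.exact (Quotient.out_eq (Quotient.mk (unitaryIrrepSetoid G) ξ))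

theorem UnitaryDual.not_rep_equiv {G : Type*} [TopologicalSpace G] [Group G] {c c' : UnitaryDual G}
    (h : c ≠ c') : ¬ (unitaryIrrepSetoid G).r c.rep c'.rep := fun hr => h (by
  rw [← Quotient.out_eq c, ← Quotient.out_eq c']
  exact Quotient.sound hr)

theorem UnitaryIrrep.coeff_equiv {G : Type*} [TopologicalSpace G] [Group G] {ξ η : UnitaryIrrep G}
    {T : Matrix (Fin η.dim) (Fin ξ.dim) ℂ} (hT : T * Tᴴ = 1)
    (h : ∀ x, T * ξ.mat x = η.mat x * T) (i j : Fin η.dim) :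
    η.coeff i j = ∑ l, ∑ k, (T i k * star (T j l)) • ξ.coeff k l := by
  ext x
  have h2 : η.mat x = T * ξ.mat x * Tᴴ := by rw [h, Matrix.mul_assoc, hT, Matrix.mul_one]
  rw [UnitaryIrrep.coeff_apply, h2]
  simp only [Matrix.mul_apply, Matrix.conjTranspose_apply, ContinuousMap.coe_sum,
    Finset.sum_apply, ContinuousMap.coe_smul, Pi.smul_apply, UnitaryIrrep.coeff_apply,
    Finset.sum_mul, smul_eq_mul]
  refine Finset.sum_congr rfl fun l _ => Finset.sum_congr rfl fun k _ => ?_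
  ring

/-- The index set of the matrix coefficients of the chosen representatives. -/
abbrev CoeffIndex (G : Type*) [TopologicalSpace G] [Group G] : Type _ :=
  Σ c : UnitaryDual G, Fin c.rep.dim × Fin c.rep.dim

section Plancherel

variable {G : Type*} [TopologicalSpace G] [T2Space G] [CompactSpace G]
  [Group G] [IsTopologicalGroup G] [MeasurableSpace G] [BorelSpace G]
  (μ : Measure G) [μ.IsHaarMeasure] [IsProbabilityMeasure μ]

/-- The normalized matrix coefficients `√d_ξ ξ_{ij}` as elements of `L²(G)`. -/
def normalizedCoeff (p : CoeffIndex G) : Lp ℂ 2 μ :=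
  ((√p.1.rep.dim : ℝ) : ℂ) • toL2 μ (p.1.rep.coeff p.2.1 p.2.2)

theorem orthonormal_normalizedCoeff : Orthonormal ℂ (normalizedCoeff (G := G) μ) := by
  classical
  rw [orthonormal_iff_ite]
  rintro ⟨c, i, j⟩ ⟨c', i', j'⟩
  simp only [normalizedCoeff, inner_smul_left, inner_smul_right, inner_toL2_toL2]
  by_cases hc : c = c'
  · subst hc
    have h1 := UnitaryIrrep.integral_coeff_mul_star c.rep μ i' j' i j
    simp only [UnitaryIrrep.coeff_apply]
    rw [h1]
    have hd : ((√c.rep.dim : ℝ) : ℂ) * ((√c.rep.dim : ℝ) : ℂ) = c.rep.dim := by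
      rw [← Complex.ofReal_mul, Real.mul_self_sqrt (Nat.cast_nonneg _)]
      simp
    have hd0 : (c.rep.dim : ℂ) ≠ 0 := by exact_mod_cast NeZero.ne c.rep.dim
    have hiff : (Sigma.mk c (i, j) : CoeffIndex G) = ⟨c, (i', j')⟩ ↔ i' = i ∧ j' = j := by
      simp [eq_comm]
    simp only [hiff, Complex.conj_ofReal]
    split_ifs
    · rw [← mul_assoc, hd, mul_inv_cancel₀ hd0]
    · simp
  · rw [if_neg fun h => hc (congrArg Sigma.fst h)]
    have := UnitaryIrrep.integral_coeff_eq_zero c.rep c'.rep μ (UnitaryDual.not_rep_equiv hc)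
      i' j' i j
    simp only [UnitaryIrrep.coeff_apply]
    rw [this]
    simp

theorem toL2_coeff_mem_span (ξ : UnitaryIrrep G) (i j : Fin ξ.dim) :
    toL2 μ (ξ.coeff i j) ∈ Submodule.span ℂ (Set.range (normalizedCoeff (G := G) μ)) := by
  have hrep : ∀ (c : UnitaryDual G) (k l : Fin c.rep.dim),
      toL2 μ (c.rep.coeff k l) ∈ Submodule.span ℂ (Set.range (normalizedCoeff (G := G) μ)) := by
    intro c k l
    have h0 : ((√c.rep.dim : ℝ) : ℂ) ≠ 0 := by
      have : (0 : ℝ) < c.rep.dim := by exact_mod_cast c.rep.dim_pos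
      exact_mod_cast (Real.sqrt_pos.2 this).ne'
    rw [← Submodule.smul_mem_iff _ h0]
    exact Submodule.subset_span ⟨⟨c, k, l⟩, rfl⟩
  obtain ⟨T, -, hT, h⟩ := UnitaryDual.rep_equiv ξ
  rw [UnitaryIrrep.coeff_equiv hT h, map_sum]
  refine Submodule.sum_mem _ fun l _ => ?_
  rw [map_sum]
  refine Submodule.sum_mem _ fun k _ => ?_
  rw [map_smul]
  exact Submodule.smul_mem _ _ (hrep _ k l)

/-- Equivalent representations have the same span of coefficients, so the chosen representatives
suffice in Peter–Weyl. -/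
theorem orthogonal_span_normalizedCoeff (E : Type*) [NormedAddCommGroup E] [NormedSpace ℝ E]
    [FiniteDimensional ℝ E] [ChartedSpace E G] [LieGroup 𝓘(ℝ, E) ∞ G] :
    (Submodule.span ℂ (Set.range (normalizedCoeff (G := G) μ)))ᗮ = ⊥ := by
  rw [eq_bot_iff, ← orthogonal_trigPoly_eq_bot μ E]
  refine Submodule.orthogonal_le ?_
  rw [trigPoly, Submodule.map_span, Submodule.span_le]
  rintro _ ⟨_, ⟨ξ, i, j, rfl⟩, rfl⟩
  exact toL2_coeff_mem_span μ ξ i j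

variable (E : Type*) [NormedAddCommGroup E] [NormedSpace ℝ E] [FiniteDimensional ℝ E]
  [ChartedSpace E G] [LieGroup 𝓘(ℝ, E) ∞ G]

/-- The normalized matrix coefficients form a Hilbert basis of `L²(G)`. -/
def coeffBasis : HilbertBasis (CoeffIndex G) ℂ (Lp ℂ 2 μ) :=
  HilbertBasis.mkOfOrthogonalEqBot (orthonormal_normalizedCoeff μ)
    (orthogonal_span_normalizedCoeff μ E)

theorem coeffBasis_repr_apply (f : Lp ℂ 2 μ) (p : CoeffIndex G) :
    (coeffBasis μ E).repr f p =
      (√p.1.rep.dim : ℝ) * ∫ x, f x * star (p.1.rep.mat x p.2.1 p.2.2) ∂μ := by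
  rw [HilbertBasis.repr_apply_apply, coeffBasis, HilbertBasis.coe_mkOfOrthogonalEqBot,
    normalizedCoeff, inner_smul_left, inner_toL2, Complex.conj_ofReal]
  rfl

end Plancherel

/-! ### Fourier coefficients of distributions and the Plancherel formula -/

section Distributions

variable {E : Type*} [NormedAddCommGroup E] [NormedSpace ℝ E] [FiniteDimensional ℝ E]
  {G : Type*} [TopologicalSpace G] [T2Space G] [CompactSpace G]
  [ChartedSpace E G] [Group G] [LieGroup 𝓘(ℝ, E) ∞ G] [IsTopologicalGroup G]

theorem fourierCoeff_apply (u : Distrib E G) (ξ : UnitaryIrrep G) (i j : Fin ξ.dim) :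
    fourierCoeff u ξ i j = u ((ξ.smoothCoeff E j i).conj) := by
  rw [fourierCoeff, Matrix.of_apply, ofFun_conjTranspose]

theorem fourierCoeff_sub (u v : Distrib E G) (ξ : UnitaryIrrep G) :
    fourierCoeff (u - v) ξ = fourierCoeff u ξ - fourierCoeff v ξ := rfl

theorem fourierCoeff_zero (ξ : UnitaryIrrep G) : fourierCoeff (0 : Distrib E G) ξ = 0 := rfl

theorem fourierCoeff_equiv (u : Distrib E G) {ξ η : UnitaryIrrep G}
    {T : Matrix (Fin η.dim) (Fin ξ.dim) ℂ} (hT : T * Tᴴ = 1)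
    (h : ∀ x, T * ξ.mat x = η.mat x * T) : fourierCoeff u η = T * fourierCoeff u ξ * Tᴴ := by
  ext i j
  have h1 : (η.smoothCoeff E j i).conj =
      ∑ l, ∑ k, (T i k * star (T j l)) • (ξ.smoothCoeff E l k).conj := by
    refine SmoothFn.ext fun x => ?_
    have h2 : (η.mat x)ᴴ = T * (ξ.mat x)ᴴ * Tᴴ := by
      have : η.mat x = T * ξ.mat x * Tᴴ := by rw [h, Matrix.mul_assoc, hT, Matrix.mul_one]
      rw [this]
      simp only [Matrix.conjTranspose_mul, Matrix.conjTranspose_conjTranspose, Matrix.mul_assoc]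
    have h3 : (η.smoothCoeff E j i).conj x = (η.mat x)ᴴ i j := rfl
    rw [h3, h2]
    simp only [Matrix.mul_apply, Matrix.conjTranspose_apply, SmoothFn.sum_apply,
      SmoothFn.smul_apply, SmoothFn.conj_apply, UnitaryIrrep.smoothCoeff_apply, Finset.sum_mul]
    refine Finset.sum_congr rfl fun l _ => Finset.sum_congr rfl fun k _ => ?_
    ring
  rw [fourierCoeff_apply, h1]
  simp only [map_sum, map_smul, Matrix.mul_apply, Matrix.conjTranspose_apply, fourierCoeff_apply,
    Finset.sum_mul, smul_eq_mul]
  refine Finset.sum_congr rfl fun l _ => Finset.sum_congr rfl fun k _ => ?_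
  ring

/-- A distribution is determined by its Fourier coefficients. -/
theorem distrib_ext_fourierCoeff {u v : Distrib E G}
    (h : ∀ c : UnitaryDual G, fourierCoeff u c.rep = fourierCoeff v c.rep) : u = v := by
  rw [← sub_eq_zero]
  refine distrib_eq_zero fun ξ i j => ?_
  obtain ⟨T, -, hT, hξ⟩ := UnitaryDual.rep_equiv ξ
  rw [← fourierCoeff_apply, fourierCoeff_equiv _ hT hξ, fourierCoeff_sub, h, sub_self]
  simp

/-- Two signs cancel: the one in the definition of `fieldDistrib` and the one from skewness of the
symbol. -/
theorem fourierCoeff_fieldDistrib (v : GroupLieAlgebra 𝓘(ℝ, E) G) (u : Distrib E G)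
    (ξ : UnitaryIrrep G) :
    fourierCoeff (fieldDistrib v u) ξ = fieldSymbol ξ v * fourierCoeff u ξ := by
  ext i j
  have h1 : fourierCoeff (fieldDistrib v u) ξ i j =
      -u (leftInvField v ((ξ.smoothCoeff E j i).conj)) := by
    rw [fourierCoeff_apply]
    rfl
  have h2 : leftInvField v ((ξ.smoothCoeff E j i).conj) =
      ∑ k, star (fieldSymbol ξ v k i) • (ξ.smoothCoeff E j k).conj := by
    rw [leftInvField_conj, (isLeftInvariant_leftInvField v).apply_smoothCoeff]
    refine SmoothFn.ext fun x => ?_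
    simp only [SmoothFn.conj_apply, SmoothFn.sum_apply, SmoothFn.smul_apply, star_sum, star_mul']
    rfl
  rw [h1, h2, map_sum, Matrix.mul_apply, ← Finset.sum_neg_distrib]
  refine Finset.sum_congr rfl fun k _ => ?_
  have h3 := congrFun (congrFun (conjTranspose_fieldSymbol ξ v) i) k
  rw [Matrix.conjTranspose_apply, Matrix.neg_apply] at h3
  rw [map_smul, h3, fourierCoeff_apply, smul_eq_mul, neg_mul, neg_neg]

variable [MeasurableSpace G] [BorelSpace G]
  (μ : Measure G) [μ.IsHaarMeasure] [IsProbabilityMeasure μ]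

/-- The distribution defined by a square integrable function. -/
def ofLp (f : Lp ℂ 2 μ) : Distrib E G where
  toFun φ := inner ℂ (toL2 μ φ.conj.toContinuousMap) f
  map_add' φ ψ := by
    rw [← inner_add_left, ← map_add]
    congr 2
    ext x
    exact map_add (starRingEnd ℂ) (φ x) (ψ x)
  map_smul' c φ := by
    have : toL2 μ (c • φ).conj.toContinuousMap =
        (starRingEnd ℂ c) • toL2 μ φ.conj.toContinuousMap := by
      rw [← map_smul]
      congr 1
      ext x
      exact map_mul (starRingEnd ℂ) c (φ x)
    rw [this, inner_smul_left, Complex.conj_conj]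
    rfl
  cont := ((toL2 μ).continuous.comp (continuous_toContinuousMap.comp
    SmoothFn.continuous_conj)).inner continuous_const

theorem ofLp_apply (f : Lp ℂ 2 μ) (φ : SmoothFn E G) : ofLp μ f φ = ∫ x, f x * φ x ∂μ := by
  change inner ℂ (toL2 μ φ.conj.toContinuousMap) f = _
  rw [inner_toL2]
  refine integral_congr_ae (ae_of_all _ fun x => ?_)
  change f x * star (star (φ x)) = f x * φ x
  rw [star_star]

theorem coeffBasis_repr (f : Lp ℂ 2 μ) (p : CoeffIndex G) :
    (coeffBasis μ E).repr f p =
      (√p.1.rep.dim : ℝ) * fourierCoeff (ofLp μ f : Distrib E G) p.1.rep p.2.2 p.2.1 := by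
  rw [coeffBasis_repr_apply, fourierCoeff_apply, ofLp_apply]
  rfl

theorem tsum_coeffIndex_ofReal (a : ∀ c : UnitaryDual G,
    Matrix (Fin c.rep.dim) (Fin c.rep.dim) ℂ) :
    ∑' p : CoeffIndex G, ENNReal.ofReal (‖((√p.1.rep.dim : ℝ) : ℂ) * a p.1 p.2.2 p.2.1‖ ^ 2) =
      ∑' c : UnitaryDual G, ENNReal.ofReal (c.rep.dim * hsSq (a c)) := by
  rw [ENNReal.tsum_sigma']
  refine tsum_congr fun c => ?_
  rw [tsum_fintype, ← ENNReal.ofReal_sum_of_nonneg fun _ _ => by positivity]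
  congr 1
  rw [Fintype.sum_prod_type, Finset.sum_comm, hsSq, Finset.mul_sum]
  refine Finset.sum_congr rfl fun i _ => ?_
  rw [Finset.mul_sum]
  refine Finset.sum_congr rfl fun j _ => ?_
  rw [norm_mul, mul_pow, Complex.norm_real, Real.norm_eq_abs, sq_abs,
    Real.sq_sqrt (Nat.cast_nonneg _)]

theorem tsum_hsSq_fourierCoeff_ofLp (f : Lp ℂ 2 μ) :
    ∑' c : UnitaryDual G, ENNReal.ofReal
      (c.rep.dim * hsSq (fourierCoeff (ofLp μ f : Distrib E G) c.rep)) = ‖f‖ₑ ^ 2 := by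
  rw [← tsum_coeffIndex_ofReal]
  have h1 : HasSum (fun p => ‖(coeffBasis μ E).repr f p‖ ^ 2) (‖f‖ ^ 2) := by
    have := lp.hasSum_norm (p := 2) (by norm_num) ((coeffBasis μ E).repr f)
    rw [LinearIsometryEquiv.norm_map] at this
    simpa using this
  have h2 := h1.tsum_eq
  simp only [coeffBasis_repr] at h1 h2
  rw [← ENNReal.ofReal_tsum_of_nonneg (fun _ => by positivity) h1.summable, h2,
    ENNReal.ofReal_pow (norm_nonneg _), ofReal_norm]

/-- Riesz–Fischer for the Hilbert basis `coeffBasis`. -/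
theorem exists_ofLp_fourierCoeff_eq (a : ∀ c : UnitaryDual G,
      Matrix (Fin c.rep.dim) (Fin c.rep.dim) ℂ)
    (h : ∑' c : UnitaryDual G, ENNReal.ofReal (c.rep.dim * hsSq (a c)) ≠ ⊤) :
    ∃ f : Lp ℂ 2 μ, ∀ c, fourierCoeff (ofLp μ f : Distrib E G) c.rep = a c := by
  rw [← tsum_coeffIndex_ofReal] at h
  let A : CoeffIndex G → ℂ := fun p => ((√p.1.rep.dim : ℝ) : ℂ) * a p.1 p.2.2 p.2.1
  have hs : Summable fun p => ‖A p‖ ^ 2 := by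
    have := ENNReal.summable_toReal h
    simpa [A, ENNReal.toReal_ofReal, sq_nonneg] using this
  have hA : Memℓp A 2 := memℓp_gen (by simpa using hs)
  let f := (coeffBasis μ E).repr.symm ⟨A, hA⟩
  refine ⟨f, fun c => ?_⟩
  ext i j
  have h1 := coeffBasis_repr (E := E) μ f ⟨c, j, i⟩
  have h2 : (coeffBasis μ E).repr f = ⟨A, hA⟩ := LinearIsometryEquiv.apply_symm_apply _ _
  rw [h2] at h1
  have h0 : ((√c.rep.dim : ℝ) : ℂ) ≠ 0 := by
    have : (0 : ℝ) < c.rep.dim := by exact_mod_cast c.rep.dim_pos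
    exact_mod_cast (Real.sqrt_pos.2 this).ne'
  exact (mul_left_cancel₀ h0 h1).symm

/-- The Plancherel formula for distributions. -/
theorem l2Norm_eq (u : Distrib E G) :
    l2Norm μ u = (∑' c : UnitaryDual G, ENNReal.ofReal
      (c.rep.dim * hsSq (fourierCoeff u c.rep))) ^ (1 / 2 : ℝ) := by
  have key : ∀ f : Lp ℂ 2 μ, ‖f‖ₑ = (∑' c : UnitaryDual G, ENNReal.ofReal
      (c.rep.dim * hsSq (fourierCoeff (ofLp μ f : Distrib E G) c.rep))) ^ (1 / 2 : ℝ) := by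
    intro f
    rw [tsum_hsSq_fourierCoeff_ofLp, ← ENNReal.rpow_natCast, ← ENNReal.rpow_mul]
    norm_num
  -- If the sum is finite, Riesz–Fischer gives a function with the same Fourier coefficients, which
  -- represents `u` by uniqueness. Conversely any `f` competing in the infimum represents `u` and so
  -- has exactly this norm.
  refine le_antisymm ?_ (le_iInf₂ fun f hf => ?_)
  · by_cases h : ∑' c : UnitaryDual G, ENNReal.ofReal
      (c.rep.dim * hsSq (fourierCoeff u c.rep)) = ⊤
    · rw [h]
      simp
    · obtain ⟨f, hf⟩ := exists_ofLp_fourierCoeff_eq (E := E) μ (fun c => fourierCoeff u c.rep) h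
      have hu : ofLp μ f = u := distrib_ext_fourierCoeff hf
      rw [← hu, ← key]
      exact iInf₂_le f fun φ => ofLp_apply μ f φ
  · have hu : u = ofLp μ f := by
      ext φ
      rw [hf, ofLp_apply]
    rw [key, ← hu]

variable {g : Bundle.ContMDiffRiemannianMetric 𝓘(ℝ, E) ∞ E (fun x : G => TangentSpace 𝓘(ℝ, E) x)}
  {n : ℕ} {X : Module.Basis (Fin n) ℝ (GroupLieAlgebra 𝓘(ℝ, E) G)}

/-- The left side is the trace of `Aᴴ (∑ σᴴ σ) A`, and the inner sum is the scalar `ν_ξ`. -/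
theorem sum_hsSq_fieldSymbol_mul (hg : IsBiInvariant g)
    (hX : ∀ i j, g.inner 1 (X i) (X j) = if i = j then 1 else 0) (ξ : UnitaryIrrep G)
    (A : Matrix (Fin ξ.dim) (Fin ξ.dim) ℂ) :
    ∑ j, hsSq (fieldSymbol ξ (X j) * A) = nu X ξ * hsSq A := by
  have h : ((∑ j, hsSq (fieldSymbol ξ (X j) * A) : ℝ) : ℂ) = ((nu X ξ * hsSq A : ℝ) : ℂ) := by
    push_cast
    simp only [ofReal_hsSq_eq_trace]
    rw [← Matrix.trace_sum]
    have : ∑ j, (fieldSymbol ξ (X j) * A)ᴴ * (fieldSymbol ξ (X j) * A) =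
        Aᴴ * (∑ j, (fieldSymbol ξ (X j))ᴴ * fieldSymbol ξ (X j)) * A := by
      rw [Finset.mul_sum, Finset.sum_mul]
      simp only [Matrix.conjTranspose_mul, Matrix.mul_assoc]
    rw [this, sum_conjTranspose_mul_fieldSymbol hg hX]
    simp
  exact_mod_cast h

theorem gradNorm_eq (hg : IsBiInvariant g)
    (hX : ∀ i j, g.inner 1 (X i) (X j) = if i = j then 1 else 0) (u : Distrib E G) :
    gradNorm μ X u = (∑' c : UnitaryDual G, ENNReal.ofReal
      (c.rep.dim * (nu X c.rep * hsSq (fourierCoeff u c.rep)))) ^ (1 / 2 : ℝ) := by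
  rw [gradNorm]
  congr 1
  have h1 : ∀ j, l2Norm μ (fieldDistrib (X j) u) ^ 2 = ∑' c : UnitaryDual G, ENNReal.ofReal
      (c.rep.dim * hsSq (fieldSymbol c.rep (X j) * fourierCoeff u c.rep)) := by
    intro j
    rw [l2Norm_eq, ← ENNReal.rpow_natCast, ← ENNReal.rpow_mul]
    norm_num
    simp only [fourierCoeff_fieldDistrib]
  simp only [h1]
  rw [← Summable.tsum_finsetSum fun _ _ => ENNReal.summable]
  refine tsum_congr fun c => ?_
  rw [← ENNReal.ofReal_sum_of_nonneg fun _ _ => mul_nonneg (Nat.cast_nonneg _) (hsSq_nonneg _),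
    ← Finset.mul_sum, sum_hsSq_fieldSymbol_mul hg hX]

end Distributions

/-! ### Sobolev spaces and extension of invariant operators -/

section Sobolev

variable {E : Type*} [NormedAddCommGroup E] [NormedSpace ℝ E] [FiniteDimensional ℝ E]
  {G : Type*} [TopologicalSpace G] [T2Space G] [CompactSpace G]
  [ChartedSpace E G] [Group G] [LieGroup 𝓘(ℝ, E) ∞ G] [IsTopologicalGroup G]

theorem continuousLinearMap_ext_rep {F : Type*} [AddCommGroup F] [Module ℂ F] [TopologicalSpace F]
    [T2Space F] {A B : SmoothFn E G →L[ℂ] F}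
    (h : ∀ (c : UnitaryDual G) i j, A (c.rep.smoothCoeff E i j) = B (c.rep.smoothCoeff E i j)) :
    A = B := by
  have key : ∀ (ξ : UnitaryIrrep G) i j, A (ξ.smoothCoeff E i j) = B (ξ.smoothCoeff E i j) := by
    intro ξ i j
    obtain ⟨T, -, hT, hξ⟩ := UnitaryDual.rep_equiv ξ
    have h1 : ξ.smoothCoeff E i j =
        ∑ l, ∑ k, (T i k * star (T j l)) • (UnitaryDual.mk ξ).rep.smoothCoeff E k l := by
      refine SmoothFn.ext fun x => ?_
      have := congrArg (fun f : C(G, ℂ) => f x) (UnitaryIrrep.coeff_equiv hT hξ i j)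
      simp only [ContinuousMap.coe_sum, Finset.sum_apply, ContinuousMap.coe_smul,
        Pi.smul_apply, UnitaryIrrep.coeff_apply, smul_eq_mul] at this
      simpa only [SmoothFn.sum_apply, SmoothFn.smul_apply,
        UnitaryIrrep.smoothCoeff_apply] using this
    rw [h1]
    simp only [map_sum, map_smul, h]
  exact ContinuousLinearMap.coe_injective
    (continuousLinearMap_ext_smoothCoeff A.continuous B.continuous key)

variable {g : Bundle.ContMDiffRiemannianMetric 𝓘(ℝ, E) ∞ E (fun x : G => TangentSpace 𝓘(ℝ, E) x)}
  {n : ℕ} {X : Module.Basis (Fin n) ℝ (GroupLieAlgebra 𝓘(ℝ, E) G)}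

/-- The operator `1 + ℒ` on distributions. -/
def onePlusLaplacian (X : Fin n → GroupLieAlgebra 𝓘(ℝ, E) G) (u : Distrib E G) : Distrib E G :=
  u - ∑ j, fieldDistrib (X j) (fieldDistrib (X j) u)

theorem fourierCoeff_onePlusLaplacian (hg : IsBiInvariant g)
    (hX : ∀ i j, g.inner 1 (X i) (X j) = if i = j then 1 else 0) (u : Distrib E G)
    (ξ : UnitaryIrrep G) :
    fourierCoeff (onePlusLaplacian X u) ξ = ((1 + nu X ξ : ℝ) : ℂ) • fourierCoeff u ξ := by
  have h1 : fourierCoeff (∑ j, fieldDistrib (X j) (fieldDistrib (X j) u)) ξ =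
      ∑ j, fourierCoeff (fieldDistrib (X j) (fieldDistrib (X j) u)) ξ := by
    ext i k
    rw [Matrix.sum_apply]
    simp only [fourierCoeff_apply]
    exact sum_apply _ _ _
  have h2 : ∑ j, fieldSymbol ξ (X j) * fieldSymbol ξ (X j) = -((nu X ξ : ℂ) • 1) := by
    rw [← sum_conjTranspose_mul_fieldSymbol hg hX ξ, ← Finset.sum_neg_distrib]
    refine Finset.sum_congr rfl fun j _ => ?_
    rw [conjTranspose_fieldSymbol, neg_mul, neg_neg]
  rw [onePlusLaplacian, fourierCoeff_sub, h1]
  simp only [fourierCoeff_fieldDistrib, ← Matrix.mul_assoc]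
  rw [← Finset.sum_mul, h2]
  push_cast
  rw [add_smul, one_smul, neg_mul, sub_neg_eq_add, smul_mul_assoc, Matrix.one_mul]

theorem one_le_japaneseBracket (hg : IsBiInvariant g)
    (hX : ∀ i j, g.inner 1 (X i) (X j) = if i = j then 1 else 0) (ξ : UnitaryIrrep G) :
    1 ≤ japaneseBracket X ξ :=
  Real.one_le_sqrt.2 (by linarith [nu_nonneg hg hX ξ])

theorem japaneseBracket_sq (hg : IsBiInvariant g)
    (hX : ∀ i j, g.inner 1 (X i) (X j) = if i = j then 1 else 0) (ξ : UnitaryIrrep G) :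
    japaneseBracket X ξ ^ 2 = 1 + nu X ξ :=
  Real.sq_sqrt (by linarith [nu_nonneg hg hX ξ])

theorem japaneseBracket_pos (hg : IsBiInvariant g)
    (hX : ∀ i j, g.inner 1 (X i) (X j) = if i = j then 1 else 0) (ξ : UnitaryIrrep G) :
    0 < japaneseBracket X ξ :=
  zero_lt_one.trans_le (one_le_japaneseBracket hg hX ξ)

theorem hsSq_smul {d : ℕ} (z : ℂ) (A : Matrix (Fin d) (Fin d) ℂ) :
    hsSq (z • A) = ‖z‖ ^ 2 * hsSq A := by
  simp only [hsSq, Matrix.smul_apply, smul_eq_mul, norm_mul, mul_pow, Finset.mul_sum]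

theorem norm_apply_sq_le_hsSq {d : ℕ} (A : Matrix (Fin d) (Fin d) ℂ) (i j : Fin d) :
    ‖A i j‖ ^ 2 ≤ hsSq A :=
  (Finset.single_le_sum (f := fun j => ‖A i j‖ ^ 2) (fun _ _ => by positivity)
    (Finset.mem_univ j)).trans
    (Finset.single_le_sum (f := fun i => ∑ j, ‖A i j‖ ^ 2)
      (fun _ _ => Finset.sum_nonneg fun _ _ => by positivity) (Finset.mem_univ i))

theorem hsSq_zero {d : ℕ} : hsSq (0 : Matrix (Fin d) (Fin d) ℂ) = 0 := by simp [hsSq]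

theorem sobolevNorm_sq (s : ℝ) (u : Distrib E G) :
    sobolevNorm X s u ^ 2 = ∑' c : UnitaryDual G, ENNReal.ofReal
      (c.rep.dim * japaneseBracket X c.rep ^ (2 * s) * hsSq (fourierCoeff u c.rep)) := by
  rw [sobolevNorm, ← ENNReal.rpow_natCast, ← ENNReal.rpow_mul]
  norm_num

theorem memSobolev_iff (s : ℝ) (u : Distrib E G) :
    MemSobolev X s u ↔ ∑' c : UnitaryDual G, ENNReal.ofReal
      (c.rep.dim * japaneseBracket X c.rep ^ (2 * s) * hsSq (fourierCoeff u c.rep)) ≠ ⊤ := by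
  rw [← sobolevNorm_sq, MemSobolev, lt_top_iff_ne_top, ne_eq, ne_eq, ENNReal.pow_eq_top_iff]
  simp

variable [MeasurableSpace G] [BorelSpace G]
  (μ : Measure G) [μ.IsHaarMeasure] [IsProbabilityMeasure μ]

/-- Every square summable family of matrices, for some power weight, consists of the Fourier
coefficients of a distribution. -/
theorem exists_fourierCoeff_eq (μ : Measure G) [μ.IsHaarMeasure] [IsProbabilityMeasure μ]
    (hg : IsBiInvariant g)
    (hX : ∀ i j, g.inner 1 (X i) (X j) = if i = j then 1 else 0) (s : ℝ)
    (a : ∀ c : UnitaryDual G, Matrix (Fin c.rep.dim) (Fin c.rep.dim) ℂ)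
    (h : ∑' c : UnitaryDual G, ENNReal.ofReal
      (c.rep.dim * japaneseBracket X c.rep ^ (2 * s) * hsSq (a c)) ≠ ⊤) :
    ∃ u : Distrib E G, ∀ c, fourierCoeff u c.rep = a c := by
  -- Dividing by `(1 + ν)^N = ⟨ξ⟩^(2N)` makes the family square summable, since `-4N ≤ 2s`. The
  -- distribution is `(1 + ℒ)^N` applied to the resulting `L²` function.
  obtain ⟨N, hN⟩ := exists_nat_ge (-s)
  let b : ∀ c : UnitaryDual G, Matrix (Fin c.rep.dim) (Fin c.rep.dim) ℂ := fun c =>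
    (((1 + nu X c.rep : ℝ) : ℂ) ^ N)⁻¹ • a c
  have hb : ∑' c : UnitaryDual G, ENNReal.ofReal (c.rep.dim * hsSq (b c)) ≠ ⊤ := by
    refine ne_top_of_le_ne_top h (ENNReal.tsum_le_tsum fun c => ENNReal.ofReal_le_ofReal ?_)
    rw [hsSq_smul, mul_assoc]
    refine mul_le_mul_of_nonneg_left (mul_le_mul_of_nonneg_right ?_ (hsSq_nonneg _))
      (Nat.cast_nonneg _)
    have h1 := one_le_japaneseBracket hg hX c.rep
    have h0 := japaneseBracket_pos hg hX c.rep
    rw [← japaneseBracket_sq hg hX, norm_inv, norm_pow, Complex.norm_real, Real.norm_eq_abs,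
      abs_of_nonneg (by positivity)]
    rw [← pow_mul, ← inv_pow, ← pow_mul, ← Real.rpow_natCast, Real.inv_rpow h0.le,
      ← Real.rpow_neg h0.le]
    refine Real.rpow_le_rpow_of_exponent_le h1 ?_
    push_cast
    nlinarith [N.cast_nonneg (α := ℝ)]
  obtain ⟨f, hf⟩ := exists_ofLp_fourierCoeff_eq (E := E) μ b hb
  refine ⟨(onePlusLaplacian X)^[N] (ofLp μ f), fun c => ?_⟩
  have hit : ∀ k : ℕ, fourierCoeff ((onePlusLaplacian X)^[k] (ofLp μ f)) c.rep =
      ((1 + nu X c.rep : ℝ) : ℂ) ^ k • b c := by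
    intro k
    induction k with
    | zero => simpa using hf c
    | succ k ih =>
      rw [Function.iterate_succ_apply', fourierCoeff_onePlusLaplacian hg hX, ih, smul_smul,
        pow_succ']
  rw [hit, smul_smul, mul_inv_cancel₀, one_smul]
  have : (1 + nu X c.rep : ℝ) ≠ 0 := by linarith [nu_nonneg hg hX c.rep]
  exact pow_ne_zero _ (by exact_mod_cast this)

theorem fourierCoeff_ofSmooth_apply (f : SmoothFn E G) (ξ : UnitaryIrrep G) (i j : Fin ξ.dim) :
    fourierCoeff (ofSmooth μ f) ξ i j = ∫ x, f x * star (ξ.mat x j i) ∂μ := by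
  rw [fourierCoeff_apply]
  rfl

/-- A Fourier coefficient of a smooth function, as a continuous linear functional. -/
def smoothFourier (ξ : UnitaryIrrep G) (i j : Fin ξ.dim) : SmoothFn E G →L[ℂ] ℂ :=
  ofSmooth μ ((ξ.smoothCoeff E j i).conj)

theorem smoothFourier_apply (ξ : UnitaryIrrep G) (i j : Fin ξ.dim) (f : SmoothFn E G) :
    smoothFourier μ ξ i j f = fourierCoeff (ofSmooth μ f) ξ i j := by
  rw [fourierCoeff_ofSmooth_apply]
  refine integral_congr_ae (ae_of_all _ fun x => ?_)
  exact mul_comm _ _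

theorem smoothFourier_smoothCoeff_self (ξ : UnitaryIrrep G) (i j a b : Fin ξ.dim) :
    smoothFourier μ ξ i j (ξ.smoothCoeff E a b) = if a = j ∧ b = i then (ξ.dim : ℂ)⁻¹ else 0 := by
  rw [smoothFourier_apply, fourierCoeff_ofSmooth_apply]
  exact UnitaryIrrep.integral_coeff_mul_star ξ μ a b j i

theorem smoothFourier_smoothCoeff_of_not_equiv {ξ η : UnitaryIrrep G}
    (h : ¬ (unitaryIrrepSetoid G).r ξ η) (i j : Fin ξ.dim) (a b : Fin η.dim) :
    smoothFourier μ ξ i j (η.smoothCoeff E a b) = 0 := by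
  rw [smoothFourier_apply, fourierCoeff_ofSmooth_apply]
  exact UnitaryIrrep.integral_coeff_eq_zero ξ η μ h a b j i

/-- For fixed entries both sides are continuous functionals of `f`, so it is enough to compare them
on matrix coefficients, where Schur orthogonality decides. -/
theorem fourierCoeff_ofSmooth_map (P : SmoothFn E G →L[ℂ] SmoothFn E G)
    (hP : IsLeftInvariant (P : SmoothFn E G →ₗ[ℂ] SmoothFn E G)) (f : SmoothFn E G)
    (c : UnitaryDual G) :
    fourierCoeff (ofSmooth μ (P f)) c.rep =
      symbol (P : SmoothFn E G →ₗ[ℂ] SmoothFn E G) c.rep * fourierCoeff (ofSmooth μ f) c.rep := by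
  ext i j
  let σ := symbol (P : SmoothFn E G →ₗ[ℂ] SmoothFn E G) c.rep
  have key : (smoothFourier μ c.rep i j).comp P =
      ∑ k, σ i k • (smoothFourier μ c.rep k j : SmoothFn E G →L[ℂ] ℂ) := by
    refine continuousLinearMap_ext_rep fun c' a b => ?_
    have h1 : P (c'.rep.smoothCoeff E a b) = _ := hP.apply_smoothCoeff c'.rep a b
    rw [ContinuousLinearMap.comp_apply, h1, map_sum, sum_apply]
    simp only [map_smul, smul_apply, smul_eq_mul]
    by_cases hc : c = c'
    · subst hc
      simp only [smoothFourier_smoothCoeff_self]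
      by_cases ha : a = j
      · simp [ha, σ]
      · simp [ha]
    · simp only [smoothFourier_smoothCoeff_of_not_equiv μ (UnitaryDual.not_rep_equiv hc), mul_zero,
        Finset.sum_const_zero]
  have := congrArg (fun L : SmoothFn E G →L[ℂ] ℂ => L f) key
  simp only [ContinuousLinearMap.comp_apply, sum_apply, smul_apply, smoothFourier_apply,
    smul_eq_mul] at this
  rw [this, Matrix.mul_apply]

/-- The trigonometric polynomial with Fourier coefficients `a c` for `c ∈ S`, and zero
otherwise. -/
def trigSum (S : Finset (UnitaryDual G))
    (a : ∀ c : UnitaryDual G, Matrix (Fin c.rep.dim) (Fin c.rep.dim) ℂ) : SmoothFn E G :=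
  ∑ c ∈ S, ∑ i, ∑ j, ((c.rep.dim : ℂ) * a c i j) • c.rep.smoothCoeff E j i

open scoped Classical in
theorem fourierCoeff_trigSum (S : Finset (UnitaryDual G))
    (a : ∀ c : UnitaryDual G, Matrix (Fin c.rep.dim) (Fin c.rep.dim) ℂ) (c : UnitaryDual G) :
    fourierCoeff (ofSmooth μ (trigSum S a : SmoothFn E G)) c.rep = if c ∈ S then a c else 0 := by
  ext k l
  rw [← smoothFourier_apply, trigSum]
  simp only [map_sum, map_smul, smul_eq_mul]
  have hne : ∀ c' ∈ S, c' ≠ c → ∑ i, ∑ j, (c'.rep.dim : ℂ) * a c' i j *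
      smoothFourier μ c.rep k l (c'.rep.smoothCoeff E j i) = 0 := by
    intro c' _ hc
    refine Finset.sum_eq_zero fun i _ => Finset.sum_eq_zero fun j _ => ?_
    rw [smoothFourier_smoothCoeff_of_not_equiv μ (UnitaryDual.not_rep_equiv hc.symm), mul_zero]
  have hd0 : (c.rep.dim : ℂ) ≠ 0 := by exact_mod_cast NeZero.ne c.rep.dim
  have hself : ∑ i, ∑ j, (c.rep.dim : ℂ) * a c i j *
      smoothFourier μ c.rep k l (c.rep.smoothCoeff E j i) = a c k l := by
    rw [Finset.sum_eq_single k, Finset.sum_eq_single l]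
    · rw [smoothFourier_smoothCoeff_self, if_pos ⟨rfl, rfl⟩]
      field_simp
    · intro j _ hj
      rw [smoothFourier_smoothCoeff_self, if_neg fun h => hj h.1, mul_zero]
    · simp
    · intro i _ hi
      refine Finset.sum_eq_zero fun j _ => ?_
      rw [smoothFourier_smoothCoeff_self, if_neg fun h => hi h.2, mul_zero]
    · simp
  by_cases hc : c ∈ S
  · rw [if_pos hc, Finset.sum_eq_single_of_mem c hc hne, hself]
  · rw [if_neg hc]
    exact Finset.sum_eq_zero fun c' hc' => hne c' hc' fun h => hc (h ▸ hc')

open scoped Classical in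
/-- The trigonometric polynomial with Fourier coefficient `A` at `c`, and zero otherwise. -/
def trigSingle (c : UnitaryDual G) (A : Matrix (Fin c.rep.dim) (Fin c.rep.dim) ℂ) :
    SmoothFn E G :=
  trigSum {c} fun c' => if h : c = c' then h ▸ A else 0

theorem fourierCoeff_trigSingle_self (c : UnitaryDual G)
    (A : Matrix (Fin c.rep.dim) (Fin c.rep.dim) ℂ) :
    fourierCoeff (ofSmooth μ (trigSingle c A : SmoothFn E G)) c.rep = A := by
  rw [trigSingle, fourierCoeff_trigSum]
  simp

theorem fourierCoeff_trigSingle_of_ne {c c' : UnitaryDual G} (h : c' ≠ c)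
    (A : Matrix (Fin c.rep.dim) (Fin c.rep.dim) ℂ) :
    fourierCoeff (ofSmooth μ (trigSingle c A : SmoothFn E G)) c'.rep = 0 := by
  rw [trigSingle, fourierCoeff_trigSum, if_neg (by simpa using h)]

/-- Testing the order estimate on functions supported at one frequency turns it into a bound on each
block of the symbol. -/
theorem HasOrder.ofReal_hsSq_le {P : SmoothFn E G →L[ℂ] SmoothFn E G} {m : ℝ}
    (hP : IsLeftInvariant (P : SmoothFn E G →ₗ[ℂ] SmoothFn E G))
    (hm : HasOrder μ X (P : SmoothFn E G →ₗ[ℂ] SmoothFn E G) m) (s : ℝ) :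
    ∃ K : ℝ≥0, ∀ (c : UnitaryDual G) (A : Matrix (Fin c.rep.dim) (Fin c.rep.dim) ℂ),
      ENNReal.ofReal (c.rep.dim * japaneseBracket X c.rep ^ (2 * s) *
        hsSq (symbol (P : SmoothFn E G →ₗ[ℂ] SmoothFn E G) c.rep * A)) ≤
      K * ENNReal.ofReal (c.rep.dim * japaneseBracket X c.rep ^ (2 * (m + s)) * hsSq A) := by
  obtain ⟨K, hK⟩ := hm s
  refine ⟨K ^ 2, fun c A => ?_⟩
  have h1 := pow_le_pow_left' (hK (trigSingle c A)) 2
  rw [mul_pow, sobolevNorm_sq, sobolevNorm_sq, tsum_eq_single c, tsum_eq_single c] at h1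
  · simp only [ContinuousLinearMap.coe_coe, fourierCoeff_ofSmooth_map μ P hP,
      fourierCoeff_trigSingle_self] at h1
    exact_mod_cast h1
  · intro c' hc'
    rw [fourierCoeff_trigSingle_of_ne μ hc', hsSq_zero]
    simp
  · intro c' hc'
    rw [ContinuousLinearMap.coe_coe, fourierCoeff_ofSmooth_map μ P hP,
      fourierCoeff_trigSingle_of_ne μ hc', Matrix.mul_zero, hsSq_zero]
    simp

theorem tendsto_fourierCoeff (hg : IsBiInvariant g)
    (hX : ∀ i j, g.inner 1 (X i) (X j) = if i = j then 1 else 0) {s : ℝ} {u : ℕ → Distrib E G}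
    {v : Distrib E G} (h : Tendsto (fun k => sobolevNorm X s (u k - v)) atTop (𝓝 0))
    (c : UnitaryDual G) :
    Tendsto (fun k => fourierCoeff (u k) c.rep) atTop (𝓝 (fourierCoeff v c.rep)) := by
  refine tendsto_pi_nhds.2 fun i => tendsto_pi_nhds.2 fun j => ?_
  rw [tendsto_iff_norm_sub_tendsto_zero]
  let w : ℝ := c.rep.dim * japaneseBracket X c.rep ^ (2 * s)
  have hw : 0 < w := mul_pos (by exact_mod_cast c.rep.dim_pos)
    (Real.rpow_pos_of_pos (japaneseBracket_pos hg hX _) _)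
  have h1 : Tendsto (fun k => ENNReal.ofReal (w * hsSq (fourierCoeff (u k - v) c.rep))) atTop
      (𝓝 0) := by
    have h2 : Tendsto (fun k => sobolevNorm X s (u k - v) ^ 2) atTop (𝓝 0) := by
      simpa using ENNReal.Tendsto.pow (n := 2) h
    refine tendsto_of_tendsto_of_tendsto_of_le_of_le tendsto_const_nhds h2
      (fun _ => zero_le) fun k => ?_
    simp only [sobolevNorm_sq]
    exact ENNReal.le_tsum c
  have h2 : Tendsto (fun k => w * hsSq (fourierCoeff (u k - v) c.rep)) atTop (𝓝 0) := by
    have := (ENNReal.tendsto_toReal ENNReal.zero_ne_top).comp h1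
    refine Tendsto.congr (fun k => ?_) this
    exact ENNReal.toReal_ofReal (mul_nonneg hw.le (hsSq_nonneg _))
  have h3 : Tendsto (fun k => √(w⁻¹ * (w * hsSq (fourierCoeff (u k - v) c.rep)))) atTop (𝓝 0) := by
    have := (h2.const_mul w⁻¹).sqrt
    simpa using this
  refine squeeze_zero (fun _ => norm_nonneg _) (fun k => ?_) h3
  refine Real.le_sqrt_of_sq_le ?_
  rw [inv_mul_cancel_left₀ hw.ne']
  exact norm_apply_sq_le_hsSq (fourierCoeff (u k - v) c.rep) i j

/-- The blocks `σ * û` satisfy the `H^(1-m)` bound and so define `v`. Fourier truncations of `u` to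
finite sets with small tails approximate `u`, and the blockwise bound makes their images approximate
`v`. -/
theorem isExtensionValue_exists (hg : IsBiInvariant g)
    (hX : ∀ i j, g.inner 1 (X i) (X j) = if i = j then 1 else 0)
    {P : SmoothFn E G →L[ℂ] SmoothFn E G} {m : ℝ}
    (hP : IsLeftInvariant (P : SmoothFn E G →ₗ[ℂ] SmoothFn E G))
    (hm : HasOrder μ X (P : SmoothFn E G →ₗ[ℂ] SmoothFn E G) m) {u : Distrib E G}
    (hu : MemSobolev X 1 u) : ∃ v, IsExtensionValue μ X P 1 (1 - m) u v := by
  classical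
  obtain ⟨K, hK⟩ := hm.ofReal_hsSq_le μ hP (1 - m)
  rw [add_sub_cancel] at hK
  let σ := fun c : UnitaryDual G => symbol (P : SmoothFn E G →ₗ[ℂ] SmoothFn E G) c.rep
  have hfin := (memSobolev_iff 1 u).1 hu
  obtain ⟨v, hv⟩ := exists_fourierCoeff_eq μ hg hX (1 - m)
      (fun c => σ c * fourierCoeff u c.rep) (by
    refine ne_top_of_le_ne_top ?_ (ENNReal.tsum_le_tsum fun c => hK c _)
    rw [ENNReal.tsum_mul_left]
    exact ENNReal.mul_ne_top ENNReal.coe_ne_top hfin)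
  have htail := ENNReal.tendsto_tsum_compl_atTop_zero hfin
  have hS : ∀ k : ℕ, ∃ S : Finset (UnitaryDual G), ∑' c : { c // c ∉ S }, ENNReal.ofReal
      ((c : UnitaryDual G).rep.dim * japaneseBracket X (c : UnitaryDual G).rep ^ (2 * (1 : ℝ)) *
        hsSq (fourierCoeff u (c : UnitaryDual G).rep)) < ((k : ℝ≥0∞) + 1)⁻¹ := fun k =>
    (htail.eventually_lt_const (by simp)).exists
  choose S hS using hS
  let f : ℕ → SmoothFn E G := fun k => trigSum (S k) fun c => fourierCoeff u c.rep
  have hf : ∀ k c, fourierCoeff (ofSmooth μ (f k) - u) c.rep =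
      if c ∈ S k then 0 else -fourierCoeff u c.rep := by
    intro k c
    rw [fourierCoeff_sub, fourierCoeff_trigSum]
    split_ifs <;> simp
  have hlim : Tendsto (fun k => sobolevNorm X 1 (ofSmooth μ (f k) - u) ^ 2) atTop (𝓝 0) := by
    have hinv : Tendsto (fun k : ℕ => ((k : ℝ≥0∞) + 1)⁻¹) atTop (𝓝 0) := by
      have := ENNReal.tendsto_inv_nat_nhds_zero.comp (tendsto_add_atTop_nat 1)
      refine this.congr fun k => ?_
      simp
    refine tendsto_of_tendsto_of_tendsto_of_le_of_le tendsto_const_nhds hinv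
      (fun _ => zero_le) fun k => ?_
    refine le_trans (le_of_eq ?_) (hS k).le
    rw [sobolevNorm_sq]
    rw [← tsum_subtype_eq_of_support_subset (s := {c | c ∉ S k})]
    · refine tsum_congr fun c => ?_
      have hc : (c : UnitaryDual G) ∉ S k := c.2
      rw [hf, if_neg hc, ← neg_one_smul ℂ, hsSq_smul]
      simp
    · intro c hc
      rw [Function.mem_support, hf] at hc
      intro hcS
      rw [if_pos hcS, hsSq_zero] at hc
      simp at hc
  refine ⟨v, f, ?_, ?_⟩
  · have := hlim.ennrpow_const (1 / 2)
    refine Tendsto.congr (fun k => ?_) (by simpa using this)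
    rw [← ENNReal.rpow_natCast, ← ENNReal.rpow_mul]
    norm_num
  · have hle : ∀ k, sobolevNorm X (1 - m) (ofSmooth μ (P (f k)) - v) ^ 2 ≤
        K * sobolevNorm X 1 (ofSmooth μ (f k) - u) ^ 2 := by
      intro k
      rw [sobolevNorm_sq, sobolevNorm_sq, ← ENNReal.tsum_mul_left]
      refine ENNReal.tsum_le_tsum fun c => ?_
      have : fourierCoeff (ofSmooth μ (P (f k)) - v) c.rep =
          σ c * fourierCoeff (ofSmooth μ (f k) - u) c.rep := by
        rw [fourierCoeff_sub, fourierCoeff_sub, fourierCoeff_ofSmooth_map μ P hP, hv,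
          Matrix.mul_sub]
      rw [this]
      exact hK c _
    have h0 : Tendsto (fun k => (K : ℝ≥0∞) * sobolevNorm X 1 (ofSmooth μ (f k) - u) ^ 2) atTop
        (𝓝 0) := by
      simpa using ENNReal.Tendsto.const_mul hlim (Or.inr (ENNReal.coe_ne_top (r := K)))
    have := (tendsto_of_tendsto_of_tendsto_of_le_of_le tendsto_const_nhds h0
      (fun _ => zero_le) hle).ennrpow_const (1 / 2)
    refine Tendsto.congr (fun k => ?_) (by simpa using this)
    rw [← ENNReal.rpow_natCast, ← ENNReal.rpow_mul]
    norm_num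

/-- Whatever value the choice in `extendH1` picks, its coefficients are forced: Sobolev convergence
implies convergence in every block. -/
theorem fourierCoeff_extendH1 (hg : IsBiInvariant g)
    (hX : ∀ i j, g.inner 1 (X i) (X j) = if i = j then 1 else 0)
    {P : SmoothFn E G →L[ℂ] SmoothFn E G} {m : ℝ}
    (hP : IsLeftInvariant (P : SmoothFn E G →ₗ[ℂ] SmoothFn E G))
    (hm : HasOrder μ X (P : SmoothFn E G →ₗ[ℂ] SmoothFn E G) m) {u : Distrib E G}
    (hu : MemSobolev X 1 u) (c : UnitaryDual G) :
    fourierCoeff (extendH1 μ X P m u) c.rep =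
      symbol (P : SmoothFn E G →ₗ[ℂ] SmoothFn E G) c.rep * fourierCoeff u c.rep := by
  obtain ⟨f, h1, h2⟩ := Classical.epsilon_spec (isExtensionValue_exists μ hg hX hP hm hu)
  have h3 := tendsto_fourierCoeff hg hX h1 c
  have h4 := tendsto_fourierCoeff hg hX h2 c
  refine tendsto_nhds_unique h4 ?_
  simp only [ContinuousLinearMap.coe_coe, fourierCoeff_ofSmooth_map μ P hP]
  exact h3.const_mul _

end Sobolev

/-! ### The smallest non-zero singular value -/

section SingularValues

variable {d : ℕ}

theorem minPosSingularValue_mem {A : Matrix (Fin d) (Fin d) ℂ} (hA : A ≠ 0) :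
    minPosSingularValue A ∈
      {s : ℝ | s ≠ 0 ∧ ∃ i : ℕ, i < d ∧ s = (Matrix.toEuclideanLin A).singularValues i} := by
  let T := Matrix.toEuclideanLin A
  refine Set.Nonempty.csInf_mem ?_ ?_
  · have hT : T.singularValues ≠ 0 := by
      rw [ne_eq, LinearMap.singularValues_eq_zero_iff]
      simpa [T] using hA
    obtain ⟨i, hi⟩ := Finsupp.ne_iff.1 hT
    -- The sequence of singular values is zero from index `d` on, so a non-zero one has `i < d`.
    refine ⟨T.singularValues i, hi, i, ?_, rfl⟩
    by_contra h
    exact hi (T.singularValues_of_finrank_le (by simpa using h))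
  · refine (Set.finite_range fun i : Fin d => T.singularValues i).subset ?_
    rintro _ ⟨-, i, hi, rfl⟩
    exact ⟨⟨i, hi⟩, rfl⟩

theorem minPosSingularValue_pos {A : Matrix (Fin d) (Fin d) ℂ} (hA : A ≠ 0) :
    0 < minPosSingularValue A := by
  obtain ⟨h0, i, -, h⟩ := minPosSingularValue_mem hA
  refine lt_of_le_of_ne ?_ h0.symm
  rw [h]
  exact LinearMap.singularValues_nonneg _ i

theorem minPosSingularValue_le (A : Matrix (Fin d) (Fin d) ℂ) {i : ℕ} (hi : i < d)
    (h : (Matrix.toEuclideanLin A).singularValues i ≠ 0) :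
    minPosSingularValue A ≤ (Matrix.toEuclideanLin A).singularValues i := by
  refine csInf_le ⟨0, ?_⟩ ⟨h, i, hi, rfl⟩
  rintro _ ⟨-, j, -, rfl⟩
  exact LinearMap.singularValues_nonneg _ j

theorem exists_adjoint_comp_self_eq {A : Matrix (Fin d) (Fin d) ℂ} (hA : A ≠ 0) :
    ∃ v : EuclideanSpace ℂ (Fin d), ‖v‖ = 1 ∧
      LinearMap.adjoint (Matrix.toEuclideanLin A) (Matrix.toEuclideanLin A v) =
        ((minPosSingularValue A ^ 2 : ℝ) : ℂ) • v := by
  let T := Matrix.toEuclideanLin A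
  obtain ⟨-, i, hi, h⟩ := minPosSingularValue_mem hA
  have hn : Module.finrank ℂ (EuclideanSpace ℂ (Fin d)) = d := by simp
  let b := T.isSymmetric_adjoint_comp_self.eigenvectorBasis hn
  refine ⟨b ⟨i, hi⟩, b.norm_eq_one _, ?_⟩
  rw [h, LinearMap.sq_singularValues_of_lt _ hn hi]
  exact T.isSymmetric_adjoint_comp_self.apply_eigenvectorBasis hn ⟨i, hi⟩

/-- In an eigenbasis of `AᴴA` the components of `w` along eigenvectors with singular value zero
vanish by `hw`; the others are stretched at least by the smallest non-zero singular value. -/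
theorem minPosSingularValue_mul_norm_le (A : Matrix (Fin d) (Fin d) ℂ)
    {w : EuclideanSpace ℂ (Fin d)}
    (hw : ∀ v, Matrix.toEuclideanLin A v = 0 → inner ℂ v w = 0) :
    minPosSingularValue A ^ 2 * ‖w‖ ^ 2 ≤ ‖Matrix.toEuclideanLin A w‖ ^ 2 := by
  let T := Matrix.toEuclideanLin A
  have hn : Module.finrank ℂ (EuclideanSpace ℂ (Fin d)) = d := by simp
  let b := T.isSymmetric_adjoint_comp_self.eigenvectorBasis hn
  have hb : ∀ i : Fin d, LinearMap.adjoint T (T (b i)) =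
      ((T.singularValues i ^ 2 : ℝ) : ℂ) • b i := fun i => by
    rw [LinearMap.sq_singularValues_fin _ hn i]
    exact T.isSymmetric_adjoint_comp_self.apply_eigenvectorBasis hn i
  have h1 : ‖w‖ ^ 2 = ∑ i, ‖inner ℂ (b i) w‖ ^ 2 := (b.sum_sq_norm_inner_right w).symm
  have h2 : ‖T w‖ ^ 2 = ∑ i : Fin d, T.singularValues i ^ 2 * ‖inner ℂ (b i) w‖ ^ 2 := by
    have h3 : ((‖T w‖ ^ 2 : ℝ) : ℂ) =
        ((∑ i : Fin d, T.singularValues i ^ 2 * ‖inner ℂ (b i) w‖ ^ 2 : ℝ) : ℂ) := by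
      have h4 : ((‖T w‖ ^ 2 : ℝ) : ℂ) = inner ℂ w (LinearMap.adjoint T (T w)) := by
        rw [LinearMap.adjoint_inner_right, inner_self_eq_norm_sq_to_K]
        simp
      rw [h4, ← b.sum_inner_mul_inner]
      push_cast
      refine Finset.sum_congr rfl fun i _ => ?_
      have h5 : inner ℂ (b i) (LinearMap.adjoint T (T w)) =
          ((T.singularValues i ^ 2 : ℝ) : ℂ) * inner ℂ (b i) w := by
        rw [LinearMap.adjoint_inner_right, ← LinearMap.adjoint_inner_left, hb, inner_smul_left,
          Complex.conj_ofReal]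
      have h6 : inner ℂ w (b i) * inner ℂ (b i) w = ((‖inner ℂ (b i) w‖ : ℝ) : ℂ) ^ 2 := by
        rw [← inner_conj_symm w (b i)]
        exact Complex.conj_mul' _
      rw [h5, mul_left_comm, h6]
      push_cast
      rfl
    exact_mod_cast h3
  rw [h1, h2, Finset.mul_sum]
  refine Finset.sum_le_sum fun i _ => ?_
  by_cases hs : T.singularValues i = 0
  · have hker : T (b i) = 0 := by
      rw [← inner_self_eq_zero (𝕜 := ℂ), ← LinearMap.adjoint_inner_right, hb, hs]
      simp
    rw [hw _ hker]
    simp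
  · gcongr
    · by_cases hA : A = 0
      · exact absurd (by simp [T, hA]) hs
      · exact (minPosSingularValue_pos hA).le
    · exact minPosSingularValue_le A i.2 hs

theorem hsSq_eq_sum_col (U : Matrix (Fin d) (Fin d) ℂ) :
    hsSq U = ∑ j, ‖WithLp.toLp 2 (fun i => U i j)‖ ^ 2 := by
  rw [hsSq, Finset.sum_comm]
  simp only [EuclideanSpace.norm_sq_eq]

theorem toEuclideanLin_col (A U : Matrix (Fin d) (Fin d) ℂ) (j : Fin d) :
    Matrix.toEuclideanLin A (WithLp.toLp 2 fun i => U i j) =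
      WithLp.toLp 2 fun i => (A * U) i j := by
  rfl

theorem trace_mul_conjTranspose_col (U : Matrix (Fin d) (Fin d) ℂ) (x : Fin d → ℂ) (j : Fin d) :
    Matrix.trace (U * (Matrix.of fun i k => if k = j then x i else 0)ᴴ) =
      inner ℂ (WithLp.toLp 2 x) (WithLp.toLp 2 fun i => U i j) := by
  simp only [Matrix.trace, Matrix.diag_apply, Matrix.mul_apply, Matrix.conjTranspose_apply,
    Matrix.of_apply, PiLp.inner_apply]
  refine Finset.sum_congr rfl fun i _ => ?_
  simp [apply_ite]

/-- Applied to matrices `B` with a single non-zero column, `hU` says that each column of `U` is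
orthogonal to the kernel of `A`. -/
theorem minPosSingularValue_mul_hsSq_le (A : Matrix (Fin d) (Fin d) ℂ)
    {U : Matrix (Fin d) (Fin d) ℂ}
    (hU : ∀ B : Matrix (Fin d) (Fin d) ℂ, A * B = 0 → Matrix.trace (U * Bᴴ) = 0) :
    minPosSingularValue A ^ 2 * hsSq U ≤ hsSq (A * U) := by
  rw [hsSq_eq_sum_col, hsSq_eq_sum_col, Finset.mul_sum]
  refine Finset.sum_le_sum fun j _ => ?_
  rw [← toEuclideanLin_col]
  refine minPosSingularValue_mul_norm_le A fun v hv => ?_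
  rw [← trace_mul_conjTranspose_col U v.ofLp j]
  refine hU _ ?_
  have hv' : ∀ i, (A *ᵥ v.ofLp) i = 0 := fun i => congrArg (fun w => w.ofLp i) hv
  ext i k
  rw [Matrix.mul_apply]
  by_cases hk : k = j
  · refine Eq.trans ?_ (hv' i)
    simp [hk, Matrix.mulVec, dotProduct]
  · simp [hk]

/-- The extremal case of the preceding bound: one column of `V` is a right singular vector `v`, the
others are zero. As `AᴴA v` is a non-zero multiple of `v`, `v` is orthogonal to the kernel of `A`.
-/
theorem exists_hsSq_eq_minPosSingularValue {A : Matrix (Fin d) (Fin d) ℂ} (hA : A ≠ 0) :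
    ∃ V : Matrix (Fin d) (Fin d) ℂ, hsSq V = 1 ∧ hsSq (A * V) = minPosSingularValue A ^ 2 ∧
      ∀ B : Matrix (Fin d) (Fin d) ℂ, A * B = 0 → Matrix.trace (V * Bᴴ) = 0 := by
  obtain ⟨v, hv1, hv⟩ := exists_adjoint_comp_self_eq hA
  let T := Matrix.toEuclideanLin A
  have hd : 0 < d := by
    rcases Nat.eq_zero_or_pos d with rfl | h
    · exact absurd (Subsingleton.elim A 0) hA
    · exact h
  let j : Fin d := ⟨0, hd⟩
  let V : Matrix (Fin d) (Fin d) ℂ := Matrix.of fun i k => if k = j then v.ofLp i else 0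
  have hcol : ∀ k, (WithLp.toLp 2 fun i => V i k : EuclideanSpace ℂ (Fin d)) =
      if k = j then v else 0 := by
    intro k
    by_cases hk : k = j
    · simp [V, hk]
    · simp only [V, hk, Matrix.of_apply, if_false]
      rfl
  have hT : ‖T v‖ ^ 2 = minPosSingularValue A ^ 2 := by
    have h1 : ((‖T v‖ ^ 2 : ℝ) : ℂ) = ((minPosSingularValue A ^ 2 : ℝ) : ℂ) := by
      have h4 : ((‖T v‖ ^ 2 : ℝ) : ℂ) = inner ℂ v (LinearMap.adjoint T (T v)) := by
        rw [LinearMap.adjoint_inner_right, inner_self_eq_norm_sq_to_K]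
        simp
      rw [h4, hv, inner_smul_right, inner_self_eq_norm_sq_to_K, hv1]
      simp
    exact_mod_cast h1
  refine ⟨V, ?_, ?_, fun B hB => ?_⟩
  · rw [hsSq_eq_sum_col, Finset.sum_eq_single j]
    · rw [hcol, if_pos rfl, hv1, one_pow]
    · intro k _ hk
      rw [hcol, if_neg hk]
      simp
    · simp
  · rw [hsSq_eq_sum_col, Finset.sum_eq_single j]
    · rw [← toEuclideanLin_col, hcol, if_pos rfl]
      exact hT
    · intro k _ hk
      rw [← toEuclideanLin_col, hcol, if_neg hk]
      simp
    · simp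
  · have h0 := minPosSingularValue_pos hA
    let x : EuclideanSpace ℂ (Fin d) := WithLp.toLp 2 fun i => B i j
    have hx : T x = 0 := by
      change Matrix.toEuclideanLin A x = 0
      rw [toEuclideanLin_col, hB]
      rfl
    have hvx : inner ℂ v x = 0 := by
      have h1 : inner ℂ (LinearMap.adjoint T (T v)) x = 0 := by
        rw [LinearMap.adjoint_inner_left, hx, inner_zero_right]
      rw [hv, inner_smul_left] at h1
      have h2 : ((minPosSingularValue A ^ 2 : ℝ) : ℂ) ≠ 0 := by exact_mod_cast (pow_pos h0 2).ne'
      exact (mul_eq_zero.1 h1).resolve_left (by simpa using h2)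
    have h3 := trace_mul_conjTranspose_col B v.ofLp j
    have h4 : Matrix.trace (V * Bᴴ) = star (Matrix.trace (B * Vᴴ)) := by
      rw [← Matrix.trace_conjTranspose, Matrix.conjTranspose_mul,
        Matrix.conjTranspose_conjTranspose]
    rw [h4, h3]
    exact (congrArg star hvx).trans (star_zero _)

theorem hsSq_unitary_mul_mul {d' : ℕ} {T : Matrix (Fin d') (Fin d) ℂ} (h1 : Tᴴ * T = 1)
    (A : Matrix (Fin d) (Fin d) ℂ) : hsSq (T * A * Tᴴ) = hsSq A := by
  have h : ((hsSq (T * A * Tᴴ) : ℝ) : ℂ) = ((hsSq A : ℝ) : ℂ) := by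
    rw [ofReal_hsSq_eq_trace, ofReal_hsSq_eq_trace]
    calc _ = Matrix.trace (T * (Aᴴ * ((Tᴴ * T) * (A * Tᴴ)))) := by
          simp only [Matrix.conjTranspose_mul, Matrix.conjTranspose_conjTranspose, Matrix.mul_assoc]
      _ = Matrix.trace ((Aᴴ * A * Tᴴ) * T) := by
          rw [h1, Matrix.one_mul, Matrix.trace_mul_comm]
          simp only [Matrix.mul_assoc]
      _ = _ := by rw [Matrix.mul_assoc, h1, Matrix.mul_one]
  exact_mod_cast h

/-- The extremal `V` for `A`, conjugated by `T`, is admissible in the lower bound for `T * A * Tᴴ`.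
This inequality transfers a bound from a chosen representative to its whole class. -/
theorem minPosSingularValue_le_of_conj {d' : ℕ} {T : Matrix (Fin d') (Fin d) ℂ} (h1 : Tᴴ * T = 1)
    {A : Matrix (Fin d) (Fin d) ℂ} (hA : A ≠ 0) :
    minPosSingularValue (T * A * Tᴴ) ≤ minPosSingularValue A := by
  obtain ⟨V, hV1, hV2, hV3⟩ := exists_hsSq_eq_minPosSingularValue hA
  have hmul : T * A * Tᴴ * (T * V * Tᴴ) = T * (A * V) * Tᴴ := by
    calc _ = T * A * (Tᴴ * T) * V * Tᴴ := by simp only [Matrix.mul_assoc]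
      _ = _ := by rw [h1, Matrix.mul_one]; simp only [Matrix.mul_assoc]
  have h3 := minPosSingularValue_mul_hsSq_le (T * A * Tᴴ) (U := T * V * Tᴴ) fun B hB => by
    have h4 : A * (Tᴴ * B * T) = 0 := by
      calc A * (Tᴴ * B * T) = (Tᴴ * T) * (A * (Tᴴ * B * T)) := by rw [h1, Matrix.one_mul]
        _ = Tᴴ * (T * A * Tᴴ * B) * T := by simp only [Matrix.mul_assoc]
        _ = 0 := by rw [hB]; simp
    have h5 := hV3 _ h4
    rw [← h5]
    simp only [Matrix.conjTranspose_mul, Matrix.conjTranspose_conjTranspose]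
    rw [Matrix.mul_assoc, Matrix.mul_assoc, Matrix.trace_mul_comm]
    simp only [Matrix.mul_assoc]
  rw [hmul, hsSq_unitary_mul_mul h1, hsSq_unitary_mul_mul h1, hV1, hV2, mul_one] at h3
  exact le_of_sq_le_sq h3 (minPosSingularValue_pos hA).le

end SingularValues

/-! ### Poincaré inequalities and symbols -/

theorem tsum_mul_rpow_le {ι : Type*} (f g : ι → ℝ≥0∞) {p q : ℝ} (hp : 0 ≤ p) (hq : 0 ≤ q)
    (hpq : p + q = 1) : ∑' i, f i ^ p * g i ^ q ≤ (∑' i, f i) ^ p * (∑' i, g i) ^ q := by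
  let : MeasurableSpace ι := ⊤
  have := ENNReal.lintegral_mul_norm_pow_le (μ := Measure.count) (f := f) (g := g)
    measurable_from_top.aemeasurable measurable_from_top.aemeasurable hp hq hpq
  simpa only [lintegral_count] using this

/-- Interpolation within one block: the exponents `2 (δ-1)/δ` and `-2 (δ-1)/δ` of `J` cancel. For `δ
= 1` the factor in `y` has exponent zero, so no bound on `y` is needed. -/
theorem le_rpow_mul_rpow {w y z J δ : ℝ} (hδ : 1 ≤ δ) (hw : 0 ≤ w) (hJ : 0 < J)
    (h1 : 1 < δ → w * J ^ 2 ≤ y) (h2 : w * J ^ (-(2 * (δ - 1))) ≤ z) :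
    w ≤ y ^ ((δ - 1) / δ) * z ^ (1 / δ) := by
  rcases hδ.eq_or_lt with rfl | hδ
  · simpa using h2
  have hδ0 : 0 < δ := by linarith
  have hp : 0 ≤ (δ - 1) / δ := div_nonneg (by linarith) hδ0.le
  have hq : 0 ≤ 1 / δ := by positivity
  have hJ2 : 0 ≤ J ^ (-(2 * (δ - 1))) := Real.rpow_nonneg hJ.le _
  calc w = w ^ ((δ - 1) / δ) * w ^ (1 / δ) := by
        rw [← Real.rpow_add_of_nonneg hw hp hq]
        have : (δ - 1) / δ + 1 / δ = 1 := by field_simp; ring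
        rw [this, Real.rpow_one]
    _ = (w * J ^ 2) ^ ((δ - 1) / δ) * (w * J ^ (-(2 * (δ - 1)))) ^ (1 / δ) := by
        rw [Real.mul_rpow hw (by positivity), Real.mul_rpow hw hJ2, mul_mul_mul_comm,
          ← Real.rpow_natCast, ← Real.rpow_mul hJ.le, ← Real.rpow_mul hJ.le, ← Real.rpow_add hJ]
        have : ((2 : ℕ) : ℝ) * ((δ - 1) / δ) + -(2 * (δ - 1)) * (1 / δ) = 0 := by
          push_cast
          field_simp
          ring
        rw [this, Real.rpow_zero, mul_one]
    _ ≤ y ^ ((δ - 1) / δ) * z ^ (1 / δ) := by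
        have := h1 hδ
        have hy : 0 ≤ y := le_trans (by positivity) this
        gcongr

/-! ### The trivial block, and the equivalence for operators acting blockwise -/

section Trivial

variable {E : Type*} [NormedAddCommGroup E] [NormedSpace ℝ E] [FiniteDimensional ℝ E]
  {G : Type*} [TopologicalSpace G] [T2Space G] [CompactSpace G]
  [ChartedSpace E G] [Group G] [LieGroup 𝓘(ℝ, E) ∞ G] [IsTopologicalGroup G]

theorem smoothCoeff_trivialIrrep (i j : Fin (trivialIrrep G).dim) :
    (trivialIrrep G).smoothCoeff E i j = SmoothFn.one E G := by
  refine SmoothFn.ext fun x => ?_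
  have h1 : Subsingleton (Fin (trivialIrrep G).dim) := inferInstanceAs (Subsingleton (Fin 1))
  rw [UnitaryIrrep.smoothCoeff_apply, trivialIrrep_mat, Subsingleton.elim i j,
    Matrix.one_apply_eq]
  rfl

theorem fourierCoeff_trivialIrrep_apply (u : Distrib E G) (i j : Fin (trivialIrrep G).dim) :
    fourierCoeff u (trivialIrrep G) i j = u (SmoothFn.one E G) := by
  rw [fourierCoeff_apply, smoothCoeff_trivialIrrep]
  congr 1
  exact SmoothFn.ext fun x => by simp

theorem UnitaryDual.not_trivial_equiv {c : UnitaryDual G}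
    (hc : c ≠ UnitaryDual.mk (trivialIrrep G)) :
    ¬ (unitaryIrrepSetoid G).r (trivialIrrep G) c.rep := fun h => hc (by
  rw [← Quotient.out_eq c]
  exact (Quotient.sound h).symm)

theorem apply_one_eq_zero_iff (u : Distrib E G) :
    u (SmoothFn.one E G) = 0 ↔ fourierCoeff u (UnitaryDual.mk (trivialIrrep G)).rep = 0 := by
  obtain ⟨T, h1, h2, h⟩ := UnitaryDual.rep_equiv (trivialIrrep G)
  obtain ⟨S, k1, k2, k⟩ := (unitaryIrrepSetoid G).symm (UnitaryDual.rep_equiv (trivialIrrep G))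
  constructor
  · intro hu
    have : fourierCoeff u (trivialIrrep G) = 0 := by
      ext i j
      rw [fourierCoeff_trivialIrrep_apply, hu]
      rfl
    rw [fourierCoeff_equiv u k2 k, this]
    simp
  · intro hu
    rw [← fourierCoeff_trivialIrrep_apply u 0 0, fourierCoeff_equiv u h2 h, hu]
    simp

theorem map_one_eq_zero_iff_symbol {P : SmoothFn E G →ₗ[ℂ] SmoothFn E G} (hP : IsLeftInvariant P) :
    P (SmoothFn.one E G) = 0 ↔ symbol P (trivialIrrep G) = 0 := by
  constructor
  · intro h
    ext i j
    rw [symbol_apply, smoothCoeff_trivialIrrep, h]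
    rfl
  · intro h
    rw [← smoothCoeff_trivialIrrep 0 0, hP.apply_smoothCoeff, h]
    simp

theorem symbol_leftInvField_trivialIrrep (v : GroupLieAlgebra 𝓘(ℝ, E) G) :
    symbol (leftInvField v : SmoothFn E G →ₗ[ℂ] SmoothFn E G) (trivialIrrep G) = 0 := by
  rw [← map_one_eq_zero_iff_symbol (isLeftInvariant_leftInvField v)]
  simpa using leftInvField_const (E := E) (G := G) v 1

theorem symbol_rep_eq_zero_iff (P : SmoothFn E G →ₗ[ℂ] SmoothFn E G) (ξ : UnitaryIrrep G) :
    symbol P (UnitaryDual.mk ξ).rep = 0 ↔ symbol P ξ = 0 := by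
  obtain ⟨T, h1, h2, h⟩ := UnitaryDual.rep_equiv ξ
  obtain ⟨S, k1, k2, k⟩ := (unitaryIrrepSetoid G).symm (UnitaryDual.rep_equiv ξ)
  constructor
  · intro hz
    rw [symbol_equiv P h2 h, hz]
    simp
  · intro hz
    rw [symbol_equiv P k2 k, hz]
    simp

theorem minPosSingularValue_symbol_rep_le (P : SmoothFn E G →ₗ[ℂ] SmoothFn E G)
    {ξ : UnitaryIrrep G} (hξ : symbol P ξ ≠ 0) :
    minPosSingularValue (symbol P (UnitaryDual.mk ξ).rep) ≤ minPosSingularValue (symbol P ξ) := by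
  obtain ⟨T, h1, h2, h⟩ := (unitaryIrrepSetoid G).symm (UnitaryDual.rep_equiv ξ)
  rw [symbol_equiv P h2 h]
  exact minPosSingularValue_le_of_conj h1 hξ

variable {g : Bundle.ContMDiffRiemannianMetric 𝓘(ℝ, E) ∞ E (fun x : G => TangentSpace 𝓘(ℝ, E) x)}
  {n : ℕ} {X : Module.Basis (Fin n) ℝ (GroupLieAlgebra 𝓘(ℝ, E) G)}

theorem nu_trivialIrrep (hg : IsBiInvariant g)
    (hX : ∀ i j, g.inner 1 (X i) (X j) = if i = j then 1 else 0) :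
    nu X (trivialIrrep G) = 0 := by
  have h := sum_conjTranspose_mul_fieldSymbol hg hX (trivialIrrep G)
  simp only [fieldSymbol_eq, symbol_leftInvField_trivialIrrep, Matrix.mul_zero,
    Finset.sum_const_zero] at h
  have := congrFun (congrFun h 0) 0
  simpa using this.symm

theorem japaneseBracket_rep (hg : IsBiInvariant g)
    (hX : ∀ i j, g.inner 1 (X i) (X j) = if i = j then 1 else 0) (ξ : UnitaryIrrep G) :
    japaneseBracket X (UnitaryDual.mk ξ).rep = japaneseBracket X ξ := by
  rw [japaneseBracket, japaneseBracket, nu_equiv hg hX (UnitaryDual.rep_equiv ξ)]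

variable [MeasurableSpace G] [BorelSpace G]
  (μ : Measure G) [μ.IsHaarMeasure] [IsProbabilityMeasure μ]

theorem memSobolev_trigSingle (s : ℝ) (c : UnitaryDual G)
    (A : Matrix (Fin c.rep.dim) (Fin c.rep.dim) ℂ) :
    MemSobolev X s (ofSmooth μ (trigSingle c A : SmoothFn E G)) := by
  rw [memSobolev_iff, tsum_eq_single c]
  · exact ENNReal.ofReal_ne_top
  · intro c' hc'
    rw [fourierCoeff_trigSingle_of_ne μ hc', hsSq_zero]
    simp

variable {P : SmoothFn E G →ₗ[ℂ] SmoothFn E G} {T : Distrib E G → Distrib E G}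

/-- The trigonometric polynomial with the single block `B` is in the kernel of `T`, and its `H^1`
inner product with `f` is a positive multiple of this trace. -/
theorem trace_eq_zero_of_mem_kerPerp (μ : Measure G) [μ.IsHaarMeasure] [IsProbabilityMeasure μ]
    (hg : IsBiInvariant g)
    (hX : ∀ i j, g.inner 1 (X i) (X j) = if i = j then 1 else 0)
    (hT : ∀ u, MemSobolev X 1 u → ∀ c : UnitaryDual G,
      fourierCoeff (T u) c.rep = symbol P c.rep * fourierCoeff u c.rep)
    {f : Distrib E G} (hf : f ∈ kerPerp X T) (c : UnitaryDual G)
    {B : Matrix (Fin c.rep.dim) (Fin c.rep.dim) ℂ} (hB : symbol P c.rep * B = 0) :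
    Matrix.trace (fourierCoeff f c.rep * Bᴴ) = 0 := by
  have hmem := memSobolev_trigSingle (X := X) (E := E) μ 1 c B
  have hTu : T (ofSmooth μ (trigSingle c B)) = 0 := by
    refine distrib_ext_fourierCoeff fun c' => ?_
    rw [hT _ hmem, fourierCoeff_zero]
    by_cases hc : c' = c
    · subst hc
      rw [fourierCoeff_trigSingle_self, hB]
    · rw [fourierCoeff_trigSingle_of_ne μ hc, Matrix.mul_zero]
  have h := hf.2 _ hmem hTu
  rw [sobolevInner, tsum_eq_single c] at h
  · rw [fourierCoeff_trigSingle_self] at h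
    refine (mul_eq_zero.1 h).resolve_left ?_
    have : 0 < c.rep.dim * japaneseBracket X c.rep ^ (2 * (1 : ℝ)) :=
      mul_pos (by exact_mod_cast c.rep.dim_pos)
        (Real.rpow_pos_of_pos (japaneseBracket_pos hg hX _) _)
    exact_mod_cast this.ne'
  · intro c' hc'
    rw [fourierCoeff_trigSingle_of_ne μ hc']
    simp

theorem hsSq_eq_zero_iff {d : ℕ} {A : Matrix (Fin d) (Fin d) ℂ} : hsSq A = 0 ↔ A = 0 := by
  refine ⟨fun h => ?_, fun h => h ▸ hsSq_zero⟩
  ext i j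
  have h1 := norm_apply_sq_le_hsSq A i j
  rw [h] at h1
  have h2 : ‖A i j‖ = 0 := by nlinarith [norm_nonneg (A i j)]
  simpa using h2

/-- A lower bound for the symbol implies the Poincaré inequality. -/
theorem poincare_of_symbol [ConnectedSpace G] (hg : IsBiInvariant g)
    (hX : ∀ i j, g.inner 1 (X i) (X j) = if i = j then 1 else 0)
    (hT : ∀ u, MemSobolev X 1 u → ∀ c : UnitaryDual G,
      fourierCoeff (T u) c.rep = symbol P c.rep * fourierCoeff u c.rep)
    {δ : ℝ} (hδ : 1 ≤ δ) {C : ℝ} (hC : 0 < C)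
    (h : ∀ ξ : UnitaryIrrep G, symbol P ξ ≠ 0 →
      C * japaneseBracket X ξ ^ (-(δ - 1)) ≤ minPosSingularValue (symbol P ξ)) :
    ∃ c : ℝ, 0 < c ∧ ∀ f ∈ kerPerp X T,
      (1 < δ → symbol P (trivialIrrep G) ≠ 0 → f (SmoothFn.one E G) = 0) →
      ENNReal.ofReal c * l2Norm μ f ^ δ ≤ gradNorm μ X f ^ (δ - 1) * l2Norm μ (T f) := by
  obtain ⟨ν₀, hν₀, hgap⟩ := exists_pos_le_nu μ hg hX
  -- The gap gives `1 + ν ≤ M ν` off the trivial representation.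
  let M : ℝ := 1 + ν₀⁻¹
  have hM : 0 < M := by positivity
  -- What the constants `M` and `C⁻²` become after Hölder and the final power `δ / 2`.
  let K : ℝ := M ^ ((δ - 1) / 2) * C⁻¹
  have hK : 0 < K := mul_pos (Real.rpow_pos_of_pos hM _) (by positivity)
  refine ⟨K⁻¹, by positivity, fun f hf hf0 => ?_⟩
  have hδ0 : 0 < δ := by linarith
  let a := fun c : UnitaryDual G => fourierCoeff f c.rep
  let w := fun c : UnitaryDual G => (c.rep.dim : ℝ) * hsSq (a c)
  let y := fun c : UnitaryDual G => (c.rep.dim : ℝ) * (nu X c.rep * hsSq (a c))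
  let z := fun c : UnitaryDual G => (c.rep.dim : ℝ) * hsSq (symbol P c.rep * a c)
  have hw : ∀ c, 0 ≤ w c := fun c => mul_nonneg (Nat.cast_nonneg _) (hsSq_nonneg _)
  have hz : ∀ c, 0 ≤ z c := fun c => mul_nonneg (Nat.cast_nonneg _) (hsSq_nonneg _)
  have hy : ∀ c, 0 ≤ y c := fun c => mul_nonneg (Nat.cast_nonneg _)
    (mul_nonneg (nu_nonneg hg hX _) (hsSq_nonneg _))
  have htr : ∀ c B, symbol P c.rep * B = 0 → Matrix.trace (a c * Bᴴ) = 0 := fun c B hB =>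
    trace_eq_zero_of_mem_kerPerp μ hg hX hT hf c hB
  -- If the symbol vanishes, every matrix is admissible in `htr`, in particular the coefficient
  -- itself.
  have hzero : ∀ c, symbol P c.rep = 0 → a c = 0 := by
    intro c hc
    have h1 := htr c (a c) (by rw [hc, Matrix.zero_mul])
    rw [Matrix.trace_mul_comm, ← ofReal_hsSq_eq_trace] at h1
    exact hsSq_eq_zero_iff.1 (by exact_mod_cast h1)
  have hwy : 1 < δ → ∀ c, w c * japaneseBracket X c.rep ^ 2 ≤ M * y c := by
    intro h1δ c
    rw [japaneseBracket_sq hg hX]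
    by_cases hc : c = UnitaryDual.mk (trivialIrrep G)
    · have ha : a c = 0 := by
        by_cases hs : symbol P (trivialIrrep G) = 0
        · refine hzero c ?_
          rw [hc]
          exact (symbol_rep_eq_zero_iff P _).2 hs
        · have := (apply_one_eq_zero_iff f).1 (hf0 h1δ hs)
          rw [← hc] at this
          exact this
      simp [w, y, ha, hsSq_zero]
    · have h1 := hgap c.rep (UnitaryDual.not_trivial_equiv hc)
      have h2 : 1 + nu X c.rep ≤ M * nu X c.rep := by
        have : 1 ≤ ν₀⁻¹ * nu X c.rep := by
          rw [inv_mul_eq_div, one_le_div hν₀]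
          exact h1
        simp only [M]
        linarith
      calc w c * (1 + nu X c.rep) ≤ w c * (M * nu X c.rep) :=
            mul_le_mul_of_nonneg_left h2 (hw c)
        _ = M * y c := by simp only [w, y]; ring
  have hwz : ∀ c, w c * japaneseBracket X c.rep ^ (-(2 * (δ - 1))) ≤ (C ^ 2)⁻¹ * z c := by
    intro c
    by_cases hs : symbol P c.rep = 0
    · have ha := hzero c hs
      simp [w, z, ha, hsSq_zero]
    · have h1 := h c.rep hs
      have hJ := japaneseBracket_pos hg hX c.rep
      have h2 := minPosSingularValue_mul_hsSq_le (symbol P c.rep) (htr c)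
      have h3 : C ^ 2 * japaneseBracket X c.rep ^ (-(2 * (δ - 1))) ≤
          minPosSingularValue (symbol P c.rep) ^ 2 := by
        have h4 : C ^ 2 * japaneseBracket X c.rep ^ (-(2 * (δ - 1))) =
            (C * japaneseBracket X c.rep ^ (-(δ - 1))) ^ 2 := by
          rw [mul_pow, ← Real.rpow_natCast, ← Real.rpow_natCast, ← Real.rpow_mul hJ.le]
          congr 2
          push_cast
          ring
        rw [h4]
        exact pow_le_pow_left₀ (mul_nonneg hC.le (Real.rpow_nonneg hJ.le _)) h1 2
      rw [inv_mul_eq_div, le_div_iff₀ (by positivity)]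
      calc w c * japaneseBracket X c.rep ^ (-(2 * (δ - 1))) * C ^ 2
          = w c * (C ^ 2 * japaneseBracket X c.rep ^ (-(2 * (δ - 1)))) := by ring
        _ ≤ w c * minPosSingularValue (symbol P c.rep) ^ 2 :=
            mul_le_mul_of_nonneg_left h3 (hw c)
        _ = c.rep.dim * (minPosSingularValue (symbol P c.rep) ^ 2 * hsSq (a c)) := by
            simp only [w]; ring
        _ ≤ z c := mul_le_mul_of_nonneg_left h2 (Nat.cast_nonneg _)
  have hp : 0 ≤ (δ - 1) / δ := div_nonneg (by linarith) hδ0.le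
  have hq : 0 ≤ 1 / δ := by positivity
  have hterm : ∀ c, ENNReal.ofReal (w c) ≤
      (ENNReal.ofReal M * ENNReal.ofReal (y c)) ^ ((δ - 1) / δ) *
        (ENNReal.ofReal (C ^ 2)⁻¹ * ENNReal.ofReal (z c)) ^ (1 / δ) := by
    intro c
    rw [← ENNReal.ofReal_mul hM.le, ← ENNReal.ofReal_mul (by positivity),
      ENNReal.ofReal_rpow_of_nonneg (mul_nonneg hM.le (hy c)) hp,
      ENNReal.ofReal_rpow_of_nonneg (mul_nonneg (by positivity) (hz c)) hq,
      ← ENNReal.ofReal_mul (Real.rpow_nonneg (mul_nonneg hM.le (hy c)) _)]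
    exact ENNReal.ofReal_le_ofReal (le_rpow_mul_rpow hδ (hw c) (japaneseBracket_pos hg hX c.rep)
      (fun h1δ => hwy h1δ c) (hwz c))
  have hsum : ∑' c, ENNReal.ofReal (w c) ≤
      (ENNReal.ofReal M * ∑' c, ENNReal.ofReal (y c)) ^ ((δ - 1) / δ) *
        (ENNReal.ofReal (C ^ 2)⁻¹ * ∑' c, ENNReal.ofReal (z c)) ^ (1 / δ) := by
    rw [← ENNReal.tsum_mul_left, ← ENNReal.tsum_mul_left]
    refine (ENNReal.tsum_le_tsum hterm).trans (tsum_mul_rpow_le _ _ hp hq ?_)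
    field_simp
    ring
  have hl2 : l2Norm μ f = (∑' c, ENNReal.ofReal (w c)) ^ (1 / 2 : ℝ) := l2Norm_eq μ f
  have hgr : gradNorm μ X f = (∑' c, ENNReal.ofReal (y c)) ^ (1 / 2 : ℝ) := gradNorm_eq μ hg hX f
  have hTf : l2Norm μ (T f) = (∑' c, ENNReal.ofReal (z c)) ^ (1 / 2 : ℝ) := by
    rw [l2Norm_eq]
    simp only [hT f hf.1]
    rfl
  rw [hl2, hgr, hTf, ← ENNReal.rpow_mul, ← ENNReal.rpow_mul]
  have hfin := ENNReal.rpow_le_rpow hsum (show 0 ≤ 1 / 2 * δ by positivity)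
  rw [ENNReal.mul_rpow_of_nonneg _ _ (by positivity), ← ENNReal.rpow_mul,
    ← ENNReal.rpow_mul] at hfin
  have e1 : (δ - 1) / δ * (1 / 2 * δ) = 1 / 2 * (δ - 1) := by field_simp
  have e2 : 1 / δ * (1 / 2 * δ) = 1 / 2 := by field_simp
  rw [e1, e2, ENNReal.mul_rpow_of_nonneg _ _ (by linarith),
    ENNReal.mul_rpow_of_nonneg _ _ (by norm_num), mul_mul_mul_comm] at hfin
  have e3 : ENNReal.ofReal M ^ (1 / 2 * (δ - 1)) * ENNReal.ofReal (C ^ 2)⁻¹ ^ (1 / 2 : ℝ) =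
      ENNReal.ofReal K := by
    rw [ENNReal.ofReal_rpow_of_pos hM, ENNReal.ofReal_rpow_of_pos (by positivity),
      ← ENNReal.ofReal_mul (Real.rpow_nonneg hM.le _)]
    congr 2
    · congr 1
      ring
    · rw [← inv_pow, ← Real.sqrt_eq_rpow, Real.sqrt_sq (by positivity)]
  rw [e3] at hfin
  refine (mul_le_mul_right hfin _).trans (le_of_eq ?_)
  rw [← mul_assoc, ← ENNReal.ofReal_mul (by positivity), inv_mul_cancel₀ hK.ne', ENNReal.ofReal_one,
    one_mul]

/-- The Poincaré inequality implies a lower bound for the symbol. -/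
theorem symbol_of_poincare (hg : IsBiInvariant g)
    (hX : ∀ i j, g.inner 1 (X i) (X j) = if i = j then 1 else 0)
    (hT : ∀ u, MemSobolev X 1 u → ∀ c : UnitaryDual G,
      fourierCoeff (T u) c.rep = symbol P c.rep * fourierCoeff u c.rep)
    {δ : ℝ} (hδ : 1 ≤ δ) {k : ℝ} (hk : 0 < k)
    (h : ∀ f ∈ kerPerp X T,
      (1 < δ → symbol P (trivialIrrep G) ≠ 0 → f (SmoothFn.one E G) = 0) →
      ENNReal.ofReal k * l2Norm μ f ^ δ ≤ gradNorm μ X f ^ (δ - 1) * l2Norm μ (T f)) :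
    ∃ C : ℝ, 0 < C ∧ ∀ ξ : UnitaryIrrep G, symbol P ξ ≠ 0 →
      C * japaneseBracket X ξ ^ (-(δ - 1)) ≤ minPosSingularValue (symbol P ξ) := by
  classical
  let c₀ : UnitaryDual G := UnitaryDual.mk (trivialIrrep G)
  -- For `δ > 1` the inequality cannot be tested on constants if `P 1 ≠ 0`. That single block has
  -- `⟨ξ⟩ = 1`, and its own singular value serves as the constant.
  let l₀ : ℝ := if symbol P c₀.rep = 0 then 1 else minPosSingularValue (symbol P c₀.rep)
  have hl₀ : 0 < l₀ := by
    simp only [l₀]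
    split_ifs with h0
    · exact one_pos
    · exact minPosSingularValue_pos h0
  refine ⟨min k l₀, lt_min hk hl₀, fun ξ hξ => ?_⟩
  let c : UnitaryDual G := UnitaryDual.mk ξ
  have hc : symbol P c.rep ≠ 0 := fun h0 => hξ ((symbol_rep_eq_zero_iff P ξ).1 h0)
  refine le_trans ?_ (minPosSingularValue_symbol_rep_le P hξ)
  rw [← japaneseBracket_rep hg hX ξ]
  change min k l₀ * japaneseBracket X c.rep ^ (-(δ - 1)) ≤ minPosSingularValue (symbol P c.rep)
  have hJ := japaneseBracket_pos hg hX c.rep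
  have hpow : 0 ≤ japaneseBracket X c.rep ^ (-(δ - 1)) := Real.rpow_nonneg hJ.le _
  by_cases hcase : 1 < δ ∧ c = c₀
  · obtain ⟨-, hcc⟩ := hcase
    have hone : japaneseBracket X c.rep = 1 := by
      rw [hcc, japaneseBracket_rep hg hX, japaneseBracket, nu_trivialIrrep hg hX]
      simp
    rw [hone, Real.one_rpow, mul_one]
    refine (min_le_right _ _).trans (le_of_eq ?_)
    simp only [l₀]
    rw [← hcc, if_neg hc]
  · refine (mul_le_mul_of_nonneg_right (min_le_left k l₀) hpow).trans ?_
    obtain ⟨V, hV1, hV2, hV3⟩ := exists_hsSq_eq_minPosSingularValue hc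
    have hd : (0 : ℝ) < c.rep.dim := by exact_mod_cast c.rep.dim_pos
    have hl := minPosSingularValue_pos hc
    -- This factor offsets the weight `d_ξ` in Plancherel, so that the test function has `L²` norm
    -- one, gradient norm `√ν_ξ`, and an image of norm equal to the singular value.
    let r : ℂ := ((√c.rep.dim)⁻¹ : ℝ)
    have hr : ‖r‖ ^ 2 = (c.rep.dim : ℝ)⁻¹ := by
      rw [Complex.norm_real, Real.norm_eq_abs, sq_abs, inv_pow, Real.sq_sqrt hd.le]
    let f : Distrib E G := ofSmooth μ (trigSingle c (r • V))
    have hfc : fourierCoeff f c.rep = r • V := fourierCoeff_trigSingle_self μ c _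
    have hfne : ∀ c', c' ≠ c → fourierCoeff f c'.rep = 0 := fun c' hc' =>
      fourierCoeff_trigSingle_of_ne μ hc' _
    have hmem : MemSobolev X 1 f := memSobolev_trigSingle μ 1 c _
    have hker : f ∈ kerPerp X T := by
      refine ⟨hmem, fun u hu hTu => ?_⟩
      rw [sobolevInner, tsum_eq_single c]
      · have h1 := hT u hu c
        rw [hTu, fourierCoeff_zero] at h1
        rw [hfc, smul_mul_assoc, Matrix.trace_smul, hV3 _ h1.symm]
        simp
      · intro c' hc'
        rw [hfne c' hc']
        simp
    have hcond : 1 < δ → symbol P (trivialIrrep G) ≠ 0 → f (SmoothFn.one E G) = 0 := by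
      intro h1δ _
      rw [apply_one_eq_zero_iff]
      exact hfne _ fun he => hcase ⟨h1δ, he.symm⟩
    have hl2 : l2Norm μ f = 1 := by
      rw [l2Norm_eq, tsum_eq_single c]
      · rw [hfc, hsSq_smul, hV1, hr, mul_one, mul_inv_cancel₀ hd.ne']
        simp
      · intro c' hc'
        rw [hfne c' hc', hsSq_zero]
        simp
    have hgr : gradNorm μ X f = ENNReal.ofReal (nu X c.rep) ^ (1 / 2 : ℝ) := by
      rw [gradNorm_eq μ hg hX, tsum_eq_single c]
      · rw [hfc, hsSq_smul, hV1, hr]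
        congr 2
        field_simp
      · intro c' hc'
        rw [hfne c' hc', hsSq_zero]
        simp
    have hTf : l2Norm μ (T f) = ENNReal.ofReal (minPosSingularValue (symbol P c.rep)) := by
      rw [l2Norm_eq, tsum_eq_single c]
      · rw [hT f hmem, hfc, Matrix.mul_smul, hsSq_smul, hV2, hr,
          mul_inv_cancel_left₀ hd.ne', ENNReal.ofReal_rpow_of_pos (by positivity),
          ← Real.sqrt_eq_rpow, Real.sqrt_sq hl.le]
      · intro c' hc'
        rw [hT f hmem, hfne c' hc', Matrix.mul_zero, hsSq_zero]
        simp
    have hmain := h f hker hcond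
    rw [hl2, hgr, hTf, ENNReal.one_rpow, mul_one, ← ENNReal.rpow_mul,
      ENNReal.ofReal_rpow_of_nonneg (nu_nonneg hg hX _) (by linarith),
      ← ENNReal.ofReal_mul (Real.rpow_nonneg (nu_nonneg hg hX _) _),
      ENNReal.ofReal_le_ofReal_iff
        (mul_nonneg (Real.rpow_nonneg (nu_nonneg hg hX _) _) hl.le)] at hmain
    have hJd : nu X c.rep ^ (1 / 2 * (δ - 1)) ≤ japaneseBracket X c.rep ^ (δ - 1) := by
      rw [Real.rpow_mul (nu_nonneg hg hX _), ← Real.sqrt_eq_rpow]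
      refine Real.rpow_le_rpow (Real.sqrt_nonneg _) ?_ (by linarith)
      exact Real.sqrt_le_sqrt (by linarith)
    calc k * japaneseBracket X c.rep ^ (-(δ - 1))
        ≤ (japaneseBracket X c.rep ^ (δ - 1) * minPosSingularValue (symbol P c.rep)) *
            japaneseBracket X c.rep ^ (-(δ - 1)) :=
          mul_le_mul_of_nonneg_right
            (hmain.trans (mul_le_mul_of_nonneg_right hJd hl.le)) hpow
      _ = minPosSingularValue (symbol P c.rep) *
            (japaneseBracket X c.rep ^ (δ - 1) * japaneseBracket X c.rep ^ (-(δ - 1))) := by ring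
      _ = minPosSingularValue (symbol P c.rep) := by
          rw [← Real.rpow_add hJ, add_neg_cancel, Real.rpow_zero, mul_one]

/-- The operator `T` enters only through its blockwise action on `H^1`, so vector fields on
distributions and extensions of operators of order `m` are both covered. -/
theorem poincare_iff_symbol [ConnectedSpace G] (hg : IsBiInvariant g)
    (hX : ∀ i j, g.inner 1 (X i) (X j) = if i = j then 1 else 0)
    (hT : ∀ u, MemSobolev X 1 u → ∀ c : UnitaryDual G,
      fourierCoeff (T u) c.rep = symbol P c.rep * fourierCoeff u c.rep)
    {δ : ℝ} (hδ : 1 ≤ δ) :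
    (∃ c : ℝ, 0 < c ∧ ∀ f ∈ kerPerp X T,
      (1 < δ → symbol P (trivialIrrep G) ≠ 0 → f (SmoothFn.one E G) = 0) →
      ENNReal.ofReal c * l2Norm μ f ^ δ ≤ gradNorm μ X f ^ (δ - 1) * l2Norm μ (T f)) ↔
    ∃ C : ℝ, 0 < C ∧ ∀ ξ : UnitaryIrrep G, symbol P ξ ≠ 0 →
      C * japaneseBracket X ξ ^ (-(δ - 1)) ≤ minPosSingularValue (symbol P ξ) :=
  ⟨fun ⟨_, hc, h⟩ => symbol_of_poincare μ hg hX hT hδ hc h,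
    fun ⟨_, hC, h⟩ => poincare_of_symbol μ hg hX hT hδ hC h⟩

end Trivial

end LiePoincare

end

theorem mainTheorem1
    {E : Type*} [NormedAddCommGroup E] [NormedSpace ℝ E] [FiniteDimensional ℝ E]
    {G : Type*} [TopologicalSpace G] [T2Space G] [CompactSpace G] [ConnectedSpace G]
    [ChartedSpace E G] [Group G] [LieGroup 𝓘(ℝ, E) ∞ G]
    [MeasurableSpace G] [BorelSpace G]
    (μ : Measure G) [μ.IsHaarMeasure] [IsProbabilityMeasure μ]
    (g : Bundle.ContMDiffRiemannianMetric 𝓘(ℝ, E) ∞ E (fun x : G => TangentSpace 𝓘(ℝ, E) x))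
    (hg : LiePoincare.IsBiInvariant g)
    {n : ℕ} (X : Module.Basis (Fin n) ℝ (GroupLieAlgebra 𝓘(ℝ, E) G))
    (hX : ∀ i j, g.inner 1 (X i) (X j) = if i = j then 1 else 0)
    (δ : ℝ) (hδ : 1 ≤ δ) :
    (∀ α : Fin n → ℝ,
      (∃ c : ℝ, 0 < c ∧
        ∀ f ∈ LiePoincare.kerPerp X (LiePoincare.fieldDistrib (∑ j, α j • X j)),
          ENNReal.ofReal c * LiePoincare.l2Norm μ f ^ δ ≤
            LiePoincare.gradNorm μ X f ^ (δ - 1) *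
              LiePoincare.l2Norm μ (LiePoincare.fieldDistrib (∑ j, α j • X j) f)) ↔
      (∃ C : ℝ, 0 < C ∧
        ∀ ξ : LiePoincare.UnitaryIrrep G,
          LiePoincare.symbol (LiePoincare.leftInvField (∑ j, α j • X j)) ξ ≠ 0 →
            C * LiePoincare.japaneseBracket X ξ ^ (-(δ - 1)) ≤
              LiePoincare.minPosSingularValue
                (LiePoincare.symbol (LiePoincare.leftInvField (∑ j, α j • X j)) ξ))) ∧
    (∀ (P : LiePoincare.SmoothFn E G →L[ℂ] LiePoincare.SmoothFn E G) (m : ℝ),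
      LiePoincare.IsLeftInvariant (P : LiePoincare.SmoothFn E G →ₗ[ℂ] LiePoincare.SmoothFn E G) →
      LiePoincare.HasOrder μ X (P : LiePoincare.SmoothFn E G →ₗ[ℂ] LiePoincare.SmoothFn E G) m →
      ((∃ c : ℝ, 0 < c ∧
        ∀ f ∈ LiePoincare.kerPerp X (LiePoincare.extendH1 μ X P m),
          (1 < δ → P (LiePoincare.SmoothFn.one E G) ≠ 0 → f (LiePoincare.SmoothFn.one E G) = 0) →
          ENNReal.ofReal c * LiePoincare.l2Norm μ f ^ δ ≤
            LiePoincare.gradNorm μ X f ^ (δ - 1) *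
              LiePoincare.l2Norm μ (LiePoincare.extendH1 μ X P m f)) ↔
      (∃ C : ℝ, 0 < C ∧
        ∀ ξ : LiePoincare.UnitaryIrrep G,
          LiePoincare.symbol (P : LiePoincare.SmoothFn E G →ₗ[ℂ] LiePoincare.SmoothFn E G) ξ ≠ 0 →
            C * LiePoincare.japaneseBracket X ξ ^ (-(δ - 1)) ≤
              LiePoincare.minPosSingularValue (LiePoincare.symbol
                (P : LiePoincare.SmoothFn E G →ₗ[ℂ] LiePoincare.SmoothFn E G) ξ)))) := by
  have : IsTopologicalGroup G := topologicalGroup_of_lieGroup 𝓘(ℝ, E) ∞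
  refine ⟨fun α => ?_, fun P m hP hm => ?_⟩
  · rw [← LiePoincare.poincare_iff_symbol μ hg hX
      (fun u _ c => LiePoincare.fourierCoeff_fieldDistrib _ u c.rep) hδ]
    -- A vector field annihilates constants, so the mean-value condition is vacuous.
    simp only [LiePoincare.symbol_leftInvField_trivialIrrep, ne_eq, not_true_eq_false,
      false_imp_iff, imp_true_iff, true_imp_iff]
  · rw [← LiePoincare.poincare_iff_symbol μ hg hX
      (fun u hu c => LiePoincare.fourierCoeff_extendH1 μ hg hX hP hm hu c) hδ]
    simp only [ne_eq, ← LiePoincare.map_one_eq_zero_iff_symbol hP, ContinuousLinearMap.coe_coe]
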